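/- **Setting.** For $\theta\in\mathbb R^{d_\theta}$ let $\rho_\theta$ be an integrable, strictly positive function on $\mathbb R^{d_x}$. Write $\ell(\theta;x)=\log\rho_\theta(x)$, $Z_\theta=\int\rho_\theta(x)\,dx$, $\pi_\theta=\rho_\theta/Z_\theta$. Assume: $\theta\mapsto\pi_\theta(x)$ is differentiable for every $x$, and $\theta\mapsto Z_\theta$ is differentiable; $x\mapsto\pi_\theta(x)$ is twice continuously differentiable for every $\theta$; $\pi_\theta$ has finite second moment, depending continuously on $\theta$; the set $\arg\max_\theta Z_\theta$ is compact; $\ell$ is differentiable on $\mathbb R^{d_\theta}\times\mathbb R^{d_x}$ and, for constants $L_\theta,L_x\ge 0$, $$\|\nabla\ell(\theta;x)-\nabla\ell(\theta';x')\|\le L_\theta\|\theta-\theta'\|+L_x\|x-x'\|,\qquad \nabla\ell=(\nabla_\theta\ell,\nabla_x\ell).$$ Put $L=\max(L_\theta,L_x)$. Let $\mathcal P_2$ be the set of probability measures on $\mathbb R^{d_x}$ that are absolutely continuous with respect to Lebesgue measure and have finite second moment. For a probability measure $q$ let $$F(\theta,q)=\int\log\frac{q(x)}{\rho_\theta(x)}\,q(dx)\in(-\infty,+\infty]\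 \text{ if } q\ll\rho_\theta(dx),\qquad F(\theta,q)=+\infty\ \text{ otherwise},$$ and, if $q$ has an almost everywhere differentiable density, let $$I(\theta,q)=\Big\|\int\nabla_\theta\ell(\theta;x)\,q(dx)\Big\|^2+\int\Big\|\nabla_x\log\frac{q(x)}{\rho_\theta(x)}\Big\|^2q(dx)\in[0,\infty].$$ **Interpolation.** Let $h>0$, $k\in\mathbb N_0$, $t_-=kh$, $\theta_k\in\mathbb R^{d_\theta}$, $q_k\in\mathcal P_2$. On $[t_-,(k+1)h]$ let $$\vartheta_{t_-}=\theta_k,\quad d\vartheta_t=\Big(\int\nabla_\theta\ell(\theta_k;x)\,q_k(dx)\Big)dt,\qquad \mathrm{Law}(Z_{t_-})=q_k,\quad dZ_t=\nabla_x\ell(\hat\theta;Z_{t_-})\,dt+\sqrt2\,dW_t,$$ where $W$ is a standard Brownian motion in $\mathbb R^{d_x}$ whose increments after time $t_-$ are independent of $Z_{t_-}$, and where the frozen parameter $\hat\theta$ is either $\vartheta_{t_-}=\theta_k$ or $\vartheta_{(k+1)h}=\theta_{k+1}:=\theta_k+h\int\nabla_\theta\ell(\theta_k;x)q_k(dx)$.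 Let $p_t=\mathrm{Law}(Z_t)$. **Lemma (descent lemma on $\mathcal M_2=\mathbb R^{d_\theta}\times\mathcal P_2$).** Suppose $h\le 1/(4L)$ (that is, $4Lh\le1$). Then, for either choice of $\hat\theta$: 1. For every $t\in(t_-,(k+1)h]$, $p_t$ belongs to $\mathcal P_2$ and has an almost everywhere differentiable density, $F(\vartheta_t,p_t)$ is finite, $s\mapsto F(\vartheta_s,p_s)$ is differentiable at $t$ (from the left if $t=(k+1)h$), and $$\partial_tF(\vartheta_t,p_t)\le-\tfrac12I(\vartheta_t,p_t)+6L^2d_x(t-t_-).$$ 2. At $t=t_-$, if $q_k$ has an almost everywhere differentiable density, the inequality holds for the upper right derivative: $$\limsup_{s\downarrow t_-}\frac{F(\vartheta_s,p_s)-F(\theta_k,q_k)}{s-t_-}\le-\tfrac12I(\theta_k,q_k)$$ (in $[-\infty,\infty]$; the quotient is $-\infty$ if $F(\theta_k,q_k)=+\infty$). -/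

import Mathlib

open MeasureTheory ProbabilityTheory Set Filter Topology
open scoped NNReal ENNReal

noncomputable section

namespace EMDescent

/-- Euclidean space `ℝⁿ` with its Euclidean norm. -/
abbrev Euc (n : ℕ) : Type := EuclideanSpace ℝ (Fin n)

variable {m d : ℕ} {Ω : Type*} [MeasurableSpace Ω]

/-! ### The model

`ρ θ x` is the (unnormalised) Lebesgue density of the latent variable `x ∈ ℝᵈ` under the
parameter `θ ∈ ℝᵐ`. -/

/-- The complete log-likelihood `ℓ(θ; x) = log ρ_θ(x)`. -/
def logLik (ρ : Euc m → Euc d → ℝ) (θ : Euc m) (x : Euc d) : ℝ := Real.log (ρ θ x)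

/-- The gradient `∇_θ ℓ(θ; x)` in the parameter. -/
def gradTheta (ρ : Euc m → Euc d → ℝ) (θ : Euc m) (x : Euc d) : Euc m :=
  gradient (fun θ' => logLik ρ θ' x) θ

/-- The gradient `∇_x ℓ(θ; x)` in the latent variable. -/
def gradX (ρ : Euc m → Euc d → ℝ) (θ : Euc m) (x : Euc d) : Euc d :=
  gradient (fun x' => logLik ρ θ x') x

/-- The marginal likelihood `Z_θ = ∫ ρ_θ(x) dx`. -/
def marginal (ρ : Euc m → Euc d → ℝ) (θ : Euc m) : ℝ := ∫ x, ρ θ x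

/-- The posterior density `π_θ(x) = ρ_θ(x) / Z_θ`. -/
def posterior (ρ : Euc m → Euc d → ℝ) (θ : Euc m) (x : Euc d) : ℝ := ρ θ x / marginal ρ θ

/-- The finite measure `ρ_θ(dx) = ρ_θ(x) dx`. -/
def modelMeasure (ρ : Euc m → Euc d → ℝ) (θ : Euc m) : Measure (Euc d) :=
  volume.withDensity (fun x => ENNReal.ofReal (ρ θ x))

/-- The maximisers of the marginal likelihood. -/
def maximizers (ρ : Euc m → Euc d → ℝ) : Set (Euc m) := {θ | ∀ θ', marginal ρ θ' ≤ marginal ρ θ}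

/-- Regularity assumptions on the model. The field `integrable` says that the normalising constant
`Z_θ` is finite. -/
structure RegularModel (ρ : Euc m → Euc d → ℝ) : Prop where
  integrable : ∀ θ, Integrable (ρ θ)
  differentiable_posterior : ∀ x, Differentiable ℝ (fun θ => posterior ρ θ x)
  differentiable_marginal : Differentiable ℝ (marginal ρ)
  contDiff_posterior : ∀ θ, ContDiff ℝ 2 (posterior ρ θ)
  pos : ∀ θ x, 0 < ρ θ x
  second_moment : ∀ θ, Integrable (fun x => ‖x‖ ^ 2 * posterior ρ θ x)
  continuous_second_moment : Continuous (fun θ => ∫ x, ‖x‖ ^ 2 * posterior ρ θ x)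
  compact_maximizers : IsCompact (maximizers ρ)

/-- `ℓ` is differentiable on `ℝᵐ × ℝᵈ`, and the Euclidean norm of
`∇ℓ(θ; x) - ∇ℓ(θ'; x')`, where `∇ℓ = (∇_θ ℓ, ∇_x ℓ)`, is at most
`Lθ ‖θ - θ'‖ + Lx ‖x - x'‖`. -/
structure LipschitzGradient (ρ : Euc m → Euc d → ℝ) (Lθ Lx : ℝ≥0) : Prop where
  differentiable : Differentiable ℝ (fun z : Euc m × Euc d => logLik ρ z.1 z.2)
  lipschitz : ∀ θ θ' x x',
    √(‖gradTheta ρ θ x - gradTheta ρ θ' x'‖ ^ 2 + ‖gradX ρ θ x - gradX ρ θ' x'‖ ^ 2) ≤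
      Lθ * ‖θ - θ'‖ + Lx * ‖x - x'‖

/-! ### Probability measures, free energy, extended Fisher information -/

/-- Membership in `𝒫₂(ℝᵈ)`: absolutely continuous probability measures with finite second
moment. -/
structure IsP2 (q : Measure (Euc d)) : Prop where
  isProbabilityMeasure : IsProbabilityMeasure q
  absolutelyContinuous : q ≪ volume
  second_moment : ∫⁻ x, ‖x‖ₑ ^ 2 ∂q < ⊤

/-- `f` is a Lebesgue density of `q` that is differentiable almost everywhere. -/
structure IsDiffDensity (q : Measure (Euc d)) (f : Euc d → ℝ) : Prop where
  measurable : Measurable f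
  nonneg : ∀ x, 0 ≤ f x
  eq_withDensity : q = volume.withDensity (fun x => ENNReal.ofReal (f x))
  ae_differentiable : ∀ᵐ x ∂(volume : Measure (Euc d)), DifferentiableAt ℝ f x

open Classical in
/-- The free energy `F(θ, q) = ∫ log (q(x) / ρ_θ(x)) q(dx)` if `q ≪ ρ_θ(dx)`, and `+∞` otherwise.
The log-likelihood ratio `llr q (ρ_θ)` is `log (dq/dρ_θ)`. As `ρ_θ(dx)` is a finite measure, its
negative part is always `q`-integrable, so that the integral is `+∞` when the integrand is not
integrable. -/
def freeEnergy (ρ : Euc m → Euc d → ℝ) (θ : Euc m) (q : Measure (Euc d)) : EReal :=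
  if q ≪ modelMeasure ρ θ ∧ Integrable (llr q (modelMeasure ρ θ)) q then
    ((∫ x, llr q (modelMeasure ρ θ) x ∂q : ℝ) : EReal)
  else ⊤

/-- The extended Fisher information
`I(θ, q) = ‖∫ ∇_θ ℓ(θ; x) q(dx)‖² + ∫ ‖∇_x log (q(x) / ρ_θ(x))‖² q(dx) ∈ [0, ∞]`
of a measure `q` with almost everywhere differentiable density `f`. (Its value does not depend on
the choice of the almost everywhere differentiable version `f` of the density.) -/
def extFisher (ρ : Euc m → Euc d → ℝ) (θ : Euc m) (q : Measure (Euc d)) (f : Euc d → ℝ) : ℝ≥0∞ :=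
  ‖∫ x, gradTheta ρ θ x ∂q‖ₑ ^ 2 +
    ∫⁻ x, ‖gradient (fun y => Real.log (f y / ρ θ y)) x‖ₑ ^ 2 ∂q

/-! ### The interpolating process -/

/-- `W` is a standard `d`-dimensional Brownian motion: its coordinates are independent real
Brownian motions. -/
structure IsBrownian (W : ℝ≥0 → Ω → Euc d) (P : Measure Ω) : Prop where
  coord : ∀ i, IsBrownianReal (fun t ω => W t ω i) P
  indep : iIndepFun (fun i ω (t : ℝ≥0) => W t ω i) P

/-- `(ϑ, Z)` solves, on the interval `[kh, (k+1)h]`, with `t₋ = kh`,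
`ϑ_{t₋} = θk`, `dϑ_t = (∫ ∇_θ ℓ(ϑ_{t₋}; x) p_{t₋}(dx)) dt`,
`Law(Z_{t₋}) = qk`, `dZ_t = ∇_x ℓ(θf; Z_{t₋}) dt + √2 dW_t`, where `p_t = Law(Z_t)`, `θf` is the
parameter at which the drift is frozen, and `W` is a Brownian motion whose increments after time
`t₋` are independent of `Z_{t₋}`. The noise being additive, the stochastic differential equation is
the pathwise integral equation `sde`. -/
structure IsInterpolation (ρ : Euc m → Euc d → ℝ) (h : ℝ) (k : ℕ) (θk : Euc m)
    (qk : Measure (Euc d)) (θf : Euc m) (P : Measure Ω) (W : ℝ≥0 → Ω → Euc d)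
    (ϑ : ℝ → Euc m) (Z : ℝ → Ω → Euc d) : Prop where
  brownian : IsBrownian W P
  indep : IndepFun (Z (k * h))
    (fun ω (s : ℝ≥0) => W ((k * h).toNNReal + s) ω - W (k * h).toNNReal ω) P
  theta_init : ϑ (k * h) = θk
  theta_ode : ∀ t ∈ Icc (k * h) ((k + 1) * h),
    HasDerivWithinAt ϑ (∫ x, gradTheta ρ (ϑ (k * h)) x ∂(P.map (Z (k * h))))
      (Icc (k * h) ((k + 1) * h)) t
  init_law : HasLaw (Z (k * h)) qk P
  sde : ∀ᵐ ω ∂P, ∀ t ∈ Icc (k * h) ((k + 1) * h),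
    Z t ω = Z (k * h) ω + (∫ _s in (k * h)..t, gradX ρ θf (Z (k * h) ω))
      + √2 • (W t.toNNReal ω - W (k * h).toNNReal ω)

end EMDescent

end

/-! ### Gaussian preliminaries: heat kernel and moments of the standard Gaussian. -/

noncomputable section

namespace EMDescent

open scoped RealInnerProductSpace

variable {d : ℕ}

/-! Write `s = t - t₋`, `g = ∫ ∇_θ ℓ(θ_k; x) q_k(dx)` and `b = ∇_x ℓ(θ̂; ·)`. For a fixed time,
`Z_t` has the law of `Z = X + s b(X) + √(2s) ξ` with `X ∼ q_k` and `ξ` an independent standard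
Gaussian, and `ϑ_t = θ_k + s g` (`IsInterpolation.map_eq`, `IsInterpolation.theta_eq`). The density
`p_s` is thus an explicit Gaussian mixture, and no Fokker–Planck equation is needed: the free energy
`E[log p_s(Z) - ℓ(θ_k + s g; Z)]` is differentiated under the expectation with `(X, ξ)` held fixed
(`hasDerivAt_freeEnergyPath`). The domination uses only the second moment of `q_k`, because `-log`
of the mixture is bounded by Jensen and in turn controls the score and the time derivative
(`exists_growth_bound`).

Positive times. Conservation of mass gives `E[∂_s log p_s(Z)] = 0` (from `integral_rate`), and the
score `S = ∇ log p_s` is the conditional expectation of `-ξ/√(2s)` given `Z`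
(`integral_inner_score`). Hence the derivative is `-⟪A, g⟫ - E⟪v - S, b - S⟫`, where `A = E ∇_θ
ℓ(ϑ_t; Z)`, `v = ∇_x ℓ(ϑ_t; Z)` and `b = b(X)`. Polarising both products produces `-I/2`, the gains
`-‖g‖²/2` and `-E‖b - S‖²/2`, and the errors `‖A - g‖²/2` and `E‖v - b‖²/2`. By the Lipschitz
condition the errors are bounded by `‖g‖²` and `L² E‖Z - X‖² = L² (s² E‖b‖² + 2 s d)`. The part with
`E‖b‖²` does not occur in the final bound; it is absorbed by the second gain, since `E‖b - S‖² ≥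
E‖b‖² - 2 L d - E‖v - b‖²`. This rests on `E⟪v, S⟫ ≤ L d` (`integral_inner_score_le`). The constants
are balanced in `descent_arith`.

Initial time. The mean value inequality on `[r, s]`, followed by `r → 0`, reduces the claim to upper
semicontinuity of the free energy and lower semicontinuity of the Fisher information at time zero.
For the first, Jensen's inequality shows that the negative entropy grows by at most `d log (1 -
sL)⁻¹` (`integral_log_stepDensity_le`). For the second, `p_s → f` and `∇p_s → ∇f` at every point
where the initial density `f` is differentiable (`tendsto_stepDensity`), and Fatou's lemma applies
(`extFisher_le_liminf`). -/

/-- The normalising constant `(4π s)^(-d/2)` of the heat kernel at time `s`. -/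
def heatConst (d : ℕ) (s : ℝ) : ℝ := ((4 * Real.pi * s) ^ ((d : ℝ) / 2))⁻¹

lemma heatConst_pos {s : ℝ} (hs : 0 < s) : 0 < heatConst d s := by
  unfold heatConst; positivity

/-- The Fourier transform of the heat kernel centred at `c`, obtained from the centred Gaussian
integral by translation. It identifies the law of a noisy step, and at `t = 0` it gives the
normalisation. -/
lemma integral_cexp_sub_sq_div {s : ℝ} (hs : 0 < s) (c t : Euc d) :
    ∫ y : Euc d, Complex.exp (-(‖y - c‖ : ℂ) ^ 2 / (4 * s)) * Complex.exp (⟪y, t⟫ * Complex.I) =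
      (heatConst d s : ℂ)⁻¹ * Complex.exp (⟪c, t⟫ * Complex.I - s * ‖t‖ ^ 2) := by
  have hb : 0 < ((1 / (4 * s) : ℝ) : ℂ).re := by simp only [Complex.ofReal_re]; positivity
  have h := GaussianFourier.integral_cexp_neg_mul_sq_norm_add hb Complex.I t
  rw [← integral_add_right_eq_self _ c]
  have e1 : ∀ y : Euc d, Complex.exp (-(‖y + c - c‖ : ℂ) ^ 2 / (4 * s)) *
      Complex.exp (⟪y + c, t⟫ * Complex.I) = Complex.exp (⟪c, t⟫ * Complex.I) *
      Complex.exp (-((1 / (4 * s) : ℝ) : ℂ) * (‖y‖ : ℂ) ^ 2 + Complex.I * ⟪t, y⟫) := by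
    intro y
    rw [← Complex.exp_add, ← Complex.exp_add, add_sub_cancel_right, inner_add_left,
      real_inner_comm t y]
    congr 1
    push_cast
    ring
  simp_rw [e1]
  rw [integral_const_mul, h]
  have hs' : (s : ℂ) ≠ 0 := by exact_mod_cast hs.ne'
  have e2 : (Real.pi / ((1 / (4 * s) : ℝ) : ℂ)) ^ ((Module.finrank ℝ (Euc d) : ℂ) / 2) =
      (heatConst d s : ℂ)⁻¹ := by
    have e3 : (Real.pi : ℂ) / ((1 / (4 * s) : ℝ) : ℂ) = ((4 * Real.pi * s : ℝ) : ℂ) := by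
      push_cast; field_simp
    have hfr : Module.finrank ℝ (Euc d) = d := by simp
    rw [e3, hfr, heatConst, ← Complex.ofReal_inv, inv_inv,
      Complex.ofReal_cpow (by positivity)]
    push_cast; rfl
  rw [e2, mul_left_comm, ← Complex.exp_add]
  congr 2
  rw [Complex.I_sq]; push_cast; field_simp; ring

lemma integrable_exp_sub_sq_div {s : ℝ} (hs : 0 < s) (c : Euc d) :
    Integrable fun y : Euc d => Real.exp (-‖y - c‖ ^ 2 / (4 * s)) := by
  have hb : 0 < ((1 / (4 * s) : ℝ) : ℂ).re := by simp only [Complex.ofReal_re]; positivity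
  have h := (GaussianFourier.integrable_cexp_neg_mul_sq_norm_add hb 0 (0 : Euc d)).norm.comp_sub_right c
  refine h.congr (.of_forall fun y => ?_)
  simp only [Complex.norm_exp]
  congr 1
  rw [zero_mul, add_zero, ← Complex.ofReal_pow, ← Complex.ofReal_neg, ← Complex.ofReal_mul, Complex.ofReal_re]
  field_simp

lemma integral_exp_sub_sq_div {s : ℝ} (hs : 0 < s) (c : Euc d) :
    ∫ y : Euc d, Real.exp (-‖y - c‖ ^ 2 / (4 * s)) = (heatConst d s)⁻¹ := by
  have h := integral_cexp_sub_sq_div hs c 0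
  simp only [inner_zero_right, Complex.ofReal_zero, zero_mul, Complex.exp_zero, mul_one, norm_zero,
    ne_eq, OfNat.ofNat_ne_zero, not_false_eq_true, zero_pow, mul_zero, sub_zero] at h
  have e : ∀ y : Euc d, Complex.exp (-(‖y - c‖ : ℂ) ^ 2 / (4 * s)) =
      ((Real.exp (-‖y - c‖ ^ 2 / (4 * s)) : ℝ) : ℂ) := by intro y; push_cast; rfl
  simp_rw [e] at h
  rw [integral_complex_ofReal] at h
  exact_mod_cast h

/-- The law of `c + √(2 s) ξ`, with `ξ` standard Gaussian, has a heat kernel density. -/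
theorem stdGaussian_map_affine {s : ℝ} (hs : 0 < s) (c : Euc d) :
    (stdGaussian (Euc d)).map (fun ξ => c + √(2 * s) • ξ) =
      volume.withDensity
        (fun y => ENNReal.ofReal (heatConst d s * Real.exp (-‖y - c‖ ^ 2 / (4 * s)))) := by
  have hfin : IsFiniteMeasure (volume.withDensity
        (fun y : Euc d => ENNReal.ofReal (heatConst d s * Real.exp (-‖y - c‖ ^ 2 / (4 * s))))) :=
    isFiniteMeasure_withDensity_ofReal ((integrable_exp_sub_sq_div hs c).const_mul _).2
  have : IsFiniteMeasure ((stdGaussian (Euc d)).map (fun ξ => c + √(2 * s) • ξ)) := inferInstance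
  -- Both sides are finite measures, so it suffices to compare characteristic functions.
  apply Measure.ext_of_charFun
  ext t
  have hm : Measurable fun y : Euc d => heatConst d s * Real.exp (-‖y - c‖ ^ 2 / (4 * s)) := by
    fun_prop
  rw [charFun_apply, charFun_apply, integral_map (by fun_prop) (by fun_prop),
    integral_withDensity_eq_integral_toReal_smul (by fun_prop) (by simp)]
  have e1 : ∀ ξ : Euc d, Complex.exp (⟪c + √(2 * s) • ξ, t⟫ * Complex.I) =
      Complex.exp (⟪c, t⟫ * Complex.I) * Complex.exp (⟪ξ, √(2 * s) • t⟫ * Complex.I) := by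
    intro ξ
    rw [← Complex.exp_add, inner_add_left, real_inner_smul_left, real_inner_smul_right]
    congr 1; push_cast; ring
  simp_rw [e1]
  rw [integral_const_mul, ← charFun_apply, charFun_stdGaussian]
  have e2 : ∀ y : Euc d, (ENNReal.ofReal (heatConst d s * Real.exp (-‖y - c‖ ^ 2 / (4 * s)))).toReal •
      Complex.exp (⟪y, t⟫ * Complex.I) = (heatConst d s : ℂ) *
      (Complex.exp (-(‖y - c‖ : ℂ) ^ 2 / (4 * s)) * Complex.exp (⟪y, t⟫ * Complex.I)) := by
    intro y
    rw [ENNReal.toReal_ofReal (mul_nonneg (heatConst_pos hs).le (Real.exp_pos _).le),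
      Complex.real_smul]
    push_cast; ring
  simp_rw [e2]
  have hk : (heatConst d s : ℂ) ≠ 0 := by exact_mod_cast (heatConst_pos hs).ne'
  rw [integral_const_mul, integral_cexp_sub_sq_div hs, ← mul_assoc, mul_inv_cancel₀ hk, one_mul,
    ← Complex.exp_add]
  congr 1
  rw [norm_smul, Real.norm_of_nonneg (Real.sqrt_nonneg _)]
  push_cast
  rw [mul_pow, ← Complex.ofReal_pow, Real.sq_sqrt (by positivity)]
  push_cast; ring

lemma integrable_norm_sq_stdGaussian : Integrable (fun ξ : Euc d => ‖ξ‖ ^ 2) (stdGaussian (Euc d)) :=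
  (IsGaussian.memLp_two_id (μ := stdGaussian (Euc d))).integrable_norm_pow (by simp)

lemma integrable_id_stdGaussian : Integrable (fun ξ : Euc d => ξ) (stdGaussian (Euc d)) :=
  IsGaussian.integrable_id

lemma integral_inner_mul_inner_stdGaussian (a c : Euc d) :
    ∫ ξ, ⟪a, ξ⟫ * ⟪c, ξ⟫ ∂stdGaussian (Euc d) = ⟪a, c⟫ := by
  have h := congrArg (fun B => B a c) (covarianceBilin_stdGaussian (E := Euc d))
  rw [covarianceBilin_apply IsGaussian.memLp_two_id] at h
  simpa [innerSL_apply_apply ℝ] using h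

/-- The identity covariance in vector form. It recovers a gradient from Gaussian averages of
directional derivatives. -/
lemma integral_inner_smul_stdGaussian (a : Euc d) :
    ∫ ξ, ⟪a, ξ⟫ • ξ ∂stdGaussian (Euc d) = a := by
  refine ext_inner_left ℝ fun c => ?_
  have hi : Integrable (fun ξ : Euc d => ⟪a, ξ⟫ • ξ) (stdGaussian (Euc d)) := by
    refine (integrable_norm_sq_stdGaussian.const_mul ‖a‖).mono' (by fun_prop) (.of_forall fun ξ => ?_)
    rw [norm_smul, pow_two, ← mul_assoc]
    gcongr
    exact norm_inner_le_norm a ξ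
  rw [← integral_inner hi]
  simp_rw [real_inner_smul_right]
  rw [integral_inner_mul_inner_stdGaussian, real_inner_comm]

lemma integral_norm_sq_stdGaussian : ∫ ξ, ‖ξ‖ ^ 2 ∂stdGaussian (Euc d) = d := by
  have h : ∀ ξ : Euc d, ‖ξ‖ ^ 2 = ∑ i, ⟪EuclideanSpace.basisFun (Fin d) ℝ i, ξ⟫ *
      ⟪EuclideanSpace.basisFun (Fin d) ℝ i, ξ⟫ := by
    intro ξ
    rw [← (EuclideanSpace.basisFun (Fin d) ℝ).sum_sq_inner_right ξ]
    simp [pow_two]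
  simp_rw [h]
  rw [integral_finsetSum]
  · simp_rw [integral_inner_mul_inner_stdGaussian]
    simp
  · intro i _
    refine (integrable_norm_sq_stdGaussian).mono' (by fun_prop) (.of_forall fun ξ => ?_)
    have := norm_inner_le_norm (𝕜 := ℝ) (EuclideanSpace.basisFun (Fin d) ℝ i) ξ
    simp only [OrthonormalBasis.norm_eq_one, one_mul] at this
    rw [norm_mul, pow_two]
    gcongr

end EMDescent
end

/-! ### The Euler–Maruyama step: density, conditional law of the initial point, tower property. -/

noncomputable section

namespace EMDescent

open scoped RealInnerProductSpace

variable {d : ℕ} {b : Euc d → Euc d} {L : ℝ≥0} {q : Measure (Euc d)}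

/-- One step of length `s` of the Euler–Maruyama scheme with drift `b`, started at `z.1` and driven
by the standard Gaussian vector `z.2`. -/
def emStep (b : Euc d → Euc d) (s : ℝ) (z : Euc d × Euc d) : Euc d :=
  z.1 + s • b z.1 + √(2 * s) • z.2

/-- The noise `y - x - s b(x)` of a step of length `s` from `x` to `y`. -/
def resid (b : Euc d → Euc d) (s : ℝ) (x y : Euc d) : Euc d := y - x - s • b x

/-- The unnormalised transition kernel of `emStep`. -/
def transKer (b : Euc d → Euc d) (s : ℝ) (x y : Euc d) : ℝ :=
  Real.exp (-‖resid b s x y‖ ^ 2 / (4 * s))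

/-- The unnormalised density of `emStep` with initial law `q`. -/
def mass (q : Measure (Euc d)) (b : Euc d → Euc d) (s : ℝ) (y : Euc d) : ℝ :=
  ∫ x, transKer b s x y ∂q

/-- The conditional law of the initial point of `emStep` given its endpoint `y`. -/
def backLaw (q : Measure (Euc d)) (b : Euc d → Euc d) (s : ℝ) (y : Euc d) : Measure (Euc d) :=
  q.tilted (fun x => -‖resid b s x y‖ ^ 2 / (4 * s))

/-- The density of `emStep` with initial law `q`. -/
def stepDensity (q : Measure (Euc d)) (b : Euc d → Euc d) (s : ℝ) (y : Euc d) : ℝ :=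
  heatConst d s * mass q b s y

lemma transKer_pos (s : ℝ) (x y : Euc d) : 0 < transKer b s x y := Real.exp_pos _

lemma transKer_le_one {s : ℝ} (hs : 0 ≤ s) (x y : Euc d) : transKer b s x y ≤ 1 := by
  unfold transKer
  rw [Real.exp_le_one_iff, neg_div]
  have : 0 ≤ ‖resid b s x y‖ ^ 2 / (4 * s) := by positivity
  linarith

lemma norm_le_of_lipschitz (hb : LipschitzWith L b) (x : Euc d) : ‖b x‖ ≤ ‖b 0‖ + L * ‖x‖ := by
  have h := hb.norm_sub_le x 0
  rw [sub_zero] at h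
  have := norm_sub_norm_le (b x) (b 0)
  linarith

lemma measurable_emStep (hb : Measurable b) (s : ℝ) : Measurable (emStep b s) := by
  unfold emStep; fun_prop

lemma measurable_resid (hb : Measurable b) (s : ℝ) :
    Measurable (fun z : Euc d × Euc d => resid b s z.1 z.2) := by
  unfold resid; fun_prop

lemma measurable_transKer (hb : Measurable b) (s : ℝ) :
    Measurable (fun z : Euc d × Euc d => transKer b s z.1 z.2) := by
  unfold transKer
  have := measurable_resid hb s
  fun_prop

lemma measurable_transKer_left (hb : Measurable b) (s : ℝ) (y : Euc d) :
    Measurable (fun x => transKer b s x y) := by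
  unfold transKer resid; fun_prop

lemma measurable_resid_left (hb : Measurable b) (s : ℝ) (y : Euc d) :
    Measurable (fun x => resid b s x y) := by
  unfold resid; fun_prop

lemma integrable_transKer [IsFiniteMeasure q] (hb : Measurable b) {s : ℝ} (hs : 0 ≤ s) (y : Euc d) :
    Integrable (fun x => transKer b s x y) q := by
  refine (integrable_const (1 : ℝ)).mono' (measurable_transKer_left hb s y).aestronglyMeasurable
    (.of_forall fun x => ?_)
  rw [Real.norm_of_nonneg (transKer_pos s x y).le]
  exact transKer_le_one hs x y

lemma mass_pos [IsProbabilityMeasure q] (hb : Measurable b) {s : ℝ} (hs : 0 ≤ s) (y : Euc d) :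
    0 < mass q b s y := by
  unfold mass
  rw [integral_pos_iff_support_of_nonneg (fun x => (transKer_pos s x y).le)
    (integrable_transKer hb hs y)]
  have : Function.support (fun x => transKer b s x y) = univ := by
    ext x; simp [(transKer_pos s x y).ne']
  rw [this]; simp

lemma mass_le_one [IsProbabilityMeasure q] (hb : Measurable b) {s : ℝ} (hs : 0 ≤ s) (y : Euc d) :
    mass q b s y ≤ 1 := by
  have := integral_mono (integrable_transKer (q := q) hb hs y) (integrable_const 1)
    (fun x => transKer_le_one hs x y)
  simpa [mass] using this

lemma measurable_mass [SFinite q] (hb : Measurable b) (s : ℝ) : Measurable (mass q b s) := by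
  have h : StronglyMeasurable (fun z : Euc d × Euc d => transKer b s z.2 z.1) :=
    ((measurable_transKer hb s).comp measurable_swap).stronglyMeasurable
  exact h.integral_prod_right.measurable

lemma stepDensity_pos [IsProbabilityMeasure q] (hb : Measurable b) {s : ℝ} (hs : 0 < s)
    (y : Euc d) : 0 < stepDensity q b s y :=
  mul_pos (heatConst_pos hs) (mass_pos hb hs.le y)

lemma integral_backLaw {F : Type*} [NormedAddCommGroup F] [NormedSpace ℝ F] (s : ℝ) (y : Euc d)
    (a : Euc d → F) :
    ∫ x, a x ∂backLaw q b s y = (mass q b s y)⁻¹ • ∫ x, transKer b s x y • a x ∂q := by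
  unfold backLaw
  rw [integral_tilted, ← integral_smul]
  congr 1; ext x
  simp only [transKer, mass, smul_smul]
  rw [div_eq_inv_mul]

lemma isProbabilityMeasure_backLaw [IsProbabilityMeasure q] (hb : Measurable b) {s : ℝ}
    (hs : 0 ≤ s) (y : Euc d) : IsProbabilityMeasure (backLaw q b s y) :=
  isProbabilityMeasure_tilted (integrable_transKer (q := q) hb hs y)

lemma integrable_backLaw_iff {F : Type*} [NormedAddCommGroup F] [NormedSpace ℝ F]
    [IsProbabilityMeasure q] (hb : Measurable b) {s : ℝ}
    (hs : 0 ≤ s) (y : Euc d) (a : Euc d → F) :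
    Integrable a (backLaw q b s y) ↔ Integrable (fun x => transKer b s x y • a x) q :=
  integrable_tilted_iff (integrable_transKer (q := q) hb hs y) a

/-! ### The joint law of the endpoints -/

/-- Given `X = x`, the endpoint has the heat kernel density centred at `x + s b(x)`; the rest is
Tonelli. -/
theorem lintegral_emStep [SFinite q] (hb : Measurable b) {s : ℝ} (hs : 0 < s)
    {G : Euc d × Euc d → ℝ≥0∞} (hG : Measurable G) :
    ∫⁻ z, G (z.1, emStep b s z) ∂(q.prod (stdGaussian (Euc d))) =
      ∫⁻ z, ENNReal.ofReal (heatConst d s * transKer b s z.1 z.2) * G z ∂(q.prod volume) := by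
  have hk := measurable_transKer hb s
  rw [lintegral_prod _ (by have := measurable_emStep hb s; fun_prop), lintegral_prod _ (by fun_prop)]
  congr 1; ext x
  have h1 := stdGaussian_map_affine hs (x + s • b x)
  calc ∫⁻ ξ, G (x, emStep b s (x, ξ)) ∂stdGaussian (Euc d)
      = ∫⁻ y, G (x, y) ∂((stdGaussian (Euc d)).map (fun ξ => x + s • b x + √(2 * s) • ξ)) := by
        rw [lintegral_map (by fun_prop) (by fun_prop)]; rfl
    _ = _ := by
        rw [h1, lintegral_withDensity_eq_lintegral_mul _ (by fun_prop) (by fun_prop)]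
        congr 1; ext y
        simp only [Pi.mul_apply, transKer, resid, sub_sub]

theorem map_emStep_pair [SFinite q] (hb : Measurable b) {s : ℝ} (hs : 0 < s) :
    (q.prod (stdGaussian (Euc d))).map (fun z => (z.1, emStep b s z)) =
      (q.prod volume).withDensity
        (fun z => ENNReal.ofReal (heatConst d s * transKer b s z.1 z.2)) := by
  have hk := measurable_transKer hb s
  have hZ := measurable_emStep hb s
  refine Measure.ext_of_lintegral _ fun G hG => ?_
  rw [lintegral_map hG (by fun_prop), lintegral_emStep hb hs hG,
    lintegral_withDensity_eq_lintegral_mul _ (by fun_prop) hG]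
  rfl

theorem map_emStep [IsProbabilityMeasure q] (hb : Measurable b) {s : ℝ} (hs : 0 < s) :
    (q.prod (stdGaussian (Euc d))).map (emStep b s) =
      volume.withDensity (fun y => ENNReal.ofReal (stepDensity q b s y)) := by
  have hk := measurable_transKer hb s
  have hm := measurable_mass (q := q) hb s
  refine Measure.ext_of_lintegral _ fun G hG => ?_
  rw [lintegral_map hG (measurable_emStep hb s),
    lintegral_emStep hb hs (G := fun z => G z.2) (by fun_prop),
    lintegral_withDensity_eq_lintegral_mul _ (by unfold stepDensity; fun_prop) hG,
    lintegral_prod_symm _ (by fun_prop)]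
  congr 1; ext y
  simp only [Pi.mul_apply]
  rw [lintegral_mul_const _ (by fun_prop), ← ofReal_integral_eq_lintegral_ofReal,
    integral_const_mul]
  · rfl
  · exact (integrable_transKer hb hs.le y).const_mul _
  · exact .of_forall fun x => (mul_pos (heatConst_pos hs) (transKer_pos s x y)).le

lemma measurable_integral_backLaw {F : Type*} [NormedAddCommGroup F] [NormedSpace ℝ F]
    [MeasurableSpace F] [BorelSpace F] [SecondCountableTopology F] [SFinite q] (hb : Measurable b)
    (s : ℝ) {a : Euc d → Euc d → F} (ha : Measurable (fun z : Euc d × Euc d => a z.1 z.2)) :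
    Measurable (fun y => ∫ x, a x y ∂backLaw q b s y) := by
  simp_rw [integral_backLaw]
  have h1 : StronglyMeasurable (fun z : Euc d × Euc d => transKer b s z.2 z.1 • a z.2 z.1) :=
    (((measurable_transKer hb s).comp measurable_swap).smul
      (ha.comp measurable_swap)).stronglyMeasurable
  exact (measurable_mass hb s).inv.smul h1.integral_prod_right.measurable

/-- Tower property: `E⟨K(Z), E[a(X, Z) | Z]⟩ = E⟨K(Z), a(X, Z)⟩`. -/
theorem integral_inner_backLaw {F : Type*} [NormedAddCommGroup F] [InnerProductSpace ℝ F]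
    [CompleteSpace F] [MeasurableSpace F] [BorelSpace F] [SecondCountableTopology F]
    [IsProbabilityMeasure q] (hb : Measurable b) {s : ℝ} (hs : 0 < s)
    {K : Euc d → F} {a : Euc d → Euc d → F} (hK : Measurable K)
    (ha : Measurable (fun z : Euc d × Euc d => a z.1 z.2))
    (hia : ∀ y, Integrable (fun x => transKer b s x y • a x y) q)
    (hi : Integrable (fun z => ⟪K (emStep b s z), a z.1 (emStep b s z)⟫)
      (q.prod (stdGaussian (Euc d)))) :
    ∫ z, ⟪K (emStep b s z), ∫ x, a x (emStep b s z) ∂backLaw q b s (emStep b s z)⟫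
        ∂(q.prod (stdGaussian (Euc d))) =
      ∫ z, ⟪K (emStep b s z), a z.1 (emStep b s z)⟫ ∂(q.prod (stdGaussian (Euc d))) := by
  have hk := measurable_transKer hb s
  have hZ := measurable_emStep hb s
  have hm := measurable_mass (q := q) hb s
  have hpair : Measurable (fun z : Euc d × Euc d => (z.1, emStep b s z)) := by fun_prop
  have hKa : Measurable (fun z : Euc d × Euc d => ⟪K z.2, a z.1 z.2⟫) :=
    (hK.comp measurable_snd).inner ha
  have hA := measurable_integral_backLaw (q := q) hb s ha
  have hc0 : ∀ z : Euc d × Euc d, 0 ≤ heatConst d s * transKer b s z.1 z.2 := fun z =>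
    (mul_pos (heatConst_pos hs) (transKer_pos s z.1 z.2)).le
  have hi2 : Integrable (fun z : Euc d × Euc d =>
      (heatConst d s * transKer b s z.1 z.2) • ⟪K z.2, a z.1 z.2⟫) (q.prod volume) := by
    have h1 : Integrable (fun z : Euc d × Euc d => ⟪K z.2, a z.1 z.2⟫)
        ((q.prod (stdGaussian (Euc d))).map (fun z => (z.1, emStep b s z))) :=
      (integrable_map_measure hKa.aestronglyMeasurable hpair.aemeasurable).2 hi
    rw [map_emStep_pair hb hs, integrable_withDensity_iff_integrable_smul' (by fun_prop)
      (by simp)] at h1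
    simpa only [ENNReal.toReal_ofReal (hc0 _)] using h1
  have lhs : ∫ z, ⟪K (emStep b s z), ∫ x, a x (emStep b s z) ∂backLaw q b s (emStep b s z)⟫
        ∂(q.prod (stdGaussian (Euc d))) =
      ∫ y, stepDensity q b s y • ⟪K y, ∫ x, a x y ∂backLaw q b s y⟫ := by
    have := integral_map (μ := q.prod (stdGaussian (Euc d))) hZ.aemeasurable
      (f := fun y => ⟪K y, ∫ x, a x y ∂backLaw q b s y⟫)
      (hK.inner hA).aestronglyMeasurable
    rw [← this, map_emStep hb hs, integral_withDensity_eq_integral_toReal_smul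
      (by unfold stepDensity; fun_prop) (by simp)]
    simp only [ENNReal.toReal_ofReal (stepDensity_pos hb hs _).le]
  have rhs : ∫ z, ⟪K (emStep b s z), a z.1 (emStep b s z)⟫ ∂(q.prod (stdGaussian (Euc d))) =
      ∫ y, ∫ x, (heatConst d s * transKer b s x y) • ⟪K y, a x y⟫ ∂q := by
    have := integral_map (μ := q.prod (stdGaussian (Euc d))) hpair.aemeasurable
      (f := fun z => ⟪K z.2, a z.1 z.2⟫) hKa.aestronglyMeasurable
    rw [← this, map_emStep_pair hb hs, integral_withDensity_eq_integral_toReal_smul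
      (by fun_prop) (by simp)]
    simp only [ENNReal.toReal_ofReal (hc0 _)]
    exact integral_prod_symm _ hi2
  rw [lhs, rhs]
  -- For each `y` the factor `mass q b s y` of the density of the endpoint cancels the normalisation
  -- of `backLaw`.
  congr 1; ext y
  rw [integral_backLaw, real_inner_smul_right, ← integral_inner (hia y)]
  simp_rw [real_inner_smul_right, smul_eq_mul, stepDensity]
  rw [← integral_const_mul, ← integral_const_mul]
  congr 1; ext x
  have := (mass_pos (q := q) hb hs.le y).ne'
  field_simp

end EMDescent
end

/-! ### Growth bounds for the log-density, its score and its time derivative. -/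

noncomputable section

namespace EMDescent

open scoped RealInnerProductSpace

variable {d : ℕ} {b : Euc d → Euc d} {L : ℝ≥0} {q : Measure (Euc d)}

/-- Nonnegativity of the variance of `‖f‖`. -/
lemma norm_integral_sq_le {α F : Type*} [MeasurableSpace α] {μ : Measure α} [IsProbabilityMeasure μ]
    [NormedAddCommGroup F] [NormedSpace ℝ F] {f : α → F} (hf : Integrable f μ)
    (hf2 : Integrable (fun x => ‖f x‖ ^ 2) μ) : ‖∫ x, f x ∂μ‖ ^ 2 ≤ ∫ x, ‖f x‖ ^ 2 ∂μ := by
  set c := ∫ x, ‖f x‖ ∂μ with hc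
  have h1 : ‖∫ x, f x ∂μ‖ ≤ c := norm_integral_le_integral_norm f
  have h2 : 0 ≤ ∫ x, (‖f x‖ ^ 2 - 2 * c * ‖f x‖ + c ^ 2) ∂μ :=
    integral_nonneg fun x => by
      have := sq_nonneg (‖f x‖ - c)
      simp only [Pi.zero_apply]; linarith
  rw [integral_add (by exact hf2.sub (hf.norm.const_mul _)) (integrable_const _),
    integral_sub hf2 (hf.norm.const_mul _), integral_const_mul, ← hc] at h2
  simp only [integral_const, probReal_univ, one_smul] at h2
  have h3 : ‖∫ x, f x ∂μ‖ ^ 2 ≤ c ^ 2 := pow_le_pow_left₀ (norm_nonneg _) h1 2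
  nlinarith

/-- The time derivative of `log (transKer b s x y)`. -/
def logKerRate (b : Euc d → Euc d) (s : ℝ) (x y : Euc d) : ℝ :=
  ‖resid b s x y‖ ^ 2 / (4 * s ^ 2) + ⟪resid b s x y, b x⟫ / (2 * s)

/-- The time derivative of `log (mass q b s y)`. -/
def rate (q : Measure (Euc d)) (b : Euc d → Euc d) (s : ℝ) (y : Euc d) : ℝ :=
  ∫ x, logKerRate b s x y ∂backLaw q b s y

/-- The score `∇ log p_s(y)` of the density of `emStep`. -/
def score (q : Measure (Euc d)) (b : Euc d → Euc d) (s : ℝ) (y : Euc d) : Euc d :=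
  ∫ x, (-(1 / (2 * s))) • resid b s x y ∂backLaw q b s y

/-- With `u = ‖resid‖² / (4s)` this is `u ≤ exp u`. The Gaussian kernel absorbs a quadratic power of
its residual, uniformly in both points. -/
lemma transKer_mul_norm_sq_le {s : ℝ} (hs : 0 < s) (x y : Euc d) :
    transKer b s x y * ‖resid b s x y‖ ^ 2 ≤ 4 * s := by
  have h := Real.add_one_le_exp (‖resid b s x y‖ ^ 2 / (4 * s))
  have h2 : ‖resid b s x y‖ ^ 2 = (4 * s) * (‖resid b s x y‖ ^ 2 / (4 * s)) := by field_simp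
  unfold transKer
  rw [neg_div, Real.exp_neg, inv_mul_le_iff₀ (Real.exp_pos _)]
  calc _ = (4 * s) * (‖resid b s x y‖ ^ 2 / (4 * s)) := h2
    _ ≤ (4 * s) * Real.exp (‖resid b s x y‖ ^ 2 / (4 * s)) := by gcongr; linarith
    _ = _ := mul_comm _ _

lemma norm_resid_le (hb : LipschitzWith L b) {s : ℝ} (hs : 0 ≤ s) (x y : Euc d) :
    ‖resid b s x y‖ ≤ ‖y‖ + s * ‖b 0‖ + (1 + s * L) * ‖x‖ := by
  unfold resid
  have h1 := norm_sub_le (y - x) (s • b x)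
  have h2 := norm_sub_le y x
  rw [norm_smul, Real.norm_of_nonneg hs] at h1
  nlinarith [mul_le_mul_of_nonneg_left (norm_le_of_lipschitz hb x) hs]

/-- The starting point is eliminated: `x = y - resid - s b(x)`, and `s L ≤ 1/2` lets the term `s L
‖b x‖` be absorbed on the left. Bounds under `backLaw` can then be expressed through `y` and the
residual alone. -/
lemma norm_drift_le (hb : LipschitzWith L b) {s : ℝ} (hs : 0 ≤ s) (hsL : s * L ≤ 1 / 2)
    (x y : Euc d) : ‖b x‖ ≤ 2 * (‖b 0‖ + L * ‖y‖ + L * ‖resid b s x y‖) := by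
  have h1 : x = y - resid b s x y - s • b x := by unfold resid; abel
  have h2 : ‖x‖ ≤ ‖y‖ + ‖resid b s x y‖ + s * ‖b x‖ := by
    have h3 := norm_sub_le (y - resid b s x y) (s • b x)
    have h4 := norm_sub_le y (resid b s x y)
    rw [← h1, norm_smul, Real.norm_of_nonneg hs] at h3
    linarith
  have h3 := norm_le_of_lipschitz hb x
  have h4 := mul_le_mul_of_nonneg_left h2 L.coe_nonneg
  nlinarith [norm_nonneg (b x), mul_le_mul_of_nonneg_right hsL (norm_nonneg (b x))]

lemma integrable_norm_resid_sq [IsProbabilityMeasure q] (hq : Integrable (fun x => ‖x‖ ^ 2) q)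
    (hb : LipschitzWith L b) {s : ℝ} (hs : 0 ≤ s) (y : Euc d) :
    Integrable (fun x => ‖resid b s x y‖ ^ 2) q := by
  have hm := measurable_resid_left hb.continuous.measurable s y
  refine ((integrable_const (2 * (‖y‖ + s * ‖b 0‖) ^ 2)).add
    (hq.const_mul (2 * (1 + s * L) ^ 2))).mono' (by fun_prop) (.of_forall fun x => ?_)
  rw [Real.norm_of_nonneg (sq_nonneg _)]
  have h := pow_le_pow_left₀ (norm_nonneg _) (norm_resid_le hb hs x y) 2
  simp only [Pi.add_apply]
  nlinarith [sq_nonneg (‖y‖ + s * ‖b 0‖ - (1 + s * L) * ‖x‖)]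

lemma neg_log_mass_nonneg [IsProbabilityMeasure q] (hb : Measurable b) {s : ℝ} (hs : 0 ≤ s)
    (y : Euc d) : 0 ≤ -Real.log (mass q b s y) := by
  rw [neg_nonneg]
  exact Real.log_nonpos (mass_pos hb hs y).le (mass_le_one hb hs y)

/-- Jensen's inequality for the exponential, via its tangent line at `log u`. -/
lemma neg_log_mass_le [IsProbabilityMeasure q] (hq : Integrable (fun x => ‖x‖ ^ 2) q)
    (hb : LipschitzWith L b) {s : ℝ} (hs : 0 ≤ s) (y : Euc d) :
    -Real.log (mass q b s y) ≤ ∫ x, ‖resid b s x y‖ ^ 2 / (4 * s) ∂q := by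
  have hbm := hb.continuous.measurable
  have hu := mass_pos (q := q) hbm hs y
  set u := mass q b s y with hu'
  have key : ∀ x, -‖resid b s x y‖ ^ 2 / (4 * s) - Real.log u + 1 ≤ u⁻¹ * transKer b s x y := by
    intro x
    have := Real.add_one_le_exp (-‖resid b s x y‖ ^ 2 / (4 * s) - Real.log u)
    rwa [Real.exp_sub, Real.exp_log hu, div_eq_inv_mul (Real.exp _)] at this
  have hi : Integrable (fun x => -‖resid b s x y‖ ^ 2 / (4 * s)) q :=
    (integrable_norm_resid_sq hq hb hs y).neg.div_const (4 * s)
  have h := integral_mono ((hi.sub (integrable_const (Real.log u))).add (integrable_const 1))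
    ((integrable_transKer (q := q) hbm hs y).const_mul u⁻¹) key
  have e1 : ∫ x, u⁻¹ * transKer b s x y ∂q = 1 := by
    rw [integral_const_mul]; exact inv_mul_cancel₀ hu.ne'
  rw [e1] at h
  simp only [Pi.add_apply, Pi.sub_apply] at h
  rw [integral_add (by exact hi.sub (integrable_const _)) (integrable_const _), integral_sub hi
    (integrable_const _)] at h
  simp only [integral_const, probReal_univ, one_smul, neg_div, integral_neg] at h
  linarith

lemma integrable_transKer_mul_norm_sq [IsFiniteMeasure q] (hb : Measurable b) {s : ℝ} (hs : 0 < s)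
    (y : Euc d) : Integrable (fun x => transKer b s x y * ‖resid b s x y‖ ^ 2) q := by
  have h1 := measurable_resid_left hb s y
  have h2 := measurable_transKer_left hb s y
  refine (integrable_const (4 * s)).mono' (by fun_prop) (.of_forall fun x => ?_)
  rw [Real.norm_of_nonneg (mul_nonneg (transKer_pos _ _ _).le (sq_nonneg _))]
  exact transKer_mul_norm_sq_le hs x y

lemma integrable_norm_sq_backLaw [IsProbabilityMeasure q] (hb : Measurable b) {s : ℝ} (hs : 0 < s)
    (y : Euc d) : Integrable (fun x => ‖resid b s x y‖ ^ 2) (backLaw q b s y) :=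
  (integrable_backLaw_iff hb hs.le y _).2 (integrable_transKer_mul_norm_sq hb hs y)

/-- The conditional second moment of the noise is controlled by the log-density. -/
lemma integral_norm_sq_backLaw_le [IsProbabilityMeasure q] (hb : Measurable b) {s : ℝ} (hs : 0 < s)
    (y : Euc d) :
    ∫ x, ‖resid b s x y‖ ^ 2 ∂backLaw q b s y ≤ 4 * s * -Real.log (mass q b s y) := by
  have hu := mass_pos (q := q) hb hs.le y
  rw [integral_backLaw, smul_eq_mul, inv_mul_le_iff₀ hu]
  simp only [smul_eq_mul]
  set u := mass q b s y with hu'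
  -- The inequality `1 - 1/r ≤ log r` with `r = transKer / u`. Integrated, it says that the relative
  -- entropy of `backLaw` with respect to `q` is nonnegative.
  have key : ∀ x, transKer b s x y - u ≤
      -(1 / (4 * s)) * (transKer b s x y * ‖resid b s x y‖ ^ 2) - Real.log u * transKer b s x y := by
    intro x
    have he := transKer_pos (b := b) s x y
    have h1 := Real.one_sub_inv_le_log_of_pos (div_pos he hu)
    rw [Real.log_div he.ne' hu.ne'] at h1
    have h2 : Real.log (transKer b s x y) = -(1 / (4 * s)) * ‖resid b s x y‖ ^ 2 := by
      rw [transKer, Real.log_exp]; field_simp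
    rw [h2, inv_div] at h1
    have h3 := mul_le_mul_of_nonneg_left h1 he.le
    have h4 : transKer b s x y * (1 - u / transKer b s x y) = transKer b s x y - u := by
      field_simp
    rw [h4] at h3
    linarith
  have hi1 := integrable_transKer (q := q) hb hs.le y
  have hi2 := integrable_transKer_mul_norm_sq (q := q) hb hs y
  have h := integral_mono (hi1.sub (integrable_const u))
    ((hi2.const_mul (-(1 / (4 * s)))).sub (hi1.const_mul (Real.log u))) key
  simp only [Pi.sub_apply] at h
  rw [integral_sub hi1 (integrable_const _), integral_sub (hi2.const_mul _) (hi1.const_mul _),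
    integral_const_mul, integral_const_mul] at h
  have e1 : ∫ x, transKer b s x y ∂q = u := rfl
  rw [e1] at h
  simp only [integral_const, probReal_univ, one_smul, sub_self] at h
  have h5 : 1 / (4 * s) * ∫ x, transKer b s x y * ‖resid b s x y‖ ^ 2 ∂q ≤ -(Real.log u * u) := by
    linarith
  rw [one_div, inv_mul_le_iff₀ (by positivity)] at h5
  linarith

lemma integrable_resid_backLaw [IsProbabilityMeasure q] (hb : Measurable b) {s : ℝ} (hs : 0 < s)
    (y : Euc d) : Integrable (fun x => resid b s x y) (backLaw q b s y) := by
  have := isProbabilityMeasure_backLaw (q := q) hb hs.le y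
  have hm := measurable_resid_left hb s y
  refine ((integrable_const 1).add (integrable_norm_sq_backLaw (q := q) hb hs y)).mono'
    hm.aestronglyMeasurable (.of_forall fun x => ?_)
  simp only [Pi.add_apply]
  nlinarith [sq_nonneg (‖resid b s x y‖ - 1)]

/-- Jensen for the conditional expectation defining the score, with prefactor `(2s)⁻² · 4s = 1/s`.
Since `-log mass` grows quadratically, the score grows linearly. -/
lemma norm_score_sq_le [IsProbabilityMeasure q] (hb : Measurable b) {s : ℝ} (hs : 0 < s)
    (y : Euc d) : ‖score q b s y‖ ^ 2 ≤ -Real.log (mass q b s y) / s := by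
  have := isProbabilityMeasure_backLaw (q := q) hb hs.le y
  have h1 := norm_integral_sq_le (integrable_resid_backLaw (q := q) hb hs y)
    (integrable_norm_sq_backLaw hb hs y)
  have h2 := h1.trans (integral_norm_sq_backLaw_le hb hs y)
  rw [score, integral_smul, norm_smul, mul_pow, norm_neg, Real.norm_of_nonneg (by positivity),
    div_pow, le_div_iff₀ hs]
  calc _ ≤ 1 ^ 2 / (2 * s) ^ 2 * (4 * s * -Real.log (mass q b s y)) * s := by gcongr
    _ = _ := by field_simp; ring

lemma abs_logKerRate_le (hb : LipschitzWith L b) {s : ℝ} (hs : 0 < s) (hsL : s * L ≤ 1 / 2)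
    (x y : Euc d) : |logKerRate b s x y| ≤
      (1 / (4 * s ^ 2) + (1 + 12 * L ^ 2) / (4 * s)) * ‖resid b s x y‖ ^ 2 +
        3 / s * (‖b 0‖ ^ 2 + L ^ 2 * ‖y‖ ^ 2) := by
  have h1 := norm_drift_le hb hs.le hsL x y
  have h2 := abs_real_inner_le_norm (resid b s x y) (b x)
  set r := ‖resid b s x y‖
  have h3 : ‖b x‖ ^ 2 ≤ 12 * (‖b 0‖ ^ 2 + L ^ 2 * ‖y‖ ^ 2 + L ^ 2 * r ^ 2) := by
    have := pow_le_pow_left₀ (norm_nonneg _) h1 2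
    nlinarith [sq_nonneg (‖b 0‖ - L * ‖y‖), sq_nonneg (‖b 0‖ - L * r), sq_nonneg (L * ‖y‖ - L * r)]
  have h4 : |⟪resid b s x y, b x⟫| ≤ (r ^ 2 + ‖b x‖ ^ 2) / 2 := by
    nlinarith [sq_nonneg (r - ‖b x‖)]
  unfold logKerRate
  calc _ ≤ |r ^ 2 / (4 * s ^ 2)| + |⟪resid b s x y, b x⟫ / (2 * s)| := abs_add_le _ _
    _ = r ^ 2 / (4 * s ^ 2) + |⟪resid b s x y, b x⟫| / (2 * s) := by
        rw [abs_of_nonneg (by positivity), abs_div, abs_of_nonneg (show 0 ≤ 2 * s by positivity)]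
    _ ≤ r ^ 2 / (4 * s ^ 2) +
        ((r ^ 2 + 12 * (‖b 0‖ ^ 2 + L ^ 2 * ‖y‖ ^ 2 + L ^ 2 * r ^ 2)) / 2) / (2 * s) := by
        gcongr; linarith
    _ = _ := by field_simp; ring

lemma measurable_logKerRate (hb : Measurable b) (s : ℝ) :
    Measurable (fun z : Euc d × Euc d => logKerRate b s z.1 z.2) := by
  have := measurable_resid hb s
  unfold logKerRate
  fun_prop

lemma integrable_logKerRate_backLaw [IsProbabilityMeasure q] (hb : LipschitzWith L b) {s : ℝ}
    (hs : 0 < s) (hsL : s * L ≤ 1 / 2) (y : Euc d) :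
    Integrable (fun x => logKerRate b s x y) (backLaw q b s y) := by
  have hbm := hb.continuous.measurable
  have := isProbabilityMeasure_backLaw (q := q) hbm hs.le y
  refine (((integrable_norm_sq_backLaw hbm hs y).const_mul _).add (integrable_const _)).mono'
    ?_ (.of_forall fun x => abs_logKerRate_le hb hs hsL x y)
  exact ((measurable_logKerRate hbm s).comp
    (measurable_id.prodMk measurable_const)).aestronglyMeasurable

lemma measurable_rate [SFinite q] (hb : Measurable b) (s : ℝ) : Measurable (rate q b s) :=
  measurable_integral_backLaw hb s (measurable_logKerRate hb s)

lemma measurable_score [SFinite q] (hb : Measurable b) (s : ℝ) : Measurable (score q b s) :=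
  measurable_integral_backLaw hb s ((measurable_resid hb s).fun_const_smul _)

lemma abs_rate_le [IsProbabilityMeasure q] (hb : LipschitzWith L b) {s : ℝ}
    (hs : 0 < s) (hsL : s * L ≤ 1 / 2) (y : Euc d) :
    |rate q b s y| ≤ (1 / (4 * s ^ 2) + (1 + 12 * L ^ 2) / (4 * s)) *
      (4 * s * -Real.log (mass q b s y)) + 3 / s * (‖b 0‖ ^ 2 + L ^ 2 * ‖y‖ ^ 2) := by
  have hbm := hb.continuous.measurable
  have := isProbabilityMeasure_backLaw (q := q) hbm hs.le y
  have hi := integrable_norm_sq_backLaw (q := q) hbm hs y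
  have hbd := fun x => abs_logKerRate_le hb hs hsL x y
  have hA : 0 ≤ 1 / (4 * s ^ 2) + (1 + 12 * (L : ℝ) ^ 2) / (4 * s) := by positivity
  generalize 1 / (4 * s ^ 2) + (1 + 12 * (L : ℝ) ^ 2) / (4 * s) = A at hbd hA ⊢
  generalize 3 / s * (‖b 0‖ ^ 2 + L ^ 2 * ‖y‖ ^ 2) = B at hbd ⊢
  have h1 := integral_mono (integrable_logKerRate_backLaw hb hs hsL y).abs
    ((hi.const_mul A).add (integrable_const B)) hbd
  simp only [Pi.add_apply] at h1
  rw [integral_add (hi.const_mul _) (integrable_const _), integral_const_mul] at h1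
  simp only [integral_const, probReal_univ, one_smul] at h1
  have h2 := mul_le_mul_of_nonneg_left (integral_norm_sq_backLaw_le (q := q) hbm hs y) hA
  have h3 : |rate q b s y| ≤ ∫ x, |logKerRate b s x y| ∂backLaw q b s y :=
    abs_integral_le_integral_abs
  linarith

/-- Locally uniform growth bounds for the log-density and its derivatives. -/
lemma exists_growth_bound [IsProbabilityMeasure q] (hq : Integrable (fun x => ‖x‖ ^ 2) q)
    (hb : LipschitzWith L b) {t : ℝ} (ht : 0 < t) (htL : t * L ≤ 1 / 4) :
    ∃ C, 0 ≤ C ∧ ∀ s ∈ Ioo (t / 2) (2 * t), ∀ y,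
      -Real.log (mass q b s y) ≤ C * (1 + ‖y‖ ^ 2) ∧
      ‖score q b s y‖ ≤ C * (1 + ‖y‖) ∧ |rate q b s y| ≤ C * (1 + ‖y‖ ^ 2) := by
  have hbm := hb.continuous.measurable
  set Q := ∫ x, ‖x‖ ^ 2 ∂q with hQ
  have hQ0 : 0 ≤ Q := integral_nonneg fun x => sq_nonneg _
  set C1 := (3 * (1 + (2 * t * ‖b 0‖) ^ 2 + 4 * Q)) / (2 * t) with hC1
  have hC1p : 0 ≤ C1 := by positivity
  have hlog : ∀ s ∈ Ioo (t / 2) (2 * t), ∀ y, -Real.log (mass q b s y) ≤ C1 * (1 + ‖y‖ ^ 2) := by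
    rintro s ⟨hs1, hs2⟩ y
    have hs : 0 < s := by linarith
    -- The time window reaches `2t`, so the hypothesis `t L ≤ 1/4` gives exactly the `1/2` required
    -- by `norm_drift_le`.
    have hsL : s * L ≤ 1 / 2 := by nlinarith [mul_le_mul_of_nonneg_right hs2.le L.coe_nonneg]
    refine (neg_log_mass_le hq hb hs.le y).trans ?_
    have hp : ∀ x, ‖resid b s x y‖ ^ 2 / (4 * s) ≤
        (3 / (2 * t)) * (‖y‖ ^ 2 + (2 * t * ‖b 0‖) ^ 2) + (3 / (2 * t) * 4) * ‖x‖ ^ 2 := by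
      intro x
      have h1 : ‖resid b s x y‖ ≤ ‖y‖ + 2 * t * ‖b 0‖ + 2 * ‖x‖ := by
        refine (norm_resid_le hb hs.le x y).trans ?_
        gcongr
        linarith
      have h2 := pow_le_pow_left₀ (norm_nonneg _) h1 2
      calc ‖resid b s x y‖ ^ 2 / (4 * s) ≤ ‖resid b s x y‖ ^ 2 / (2 * t) :=
            div_le_div_of_nonneg_left (by positivity) (by positivity) (by linarith)
        _ ≤ (3 * (‖y‖ ^ 2 + (2 * t * ‖b 0‖) ^ 2 + 4 * ‖x‖ ^ 2)) / (2 * t) := by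
            gcongr
            nlinarith [sq_nonneg (‖y‖ - 2 * t * ‖b 0‖), sq_nonneg (‖y‖ - 2 * ‖x‖),
              sq_nonneg (2 * t * ‖b 0‖ - 2 * ‖x‖)]
        _ = _ := by ring
    refine (integral_mono ((integrable_norm_resid_sq hq hb hs.le y).div_const _)
      ((integrable_const _).add (hq.const_mul _)) hp).trans ?_
    simp only [Pi.add_apply]
    rw [integral_add (integrable_const _) (hq.const_mul _), integral_const_mul (3 / (2 * t) * 4), ← hQ]
    simp only [integral_const, probReal_univ, one_smul]
    have e : C1 * (1 + ‖y‖ ^ 2) - (3 / (2 * t) * (‖y‖ ^ 2 + (2 * t * ‖b 0‖) ^ 2) + 3 / (2 * t) * 4 * Q)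
        = 3 / (2 * t) * (1 + ‖y‖ ^ 2 * ((2 * t * ‖b 0‖) ^ 2 + 4 * Q)) := by
      rw [hC1]; ring
    have : 0 ≤ 3 / (2 * t) * (1 + ‖y‖ ^ 2 * ((2 * t * ‖b 0‖) ^ 2 + 4 * Q)) := by positivity
    linarith
  -- The `+ 1` ensures `2 / t * C1 ≤ C2 ^ 2`, so that a square root of the bound can be taken.
  set C2 := 2 / t * C1 + 1 with hC2
  set C3 := (1 / t ^ 2 + (1 + 12 * L ^ 2) / (2 * t)) * (8 * t * C1) +
    6 / t * (‖b 0‖ ^ 2 + L ^ 2) with hC3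
  have hC2p : 0 ≤ C2 := by positivity
  have hC3p : 0 ≤ C3 := by positivity
  refine ⟨C1 + C2 + C3, by positivity, fun s hs y => ⟨?_, ?_, ?_⟩⟩
  · refine (hlog s hs y).trans ?_
    gcongr; linarith
  · have hs0 : 0 < s := by linarith [hs.1]
    have h1 := norm_score_sq_le (q := q) hbm hs0 y
    have h2 : -Real.log (mass q b s y) / s ≤ (C1 * (1 + ‖y‖ ^ 2)) / (t / 2) :=
      div_le_div₀ (by positivity) (hlog s hs y) (by linarith) hs.1.le
    have h3 : ‖score q b s y‖ ^ 2 ≤ (C2 * (1 + ‖y‖)) ^ 2 := by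
      calc _ ≤ (C1 * (1 + ‖y‖ ^ 2)) / (t / 2) := h1.trans h2
        _ = (2 / t * C1) * (1 + ‖y‖ ^ 2) := by field_simp
        _ ≤ C2 ^ 2 * (1 + ‖y‖) ^ 2 := by
            have : 0 ≤ 2 / t * C1 := by positivity
            gcongr
            · rw [hC2]; nlinarith
            · nlinarith [norm_nonneg y]
        _ = _ := by ring
    have h4 := (sq_le_sq₀ (norm_nonneg _) (by positivity)).1 h3
    refine h4.trans ?_
    gcongr; linarith
  · have hs0 : 0 < s := by linarith [hs.1]
    have hsL : s * L ≤ 1 / 2 := by nlinarith [mul_le_mul_of_nonneg_right hs.2.le L.coe_nonneg]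
    have hl := hlog s hs y
    have hl0 := neg_log_mass_nonneg (q := q) hbm hs0.le y
    have h1 := hs.1
    have h2 := hs.2
    calc |rate q b s y| ≤ _ := abs_rate_le hb hs0 hsL y
      _ ≤ (1 / t ^ 2 + (1 + 12 * L ^ 2) / (2 * t)) * (8 * t * (C1 * (1 + ‖y‖ ^ 2))) +
          6 / t * ((‖b 0‖ ^ 2 + L ^ 2) * (1 + ‖y‖ ^ 2)) := by
          have a1 : 1 / (4 * s ^ 2) ≤ 1 / t ^ 2 := by
            apply one_div_le_one_div_of_le (by positivity); nlinarith
          have a2 : (1 + 12 * (L : ℝ) ^ 2) / (4 * s) ≤ (1 + 12 * L ^ 2) / (2 * t) :=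
            div_le_div_of_nonneg_left (by positivity) (by positivity) (by linarith)
          have a3 : 4 * s * -Real.log (mass q b s y) ≤ 8 * t * (C1 * (1 + ‖y‖ ^ 2)) := by
            gcongr ?_ * ?_; linarith
          have a4 : 3 / s ≤ 6 / t := by
            rw [div_le_div_iff₀ hs0 ht]; linarith
          have a5 : ‖b 0‖ ^ 2 + L ^ 2 * ‖y‖ ^ 2 ≤ (‖b 0‖ ^ 2 + L ^ 2) * (1 + ‖y‖ ^ 2) := by
            nlinarith [mul_nonneg (sq_nonneg ‖b 0‖) (sq_nonneg ‖y‖), sq_nonneg (L : ℝ)]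
          gcongr
      _ = C3 * (1 + ‖y‖ ^ 2) := by rw [hC3]; ring
      _ ≤ _ := by gcongr; linarith

end EMDescent
end

/-! ### Joint differentiability in time and space, and differentiation along the step. -/

noncomputable section

namespace EMDescent

open scoped RealInnerProductSpace

variable {d : ℕ} {b : Euc d → Euc d} {L : ℝ≥0} {q : Measure (Euc d)}

/-- The linear form `(r, v) ↦ α r + ⟪β, v⟫`. -/
def jointForm (α : ℝ) (β : Euc d) : ℝ × Euc d →L[ℝ] ℝ :=
  α • ContinuousLinearMap.fst ℝ ℝ (Euc d) + (innerSL ℝ β).comp (ContinuousLinearMap.snd ℝ ℝ (Euc d))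

@[simp]
lemma jointForm_apply (α : ℝ) (β : Euc d) (p : ℝ × Euc d) :
    jointForm α β p = α * p.1 + ⟪β, p.2⟫ := by
  simp [jointForm, innerSL_apply_apply ℝ]

lemma norm_jointForm_le (α : ℝ) (β : Euc d) : ‖jointForm α β‖ ≤ |α| + ‖β‖ := by
  refine ContinuousLinearMap.opNorm_le_bound _ (by positivity) fun p => ?_
  rw [jointForm_apply, add_mul]
  refine (norm_add_le _ _).trans (add_le_add ?_ ?_)
  · rw [norm_mul, Real.norm_eq_abs α]
    gcongr
    exact norm_fst_le p
  · refine (norm_inner_le_norm _ _).trans ?_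
    gcongr
    exact norm_snd_le p

lemma smul_jointForm (c α : ℝ) (β : Euc d) : c • jointForm α β = jointForm (c * α) (c • β) := by
  refine ContinuousLinearMap.ext fun p => ?_
  simp only [smul_apply, jointForm_apply, smul_eq_mul, real_inner_smul_left]
  ring

lemma integral_jointForm {X : Type*} [MeasurableSpace X] {μ : Measure X} {α : X → ℝ}
    {β : X → Euc d} (hα : Integrable α μ) (hβ : Integrable β μ)
    (hi : Integrable (fun x => jointForm (α x) (β x)) μ) :
    ∫ x, jointForm (α x) (β x) ∂μ = jointForm (∫ x, α x ∂μ) (∫ x, β x ∂μ) := by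
  refine ContinuousLinearMap.ext fun p => ?_
  rw [ContinuousLinearMap.integral_apply hi]
  simp_rw [jointForm_apply]
  rw [integral_add (hα.mul_const _) (hβ.inner_const p.2), integral_mul_const]
  congr 1
  simp_rw [real_inner_comm p.2]
  exact integral_inner hβ p.2

lemma continuous_jointForm : Continuous (fun p : ℝ × Euc d => jointForm p.1 p.2) := by
  unfold jointForm
  have := (innerSL ℝ (E := Euc d)).continuous
  fun_prop

lemma measurable_logKerRate_left (hb : Measurable b) (s : ℝ) (y : Euc d) :
    Measurable (fun x => logKerRate b s x y) := by
  unfold logKerRate resid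
  fun_prop

lemma hasFDerivAt_transKer {s : ℝ} (hs : 0 < s) (x y : Euc d) :
    HasFDerivAt (fun p : ℝ × Euc d => transKer b p.1 x p.2)
      (transKer b s x y • jointForm (logKerRate b s x y) (-(1 / (2 * s)) • resid b s x y))
      (s, y) := by
  have h1 : HasFDerivAt (fun p : ℝ × Euc d => resid b p.1 x p.2)
      (ContinuousLinearMap.snd ℝ ℝ (Euc d) -
        (ContinuousLinearMap.fst ℝ ℝ (Euc d)).smulRight (b x)) (s, y) := by
    unfold resid
    exact (hasFDerivAt_snd.sub_const x).sub (hasFDerivAt_fst.smul_const (b x))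
  have h2 := h1.norm_sq
  have h3 : HasFDerivAt (fun p : ℝ × Euc d => (4 * p.1)⁻¹)
      (-((4 * s) ^ 2)⁻¹ • ((4 : ℝ) • ContinuousLinearMap.fst ℝ ℝ (Euc d))) (s, y) :=
    (hasDerivAt_inv (by positivity : 4 * s ≠ 0)).comp_hasFDerivAt (s, y)
      (hasFDerivAt_fst.const_mul 4)
  have h4 := (h2.neg.mul h3).exp
  have e : (fun p : ℝ × Euc d => transKer b p.1 x p.2) = fun p =>
      Real.exp (((-fun p : ℝ × Euc d => ‖resid b p.1 x p.2‖ ^ 2) * fun p : ℝ × Euc d => (4 * p.1)⁻¹) p) := by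
    ext p; rw [transKer, div_eq_mul_inv]; rfl
  rw [e]
  have hs' := hs.ne'
  have e0 : Real.exp (-‖resid b s x y‖ ^ 2 * (4 * s)⁻¹) = transKer b s x y := by
    rw [transKer, div_eq_mul_inv]
  refine h4.congr_fderiv ?_
  simp only [Pi.mul_apply, Pi.neg_apply]
  rw [e0]
  congr 1
  refine ContinuousLinearMap.ext fun p => ?_
  simp [jointForm_apply, logKerRate, real_inner_smul_left, real_inner_smul_right,
    innerSL_apply_apply ℝ]
  field_simp
  ring

lemma transKer_mul_norm_le {s : ℝ} (hs : 0 < s) (x y : Euc d) :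
    transKer b s x y * ‖resid b s x y‖ ≤ 1 + 4 * s := by
  have h1 := transKer_mul_norm_sq_le (b := b) hs x y
  have h2 := transKer_le_one (b := b) hs.le x y
  have h3 := transKer_pos (b := b) s x y
  nlinarith [mul_nonneg h3.le (sq_nonneg (‖resid b s x y‖ - 1)),
    mul_nonneg h3.le (norm_nonneg (resid b s x y))]

/-- The kernel absorbs all powers of the residual, leaving a bound that is affine in `‖b x‖` and
independent of `y`. This is what makes the derivative of the kernel `q`-integrable. -/
lemma transKer_mul_abs_logKerRate_le {s : ℝ} (hs : 0 < s) (x y : Euc d) :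
    transKer b s x y * |logKerRate b s x y| ≤ 1 / s + (1 + 4 * s) / (2 * s) * ‖b x‖ := by
  have h1 := transKer_mul_norm_sq_le (b := b) hs x y
  have h2 := transKer_mul_norm_le (b := b) hs x y
  have h3 := transKer_pos (b := b) s x y
  have h4 : |logKerRate b s x y| ≤ ‖resid b s x y‖ ^ 2 / (4 * s ^ 2) +
      ‖resid b s x y‖ * ‖b x‖ / (2 * s) := by
    unfold logKerRate
    refine (abs_add_le _ _).trans (add_le_add (abs_of_nonneg (by positivity)).le ?_)
    rw [abs_div, abs_of_nonneg (show 0 ≤ 2 * s by positivity)]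
    gcongr
    exact abs_real_inner_le_norm _ _
  calc _ ≤ transKer b s x y * (‖resid b s x y‖ ^ 2 / (4 * s ^ 2) +
      ‖resid b s x y‖ * ‖b x‖ / (2 * s)) := by gcongr
    _ = (transKer b s x y * ‖resid b s x y‖ ^ 2) / (4 * s ^ 2) +
        (transKer b s x y * ‖resid b s x y‖) / (2 * s) * ‖b x‖ := by ring
    _ ≤ (4 * s) / (4 * s ^ 2) + (1 + 4 * s) / (2 * s) * ‖b x‖ := by gcongr
    _ = _ := by field_simp

lemma integrable_norm_drift [IsProbabilityMeasure q] (hq : Integrable (fun x => ‖x‖ ^ 2) q)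
    (hb : LipschitzWith L b) : Integrable (fun x => ‖b x‖) q := by
  have hbm := hb.continuous.measurable
  refine ((integrable_const (‖b 0‖ + L)).add (hq.const_mul L)).mono' (by fun_prop)
    (.of_forall fun x => ?_)
  rw [norm_norm]
  refine (norm_le_of_lipschitz hb x).trans ?_
  simp only [Pi.add_apply]
  nlinarith [mul_nonneg L.coe_nonneg (sq_nonneg (‖x‖ - 1)), mul_nonneg L.coe_nonneg (sq_nonneg ‖x‖)]

lemma integrable_transKer_mul_logKerRate [IsProbabilityMeasure q]
    (hq : Integrable (fun x => ‖x‖ ^ 2) q) (hb : LipschitzWith L b) {s : ℝ} (hs : 0 < s)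
    (y : Euc d) : Integrable (fun x => transKer b s x y * logKerRate b s x y) q := by
  have hbm := hb.continuous.measurable
  have h1 := measurable_transKer_left hbm s y
  have h2 := measurable_logKerRate_left hbm s y
  refine ((integrable_const (1 / s)).fun_add ((integrable_norm_drift hq hb).const_mul
    ((1 + 4 * s) / (2 * s)))).mono' (by fun_prop) (.of_forall fun x => ?_)
  rw [norm_mul, Real.norm_of_nonneg (transKer_pos _ _ _).le]
  exact transKer_mul_abs_logKerRate_le hs x y

lemma integrable_transKer_smul_resid [IsProbabilityMeasure q] (hb : Measurable b) {s : ℝ}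
    (hs : 0 < s) (y : Euc d) : Integrable (fun x => transKer b s x y • resid b s x y) q :=
  (integrable_backLaw_iff hb hs.le y _).1 (integrable_resid_backLaw hb hs y)

/-- Differentiation under the integral, dominated uniformly over times in `(t/2, 2t)` and over all
`y`. The derivative is taken jointly in time and space because `log mass` is later evaluated at the
moving point `(s, emStep b s z)`. -/
theorem hasFDerivAt_mass [IsProbabilityMeasure q] (hq : Integrable (fun x => ‖x‖ ^ 2) q)
    (hb : LipschitzWith L b) {t : ℝ} (ht : 0 < t) (y : Euc d) :
    HasFDerivAt (fun p : ℝ × Euc d => mass q b p.1 p.2)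
      (jointForm (∫ x, transKer b t x y * logKerRate b t x y ∂q)
        (∫ x, transKer b t x y • (-(1 / (2 * t)) • resid b t x y) ∂q)) (t, y) := by
  have hbm := hb.continuous.measurable
  have hbd : ∀ s ∈ Ioo (t / 2) (2 * t), ∀ x y : Euc d,
      ‖transKer b s x y • jointForm (logKerRate b s x y) (-(1 / (2 * s)) • resid b s x y)‖ ≤
        (2 / t + (1 + 8 * t) / t) + (1 + 8 * t) / t * ‖b x‖ := by
    rintro s ⟨hs1, hs2⟩ x y
    have hs : 0 < s := by linarith
    have hk := transKer_pos (b := b) s x y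
    rw [norm_smul, Real.norm_of_nonneg hk.le]
    calc _ ≤ transKer b s x y * (|logKerRate b s x y| + 1 / (2 * s) * ‖resid b s x y‖) := by
          gcongr
          refine (norm_jointForm_le _ _).trans ?_
          rw [norm_smul, norm_neg, Real.norm_of_nonneg (by positivity)]
      _ = transKer b s x y * |logKerRate b s x y| +
          1 / (2 * s) * (transKer b s x y * ‖resid b s x y‖) := by ring
      _ ≤ (1 / s + (1 + 4 * s) / (2 * s) * ‖b x‖) + 1 / (2 * s) * (1 + 4 * s) :=
          add_le_add (transKer_mul_abs_logKerRate_le hs x y)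
            (mul_le_mul_of_nonneg_left (transKer_mul_norm_le hs x y) (by positivity))
      _ = 1 / s + (1 + 4 * s) / (2 * s) + (1 + 4 * s) / (2 * s) * ‖b x‖ := by ring
      _ ≤ _ := by
          have a1 : 1 / s ≤ 2 / t := by rw [div_le_div_iff₀ hs ht]; linarith
          have a2 : (1 + 4 * s) / (2 * s) ≤ (1 + 8 * t) / t :=
            div_le_div₀ (by positivity) (by linarith) ht (by linarith)
          gcongr
  have hmem : Ioo (t / 2) (2 * t) ×ˢ (univ : Set (Euc d)) ∈ 𝓝 ((t, y) : ℝ × Euc d) :=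
    prod_mem_nhds (Ioo_mem_nhds (by linarith) (by linarith)) univ_mem
  have hmeas : AEStronglyMeasurable (fun x => transKer b t x y •
      jointForm (logKerRate b t x y) (-(1 / (2 * t)) • resid b t x y)) q := by
    have h1 := (measurable_logKerRate_left hbm t y).aestronglyMeasurable (μ := q)
    have h2 := ((measurable_resid_left hbm t y).fun_const_smul (-(1 / (2 * t)))).aestronglyMeasurable
      (μ := q)
    exact (measurable_transKer_left hbm t y).aestronglyMeasurable.smul
      (continuous_jointForm.comp_aestronglyMeasurable (h1.prodMk h2))
  have hbi : Integrable (fun x => (2 / t + (1 + 8 * t) / t) + (1 + 8 * t) / t * ‖b x‖) q :=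
    (integrable_const _).fun_add ((integrable_norm_drift hq hb).const_mul _)
  have h := hasFDerivAt_integral_of_dominated_of_fderiv_le (μ := q) (𝕜 := ℝ)
    (F := fun (p : ℝ × Euc d) x => transKer b p.1 x p.2) (x₀ := (t, y))
    (F' := fun p x => transKer b p.1 x p.2 •
      jointForm (logKerRate b p.1 x p.2) (-(1 / (2 * p.1)) • resid b p.1 x p.2))
    hmem (.of_forall fun p => (measurable_transKer_left hbm p.1 p.2).aestronglyMeasurable)
    (integrable_transKer hbm ht.le y) hmeas
    (.of_forall fun x p hp => hbd p.1 hp.1 x p.2) hbi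
    (.of_forall fun x p hp => hasFDerivAt_transKer (by have := hp.1.1; linarith) x p.2)
  refine h.congr_fderiv ?_
  simp_rw [smul_jointForm]
  refine integral_jointForm (integrable_transKer_mul_logKerRate hq hb ht y) ?_ ?_
  · simp_rw [smul_comm _ (-(1 / (2 * t)))]
    exact (integrable_transKer_smul_resid (q := q) hbm ht y).smul (-(1 / (2 * t)))
  · simp_rw [← smul_jointForm]
    exact hbi.mono' hmeas (.of_forall fun x => hbd t ⟨by linarith, by linarith⟩ x y)

/-- Dividing by the mass turns the integrals against the kernel into expectations under `backLaw`.
-/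
theorem hasFDerivAt_log_mass [IsProbabilityMeasure q] (hq : Integrable (fun x => ‖x‖ ^ 2) q)
    (hb : LipschitzWith L b) {t : ℝ} (ht : 0 < t) (y : Euc d) :
    HasFDerivAt (fun p : ℝ × Euc d => Real.log (mass q b p.1 p.2))
      (jointForm (rate q b t y) (score q b t y)) (t, y) := by
  have h := (hasFDerivAt_mass hq hb ht y).log
    (mass_pos (q := q) hb.continuous.measurable ht.le y).ne'
  refine h.congr_fderiv ?_
  rw [smul_jointForm, rate, score, integral_backLaw, integral_backLaw]
  simp only [smul_eq_mul]

/-! ### Differentiation along the interpolation -/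

lemma norm_emStep_le (hb : LipschitzWith L b) {s : ℝ} (hs : 0 ≤ s) (z : Euc d × Euc d) :
    ‖emStep b s z‖ ≤ s * ‖b 0‖ + (1 + s * L) * ‖z.1‖ + √(2 * s) * ‖z.2‖ := by
  unfold emStep
  have h1 := norm_add₃_le (a := z.1) (b := s • b z.1) (c := √(2 * s) • z.2)
  rw [norm_smul, norm_smul, Real.norm_of_nonneg hs, Real.norm_of_nonneg (Real.sqrt_nonneg _)] at h1
  nlinarith [mul_le_mul_of_nonneg_left (norm_le_of_lipschitz hb z.1) hs]

lemma hasDerivAt_emStep {s : ℝ} (hs : 0 < s) (z : Euc d × Euc d) :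
    HasDerivAt (fun r => emStep b r z) (b z.1 + (√(2 * s))⁻¹ • z.2) s := by
  unfold emStep
  have h1 : HasDerivAt (fun r : ℝ => √(2 * r)) ((√(2 * s))⁻¹) s := by
    have := ((hasDerivAt_id' s).const_mul 2).sqrt (by positivity)
    convert this using 1
    rw [inv_eq_one_div, div_eq_div_iff (by positivity) (by positivity)]
    ring
  have h2 := ((hasDerivAt_id s).smul_const (b z.1)).const_add z.1
  rw [one_smul] at h2
  exact h2.add (h1.smul_const z.2)

lemma integrable_growth [IsProbabilityMeasure q] (hq : Integrable (fun x => ‖x‖ ^ 2) q) :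
    Integrable (fun z : Euc d × Euc d => 1 + ‖z.1‖ ^ 2 + ‖z.2‖ ^ 2)
      (q.prod (stdGaussian (Euc d))) :=
  ((integrable_const _).fun_add (hq.comp_fst _)).fun_add (integrable_norm_sq_stdGaussian.comp_snd _)

lemma exists_emStep_bound (hb : LipschitzWith L b) {t : ℝ} (ht : 0 < t) :
    ∃ C, 0 ≤ C ∧ ∀ s ∈ Icc 0 (2 * t), ∀ z,
      1 + ‖emStep b s z‖ ^ 2 ≤ C * (1 + ‖z.1‖ ^ 2 + ‖z.2‖ ^ 2) := by
  set A := 2 * t * ‖b 0‖ with hA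
  set B := 1 + 2 * t * L with hB
  have hA0 : 0 ≤ A := by positivity
  have hB0 : 0 ≤ B := by positivity
  refine ⟨1 + 3 * (A ^ 2 + B ^ 2 + 4 * t), by positivity, fun s hs z => ?_⟩
  have h1 : ‖emStep b s z‖ ≤ A + B * ‖z.1‖ + √(4 * t) * ‖z.2‖ := by
    refine (norm_emStep_le hb hs.1 z).trans ?_
    have h0 := hs.1
    have h1 := hs.2
    have h2 : √(2 * s) ≤ √(4 * t) := Real.sqrt_le_sqrt (by linarith)
    rw [hA, hB]
    gcongr
  have h2 := pow_le_pow_left₀ (norm_nonneg _) h1 2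
  have h3 : (√(4 * t)) ^ 2 = 4 * t := Real.sq_sqrt (by positivity)
  have h4 : (A + B * ‖z.1‖ + √(4 * t) * ‖z.2‖) ^ 2 ≤
      3 * (A ^ 2 + B ^ 2 * ‖z.1‖ ^ 2 + 4 * t * ‖z.2‖ ^ 2) := by
    have h5 : 4 * t * ‖z.2‖ ^ 2 = (√(4 * t) * ‖z.2‖) ^ 2 := by rw [mul_pow, h3]
    rw [h5]
    nlinarith [sq_nonneg (A - B * ‖z.1‖), sq_nonneg (A - √(4 * t) * ‖z.2‖),
      sq_nonneg (B * ‖z.1‖ - √(4 * t) * ‖z.2‖)]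
  have h5 : 3 * (A ^ 2 + B ^ 2 * ‖z.1‖ ^ 2 + 4 * t * ‖z.2‖ ^ 2) ≤
      3 * (A ^ 2 + B ^ 2 + 4 * t) * (1 + ‖z.1‖ ^ 2 + ‖z.2‖ ^ 2) := by
    have := sq_nonneg ‖z.1‖
    have := sq_nonneg ‖z.2‖
    have e : 3 * (A ^ 2 + B ^ 2 + 4 * t) * (1 + ‖z.1‖ ^ 2 + ‖z.2‖ ^ 2) -
      3 * (A ^ 2 + B ^ 2 * ‖z.1‖ ^ 2 + 4 * t * ‖z.2‖ ^ 2) =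
      3 * (A ^ 2 * (‖z.1‖ ^ 2 + ‖z.2‖ ^ 2) + B ^ 2 * (1 + ‖z.2‖ ^ 2) + 4 * t * (1 + ‖z.1‖ ^ 2)) := by
      ring
    have : 0 ≤ 3 * (A ^ 2 * (‖z.1‖ ^ 2 + ‖z.2‖ ^ 2) + B ^ 2 * (1 + ‖z.2‖ ^ 2) +
      4 * t * (1 + ‖z.1‖ ^ 2)) := by positivity
    linarith
  nlinarith [sq_nonneg ‖z.1‖, sq_nonneg ‖z.2‖]

/-- Functions of quadratic growth are integrable along the interpolation. -/
lemma integrable_comp_emStep [IsProbabilityMeasure q] (hq : Integrable (fun x => ‖x‖ ^ 2) q)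
    (hb : LipschitzWith L b) {s : ℝ} (hs : 0 ≤ s) {F : Type*} [NormedAddCommGroup F]
    [MeasurableSpace F] [BorelSpace F] [SecondCountableTopology F] {f : Euc d → F}
    (hf : Measurable f) {C : ℝ} (hC : ∀ y, ‖f y‖ ≤ C * (1 + ‖y‖ ^ 2)) :
    Integrable (fun z => f (emStep b s z)) (q.prod (stdGaussian (Euc d))) := by
  obtain ⟨C', hC', h⟩ := exists_emStep_bound (d := d) hb (t := s + 1) (by linarith)
  have hC0 : 0 ≤ C := by
    have := (norm_nonneg _).trans (hC 0)
    simpa using this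
  refine ((integrable_growth hq).const_mul (C * C')).mono'
    (hf.comp (measurable_emStep hb.continuous.measurable s)).aestronglyMeasurable
    (.of_forall fun z => (hC _).trans ?_)
  rw [mul_assoc]
  gcongr
  exact h s ⟨hs, by linarith⟩ z

/-- Differentiation of `s ↦ E Φ(s, Z_s)` along the interpolation. -/
theorem hasDerivAt_integral_emStep [IsProbabilityMeasure q] (hq : Integrable (fun x => ‖x‖ ^ 2) q)
    (hb : LipschitzWith L b) {t : ℝ} (ht : 0 < t) {Φ : ℝ → Euc d → ℝ} {α : ℝ → Euc d → ℝ}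
    {β : ℝ → Euc d → Euc d} {C C' : ℝ}
    (hΦm : ∀ s ∈ Ioo (t / 2) (2 * t), Measurable (Φ s)) (hαm : Measurable (α t))
    (hβm : Measurable (β t)) (hΦ : ∀ y, |Φ t y| ≤ C' * (1 + ‖y‖ ^ 2))
    (hd : ∀ s ∈ Ioo (t / 2) (2 * t), ∀ y,
      HasFDerivAt (fun p : ℝ × Euc d => Φ p.1 p.2) (jointForm (α s y) (β s y)) (s, y))
    (hα : ∀ s ∈ Ioo (t / 2) (2 * t), ∀ y, |α s y| ≤ C * (1 + ‖y‖ ^ 2))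
    (hβ : ∀ s ∈ Ioo (t / 2) (2 * t), ∀ y, ‖β s y‖ ≤ C * (1 + ‖y‖)) :
    HasDerivAt (fun s => ∫ z, Φ s (emStep b s z) ∂(q.prod (stdGaussian (Euc d))))
      (∫ z, (α t (emStep b t z) + ⟪β t (emStep b t z), b z.1 + (√(2 * t))⁻¹ • z.2⟫)
        ∂(q.prod (stdGaussian (Euc d)))) t := by
  have hbm := hb.continuous.measurable
  obtain ⟨K, hK, hKb⟩ := exists_emStep_bound (d := d) hb ht
  have htm : t ∈ Ioo (t / 2) (2 * t) := ⟨by linarith, by linarith⟩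
  have hC0 : 0 ≤ C := by
    have := (abs_nonneg _).trans (hα t htm 0)
    simpa using this
  have hZ := measurable_emStep hbm t
  set D := 2 * (‖b 0‖ ^ 2 + L ^ 2) + 2 * t⁻¹ with hD
  have hD0 : 0 ≤ D := by positivity
  refine (hasDerivAt_integral_of_dominated_loc_of_deriv_le (𝕜 := ℝ)
    (F' := fun s z => α s (emStep b s z) + ⟪β s (emStep b s z), b z.1 + (√(2 * s))⁻¹ • z.2⟫)
    (bound := fun z => (C * K + C * (K + D)) * (1 + ‖z.1‖ ^ 2 + ‖z.2‖ ^ 2))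
    (Ioo_mem_nhds htm.1 htm.2) ?_ ?_ ?_ ?_ ((integrable_growth hq).const_mul _) ?_).2
  · filter_upwards [Ioo_mem_nhds htm.1 htm.2] with s hs
    exact ((hΦm s hs).comp (measurable_emStep hbm s)).aestronglyMeasurable
  · exact integrable_comp_emStep hq hb ht.le (hΦm t htm) hΦ
  · exact ((hαm.comp hZ).add ((hβm.comp hZ).inner (by fun_prop))).aestronglyMeasurable
  · refine .of_forall fun z s hs => ?_
    have hs0 : 0 < s := by linarith [hs.1]
    have hz := hKb s ⟨hs0.le, hs.2.le⟩ z
    set Z := emStep b s z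
    set V := b z.1 + (√(2 * s))⁻¹ • z.2 with hV
    have h1 := hα s hs Z
    have h2 := hβ s hs Z
    have h3 : ‖V‖ ^ 2 ≤ 2 * D * (1 + ‖z.1‖ ^ 2 + ‖z.2‖ ^ 2) := by
      have a1 : ‖V‖ ≤ ‖b z.1‖ + ‖(√(2 * s))⁻¹ • z.2‖ := norm_add_le _ _
      have a2 : ‖(√(2 * s))⁻¹ • z.2‖ ^ 2 ≤ t⁻¹ * ‖z.2‖ ^ 2 := by
        rw [norm_smul, mul_pow, norm_inv, inv_pow, Real.norm_of_nonneg (Real.sqrt_nonneg _),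
          Real.sq_sqrt (by positivity)]
        gcongr
        linarith [hs.1]
      have a3 : ‖b z.1‖ ^ 2 ≤ 2 * (‖b 0‖ ^ 2 + L ^ 2 * ‖z.1‖ ^ 2) := by
        have := pow_le_pow_left₀ (norm_nonneg _) (norm_le_of_lipschitz hb z.1) 2
        nlinarith [sq_nonneg (‖b 0‖ - L * ‖z.1‖)]
      have a4 : ‖V‖ ^ 2 ≤ 2 * ‖b z.1‖ ^ 2 + 2 * ‖(√(2 * s))⁻¹ • z.2‖ ^ 2 := by
        have := pow_le_pow_left₀ (norm_nonneg _) a1 2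
        nlinarith [sq_nonneg (‖b z.1‖ - ‖(√(2 * s))⁻¹ • z.2‖)]
      have a5 : 2 * D * (1 + ‖z.1‖ ^ 2 + ‖z.2‖ ^ 2) - 2 * (2 * (‖b 0‖ ^ 2 + L ^ 2 * ‖z.1‖ ^ 2)) -
          2 * (t⁻¹ * ‖z.2‖ ^ 2) = 4 * (‖b 0‖ ^ 2 * (‖z.1‖ ^ 2 + ‖z.2‖ ^ 2) + L ^ 2 * (1 + ‖z.2‖ ^ 2))
          + 4 * t⁻¹ * (1 + ‖z.1‖ ^ 2) + 2 * t⁻¹ * ‖z.2‖ ^ 2 := by rw [hD]; ring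
      have a6 : 0 ≤ 4 * (‖b 0‖ ^ 2 * (‖z.1‖ ^ 2 + ‖z.2‖ ^ 2) + L ^ 2 * (1 + ‖z.2‖ ^ 2))
          + 4 * t⁻¹ * (1 + ‖z.1‖ ^ 2) + 2 * t⁻¹ * ‖z.2‖ ^ 2 := by positivity
      linarith
    have h4 : ‖⟪β s Z, V⟫‖ ≤ C * (K + D) * (1 + ‖z.1‖ ^ 2 + ‖z.2‖ ^ 2) := by
      calc _ ≤ ‖β s Z‖ * ‖V‖ := norm_inner_le_norm _ _
        _ ≤ C * (1 + ‖Z‖) * ‖V‖ := by gcongr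
        _ ≤ C * ((1 + ‖Z‖ ^ 2) + ‖V‖ ^ 2 / 2) := by
            rw [mul_assoc]
            gcongr
            nlinarith [sq_nonneg (1 + ‖Z‖ - ‖V‖), sq_nonneg (1 - ‖Z‖)]
        _ ≤ C * (K * (1 + ‖z.1‖ ^ 2 + ‖z.2‖ ^ 2) + D * (1 + ‖z.1‖ ^ 2 + ‖z.2‖ ^ 2)) := by
            gcongr
            linarith
        _ = _ := by ring
    have h5 : C * (1 + ‖Z‖ ^ 2) ≤ C * (K * (1 + ‖z.1‖ ^ 2 + ‖z.2‖ ^ 2)) := by gcongr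
    have h6 := norm_add_le (α s Z) ⟪β s Z, V⟫
    rw [Real.norm_eq_abs (α s Z)] at h6
    nlinarith
  · refine .of_forall fun z s hs => ?_
    have hs0 : 0 < s := by linarith [hs.1]
    have h1 := (hasDerivAt_id s).prodMk (hasDerivAt_emStep (b := b) hs0 z)
    -- The chain rule along the explicit path `s ↦ (s, emStep b s z)`, with initial point and noise
    -- held fixed. The time derivative is singular only at `s = 0`.
    have h2 := (hd s hs (emStep b s z)).comp_hasDerivAt s h1
    simp only [jointForm_apply, mul_one, id] at h2
    exact h2

end EMDescent
end

/-! ### Regularity of the log-likelihood; integration by parts and moments along a step. -/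

noncomputable section

namespace EMDescent

open scoped RealInnerProductSpace

variable {m d : ℕ} {ρ : Euc m → Euc d → ℝ} {Lθ Lx L : ℝ≥0}

/-! ### The log-likelihood -/

lemma LipschitzGradient.norm_gradTheta_sub_le (hg : LipschitzGradient ρ Lθ Lx) (hθ : Lθ ≤ L)
    (hx : Lx ≤ L) (θ θ' : Euc m) (x x' : Euc d) :
    ‖gradTheta ρ θ x - gradTheta ρ θ' x'‖ ≤ L * (‖θ - θ'‖ + ‖x - x'‖) := by
  have h := hg.lipschitz θ θ' x x'
  have h1 : ‖gradTheta ρ θ x - gradTheta ρ θ' x'‖ ≤ _ :=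
    (Real.le_sqrt (norm_nonneg _) (by positivity)).2
      (le_add_of_nonneg_right (sq_nonneg ‖gradX ρ θ x - gradX ρ θ' x'‖))
  refine (h1.trans h).trans ?_
  rw [mul_add]
  gcongr

lemma LipschitzGradient.norm_gradX_sub_le (hg : LipschitzGradient ρ Lθ Lx) (hθ : Lθ ≤ L)
    (hx : Lx ≤ L) (θ θ' : Euc m) (x x' : Euc d) :
    ‖gradX ρ θ x - gradX ρ θ' x'‖ ≤ L * (‖θ - θ'‖ + ‖x - x'‖) := by
  have h := hg.lipschitz θ θ' x x'
  have h1 : ‖gradX ρ θ x - gradX ρ θ' x'‖ ≤ _ :=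
    (Real.le_sqrt (norm_nonneg _) (by positivity)).2
      (le_add_of_nonneg_left (sq_nonneg ‖gradTheta ρ θ x - gradTheta ρ θ' x'‖))
  refine (h1.trans h).trans ?_
  rw [mul_add]
  gcongr

lemma LipschitzGradient.lipschitzWith_gradX (hg : LipschitzGradient ρ Lθ Lx) (hθ : Lθ ≤ L)
    (hx : Lx ≤ L) (θ : Euc m) : LipschitzWith L (gradX ρ θ) :=
  LipschitzWith.of_dist_le_mul fun x x' => by
    simpa [dist_eq_norm] using hg.norm_gradX_sub_le hθ hx θ θ x x'

lemma LipschitzGradient.lipschitzWith_gradTheta (hg : LipschitzGradient ρ Lθ Lx) (hθ : Lθ ≤ L)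
    (hx : Lx ≤ L) (θ : Euc m) : LipschitzWith L (gradTheta ρ θ) :=
  LipschitzWith.of_dist_le_mul fun x x' => by
    simpa [dist_eq_norm] using hg.norm_gradTheta_sub_le hθ hx θ θ x x'

lemma LipschitzGradient.hasFDerivAt (hg : LipschitzGradient ρ Lθ Lx) (θ : Euc m) (x : Euc d) :
    HasFDerivAt (fun z : Euc m × Euc d => logLik ρ z.1 z.2)
      ((innerSL ℝ (gradTheta ρ θ x)).comp (ContinuousLinearMap.fst ℝ (Euc m) (Euc d)) +
        (innerSL ℝ (gradX ρ θ x)).comp (ContinuousLinearMap.snd ℝ (Euc m) (Euc d))) (θ, x) := by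
  have hD := (hg.differentiable (θ, x)).hasFDerivAt
  set D := fderiv ℝ (fun z : Euc m × Euc d => logLik ρ z.1 z.2) (θ, x)
  have h1 : HasFDerivAt (fun θ' => logLik ρ θ' x) (D.comp (ContinuousLinearMap.inl ℝ _ _)) θ :=
    HasFDerivAt.comp (g := fun z : Euc m × Euc d => logLik ρ z.1 z.2)
      (f := fun θ' => (θ', x)) θ hD
      (hasFDerivAt_prodMk_left (𝕜 := ℝ) θ x)
  have h2 : HasFDerivAt (fun x' => logLik ρ θ x') (D.comp (ContinuousLinearMap.inr ℝ _ _)) x :=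
    HasFDerivAt.comp (g := fun z : Euc m × Euc d => logLik ρ z.1 z.2)
      (f := fun x' => (θ, x')) x hD
      (hasFDerivAt_prodMk_right (𝕜 := ℝ) θ x)
  have e1 : ∀ v, ⟪gradTheta ρ θ x, v⟫ = D (v, 0) := fun v => by
    rw [gradTheta, gradient, h1.fderiv, InnerProductSpace.toDual_symm_apply]; simp
  have e2 : ∀ v, ⟪gradX ρ θ x, v⟫ = D (0, v) := fun v => by
    rw [gradX, gradient, h2.fderiv, InnerProductSpace.toDual_symm_apply]; simp
  refine hD.congr_fderiv (ContinuousLinearMap.ext fun p => ?_)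
  simp only [add_apply, ContinuousLinearMap.comp_apply, ContinuousLinearMap.coe_fst',
    ContinuousLinearMap.coe_snd', innerSL_apply_apply ℝ, e1, e2]
  rw [← map_add]; simp

lemma LipschitzGradient.hasFDerivAt_path (hg : LipschitzGradient ρ Lθ Lx) (θ g : Euc m) (s : ℝ)
    (y : Euc d) :
    HasFDerivAt (fun p : ℝ × Euc d => logLik ρ (θ + p.1 • g) p.2)
      (jointForm ⟪gradTheta ρ (θ + s • g) y, g⟫ (gradX ρ (θ + s • g) y)) (s, y) := by
  have h1 : HasFDerivAt (fun p : ℝ × Euc d => (θ + p.1 • g, p.2))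
      (((ContinuousLinearMap.fst ℝ ℝ (Euc d)).smulRight g).prod
        (ContinuousLinearMap.snd ℝ ℝ (Euc d))) (s, y) :=
    ((hasFDerivAt_fst.smul_const g).const_add θ).prodMk hasFDerivAt_snd
  have h2 := (hg.hasFDerivAt (θ + s • g) y).comp (s, y) h1
  refine h2.congr_fderiv (ContinuousLinearMap.ext fun p => ?_)
  simp [jointForm_apply, innerSL_apply_apply ℝ, real_inner_smul_right, mul_comm]

lemma LipschitzGradient.hasFDerivAt_right (hg : LipschitzGradient ρ Lθ Lx) (θ : Euc m) (x : Euc d) :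
    HasFDerivAt (logLik ρ θ) (innerSL ℝ (gradX ρ θ x)) x := by
  refine ((hg.hasFDerivAt θ x).comp x (hasFDerivAt_prodMk_right θ x)).congr_fderiv
    (ContinuousLinearMap.ext fun p => ?_)
  simp

lemma LipschitzGradient.continuous_logLik (hg : LipschitzGradient ρ Lθ Lx) (θ : Euc m) :
    Continuous (logLik ρ θ) :=
  continuous_iff_continuousAt.2 fun x => (hg.hasFDerivAt_right θ x).continuousAt

lemma LipschitzGradient.norm_gradX_le (hg : LipschitzGradient ρ Lθ Lx) (hθ : Lθ ≤ L)
    (hx : Lx ≤ L) (θ θ₀ : Euc m) (y : Euc d) :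
    ‖gradX ρ θ y‖ ≤ ‖gradX ρ θ₀ 0‖ + L * (‖θ - θ₀‖ + ‖y‖) := by
  have h := hg.norm_gradX_sub_le hθ hx θ θ₀ y 0
  rw [sub_zero] at h
  have := norm_sub_norm_le (gradX ρ θ y) (gradX ρ θ₀ 0)
  linarith

lemma LipschitzGradient.norm_gradTheta_le (hg : LipschitzGradient ρ Lθ Lx) (hθ : Lθ ≤ L)
    (hx : Lx ≤ L) (θ θ₀ : Euc m) (y : Euc d) :
    ‖gradTheta ρ θ y‖ ≤ ‖gradTheta ρ θ₀ 0‖ + L * (‖θ - θ₀‖ + ‖y‖) := by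
  have h := hg.norm_gradTheta_sub_le hθ hx θ θ₀ y 0
  rw [sub_zero] at h
  have := norm_sub_norm_le (gradTheta ρ θ y) (gradTheta ρ θ₀ 0)
  linarith

/-- The gradient grows linearly, so the mean value inequality on the ball of radius `‖y‖` gives
quadratic growth. Finite second moments therefore suffice for all expectations of `ℓ`. -/
lemma LipschitzGradient.exists_logLik_bound (hg : LipschitzGradient ρ Lθ Lx) (θ : Euc m) :
    ∃ C, 0 ≤ C ∧ ∀ y, |logLik ρ θ y| ≤ C * (1 + ‖y‖ ^ 2) := by
  obtain ⟨L, hθ, hx⟩ : ∃ L, Lθ ≤ L ∧ Lx ≤ L := ⟨max Lθ Lx, le_max_left _ _, le_max_right _ _⟩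
  refine ⟨|logLik ρ θ 0| + ‖gradX ρ θ 0‖ + L, by positivity, fun y => ?_⟩
  have h1 : ∀ x ∈ Metric.closedBall (0 : Euc d) ‖y‖,
      ‖innerSL ℝ (gradX ρ θ x)‖ ≤ ‖gradX ρ θ 0‖ + L * ‖y‖ := by
    intro x hx'
    rw [innerSL_apply_norm]
    have := hg.norm_gradX_le hθ hx θ θ x
    rw [sub_self, norm_zero, zero_add] at this
    refine this.trans ?_
    gcongr
    simpa using hx'
  have h2 := (convex_closedBall (0 : Euc d) ‖y‖).norm_image_sub_le_of_norm_hasFDerivWithin_le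
    (fun x _ => (hg.hasFDerivAt_right θ x).hasFDerivWithinAt) h1
    (show (0 : Euc d) ∈ _ by simp) (show y ∈ _ by simp)
  rw [sub_zero, Real.norm_eq_abs] at h2
  have h3 := abs_sub_abs_le_abs_sub (logLik ρ θ y) (logLik ρ θ 0)
  have h4 : ‖y‖ ≤ 1 + ‖y‖ ^ 2 := by nlinarith [sq_nonneg (‖y‖ - 1), norm_nonneg y]
  have h5 := mul_le_mul_of_nonneg_left h4 (norm_nonneg (gradX ρ θ 0))
  nlinarith [mul_nonneg (abs_nonneg (logLik ρ θ 0)) (sq_nonneg ‖y‖), L.coe_nonneg]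

/-! ### Square integrable vector fields along the interpolation -/

lemma integrable_inner_of_memLp {X : Type*} [MeasurableSpace X] {μ : Measure X} {n : ℕ}
    {f g : X → Euc n} (hf : MemLp f 2 μ) (hg : MemLp g 2 μ) : Integrable (fun x => ⟪f x, g x⟫) μ := by
  have h1 := (memLp_two_iff_integrable_sq_norm hf.1).1 hf
  have h2 := (memLp_two_iff_integrable_sq_norm hg.1).1 hg
  refine (h1.add h2).mono' (hf.1.inner hg.1) (.of_forall fun x => ?_)
  have := norm_inner_le_norm (𝕜 := ℝ) (f x) (g x)
  simp only [Pi.add_apply]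
  nlinarith [sq_nonneg (‖f x‖ - ‖g x‖), sq_nonneg ‖f x‖, sq_nonneg ‖g x‖]

lemma integrable_normSq_of_memLp {X : Type*} [MeasurableSpace X] {μ : Measure X} {n : ℕ}
    {f : X → Euc n} (hf : MemLp f 2 μ) : Integrable (fun x => ‖f x‖ ^ 2) μ :=
  (memLp_two_iff_integrable_sq_norm hf.1).1 hf

variable {b : Euc d → Euc d} {q : Measure (Euc d)}

lemma memLp_comp_emStep [IsProbabilityMeasure q] (hq : Integrable (fun x => ‖x‖ ^ 2) q)
    (hb : LipschitzWith L b) {s : ℝ} (hs : 0 ≤ s) {n : ℕ} {f : Euc d → Euc n} (hf : Measurable f)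
    {C : ℝ} (hC : ∀ y, ‖f y‖ ≤ C * (1 + ‖y‖)) :
    MemLp (fun z => f (emStep b s z)) 2 (q.prod (stdGaussian (Euc d))) := by
  refine (memLp_two_iff_integrable_sq_norm
    (hf.comp (measurable_emStep hb.continuous.measurable s)).aestronglyMeasurable).2 ?_
  refine integrable_comp_emStep hq hb hs (f := fun y => ‖f y‖ ^ 2) (by fun_prop)
    (C := 2 * C ^ 2) fun y => ?_
  rw [Real.norm_of_nonneg (sq_nonneg _)]
  have := pow_le_pow_left₀ (norm_nonneg _) (hC y) 2
  nlinarith [mul_nonneg (sq_nonneg C) (sq_nonneg (1 - ‖y‖))]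

lemma memLp_comp_fst [IsProbabilityMeasure q] (hq : Integrable (fun x => ‖x‖ ^ 2) q) {n : ℕ}
    {f : Euc d → Euc n} (hf : Measurable f) {C : ℝ} (hC : ∀ y, ‖f y‖ ≤ C * (1 + ‖y‖)) :
    MemLp (fun z : Euc d × Euc d => f z.1) 2 (q.prod (stdGaussian (Euc d))) := by
  refine (memLp_two_iff_integrable_sq_norm (hf.comp measurable_fst).aestronglyMeasurable).2 ?_
  refine ((integrable_growth hq).const_mul (2 * C ^ 2)).mono'
    ((hf.comp measurable_fst).norm.pow_const 2).aestronglyMeasurable (.of_forall fun z => ?_)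
  rw [Real.norm_of_nonneg (sq_nonneg _)]
  have := pow_le_pow_left₀ (norm_nonneg _) (hC z.1) 2
  simp only [Function.comp_apply]
  nlinarith [mul_nonneg (sq_nonneg C) (sq_nonneg (1 - ‖z.1‖)), mul_nonneg (sq_nonneg C) (sq_nonneg ‖z.2‖)]

lemma memLp_snd [IsProbabilityMeasure q] :
    MemLp (fun z : Euc d × Euc d => z.2) 2 (q.prod (stdGaussian (Euc d))) :=
  (memLp_two_iff_integrable_sq_norm (by fun_prop)).2 (integrable_norm_sq_stdGaussian.comp_snd _)

lemma memLp_noise [IsProbabilityMeasure q] (c : ℝ) :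
    MemLp (fun z : Euc d × Euc d => -(c • z.2)) 2 (q.prod (stdGaussian (Euc d))) :=
  (memLp_snd.const_smul c).neg

lemma integrable_norm_sq_snd [IsProbabilityMeasure q] :
    Integrable (fun z : Euc d × Euc d => ‖z.2‖ ^ 2) (q.prod (stdGaussian (Euc d))) :=
  integrable_norm_sq_stdGaussian.comp_snd _

lemma integral_norm_sq_snd [IsProbabilityMeasure q] :
    ∫ z : Euc d × Euc d, ‖z.2‖ ^ 2 ∂(q.prod (stdGaussian (Euc d))) = d := by
  rw [integral_fun_snd (fun ξ : Euc d => ‖ξ‖ ^ 2), integral_norm_sq_stdGaussian]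
  simp

lemma norm_drift_growth (hb : LipschitzWith L b) (y : Euc d) :
    ‖b y‖ ≤ (‖b 0‖ + L) * (1 + ‖y‖) := by
  have := norm_le_of_lipschitz hb y
  nlinarith [mul_nonneg (norm_nonneg (b 0)) (norm_nonneg y), L.coe_nonneg]

lemma integral_inner_fst_snd [IsProbabilityMeasure q] {f : Euc d → Euc d}
    (hi : Integrable (fun z : Euc d × Euc d => ⟪f z.1, z.2⟫) (q.prod (stdGaussian (Euc d)))) :
    ∫ z, ⟪f z.1, z.2⟫ ∂(q.prod (stdGaussian (Euc d))) = 0 := by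
  rw [integral_prod _ hi]
  have : ∀ x, ∫ ξ, ⟪f x, ξ⟫ ∂stdGaussian (Euc d) = 0 := fun x => by
    rw [integral_inner integrable_id_stdGaussian]; simp
  simp [this]

lemma resid_emStep (s : ℝ) (z : Euc d × Euc d) : resid b s z.1 (emStep b s z) = √(2 * s) • z.2 := by
  unfold resid emStep; abel

/-- Gaussian integration by parts: the score is the conditional expectation of the noise. -/
lemma integral_inner_score [IsProbabilityMeasure q] (hb : LipschitzWith L b) {s : ℝ} (hs : 0 < s)
    {K : Euc d → Euc d} (hK : Measurable K)
    (hK2 : MemLp (fun z => K (emStep b s z)) 2 (q.prod (stdGaussian (Euc d)))) :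
    ∫ z, ⟪K (emStep b s z), score q b s (emStep b s z)⟫ ∂(q.prod (stdGaussian (Euc d))) =
      ∫ z, ⟪K (emStep b s z), -((√(2 * s))⁻¹ • z.2)⟫ ∂(q.prod (stdGaussian (Euc d))) := by
  have hbm := hb.continuous.measurable
  -- At the true endpoint the residual is `√(2s) ξ`, so the integrand of `score` becomes `-ξ /
  -- √(2s)`.
  have e : ∀ z : Euc d × Euc d, -(1 / (2 * s)) • resid b s z.1 (emStep b s z) =
      -((√(2 * s))⁻¹ • z.2) := fun z => by
    rw [resid_emStep, smul_smul, ← neg_smul]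
    congr 1
    have h1 : √(2 * s) * √(2 * s) = 2 * s := Real.mul_self_sqrt (by positivity)
    have h2 : √(2 * s) ≠ 0 := by positivity
    field_simp
    nlinarith
  have hN := memLp_noise (d := d) (q := q) (√(2 * s))⁻¹
  have h := integral_inner_backLaw (q := q) hbm hs (K := K)
    (a := fun x y => -(1 / (2 * s)) • resid b s x y) hK
    ((measurable_resid hbm s).fun_const_smul _)
    (fun y => by
      simp_rw [smul_comm _ (-(1 / (2 * s)))]
      exact (integrable_transKer_smul_resid (q := q) hbm hs y).smul (-(1 / (2 * s))))
    (by simp_rw [e]; exact integrable_inner_of_memLp hK2 hN)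
  simp_rw [e] at h
  exact h

/-- Conservation of mass: this value cancels the derivative `-d/(2s)` of `log heatConst`. By the
tower property the rate may be replaced by that of the kernel at `(X, Z)`, whose cross term has mean
zero. -/
lemma integral_rate [IsProbabilityMeasure q] (hq : Integrable (fun x => ‖x‖ ^ 2) q)
    (hb : LipschitzWith L b) {s : ℝ} (hs : 0 < s) :
    ∫ z, rate q b s (emStep b s z) ∂(q.prod (stdGaussian (Euc d))) = d / (2 * s) := by
  have hbm := hb.continuous.measurable
  have hB : MemLp (fun z : Euc d × Euc d => b z.1) 2 (q.prod (stdGaussian (Euc d))) :=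
    memLp_comp_fst hq hbm (norm_drift_growth hb)
  have hi := integrable_inner_of_memLp hB memLp_snd
  have hi2 := integrable_norm_sq_snd (d := d) (q := q)
  have e : ∀ z : Euc d × Euc d, logKerRate b s z.1 (emStep b s z) =
      (1 / (2 * s)) * ‖z.2‖ ^ 2 + (√(2 * s) / (2 * s)) * ⟪b z.1, z.2⟫ := fun z => by
    rw [logKerRate, resid_emStep, norm_smul, mul_pow, Real.norm_of_nonneg (Real.sqrt_nonneg _),
      Real.sq_sqrt (by positivity), real_inner_smul_left, real_inner_comm]
    field_simp
    ring
  have h := integral_inner_backLaw (q := q) hbm hs (F := ℝ) (K := fun _ => 1)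
    (a := fun x y => logKerRate b s x y) measurable_const (measurable_logKerRate hbm s)
    (fun y => integrable_transKer_mul_logKerRate hq hb hs y)
    (by
      simp only [RCLike.inner_apply, conj_trivial, mul_one, e]
      exact (hi2.const_mul _).fun_add (hi.const_mul _))
  simp only [RCLike.inner_apply, conj_trivial, mul_one, e] at h
  unfold rate
  refine h.trans ?_
  rw [integral_add (hi2.const_mul _) (hi.const_mul _), integral_const_mul, integral_const_mul,
    integral_inner_fst_snd hi, integral_norm_sq_snd]
  simp; ring

/-- `E⟪v(Z), ∇ log p(Z)⟫ ≤ L d` for an `L`-Lipschitz field `v`. -/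
lemma integral_inner_score_le [IsProbabilityMeasure q] (hq : Integrable (fun x => ‖x‖ ^ 2) q)
    (hb : LipschitzWith L b) {s : ℝ} (hs : 0 < s) {v : Euc d → Euc d} (hv : LipschitzWith L v) :
    ∫ z, ⟪v (emStep b s z), score q b s (emStep b s z)⟫ ∂(q.prod (stdGaussian (Euc d))) ≤ L * d := by
  have hbm := hb.continuous.measurable
  have hvm := hv.continuous.measurable
  have hvZ := memLp_comp_emStep hq hb hs.le hvm (norm_drift_growth hv)
  rw [integral_inner_score hb hs hvm hvZ]
  -- The noiseless endpoint `Y = X + s b(X)` is independent of `ξ`, so `v(Y)` may be subtracted from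
  -- `v(Z)` at no cost; the difference is at most `L √(2s) ‖ξ‖`, and `E‖ξ‖² = d`.
  have hY : MemLp (fun z : Euc d × Euc d => v (z.1 + s • b z.1)) 2
      (q.prod (stdGaussian (Euc d))) := by
    refine memLp_comp_fst hq (f := fun x => v (x + s • b x)) (by fun_prop)
      (C := (‖v 0‖ + L) * (1 + s * (‖b 0‖ + L))) fun x => ?_
    refine (norm_drift_growth hv _).trans ?_
    rw [mul_assoc]
    gcongr
    have h1 := norm_add_le x (s • b x)
    rw [norm_smul, Real.norm_of_nonneg hs.le] at h1
    have h2 := mul_le_mul_of_nonneg_left (norm_drift_growth hb x) hs.le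
    nlinarith
  have hiY := integrable_inner_of_memLp hY memLp_snd
  have hi2 := integrable_norm_sq_snd (d := d) (q := q)
  have hN := memLp_noise (d := d) (q := q) (√(2 * s))⁻¹
  have key : ∀ z : Euc d × Euc d, ⟪v (emStep b s z), -((√(2 * s))⁻¹ • z.2)⟫ ≤
      L * ‖z.2‖ ^ 2 + (-(√(2 * s))⁻¹) * ⟪v (z.1 + s • b z.1), z.2⟫ := by
    intro z
    have hp : 0 < √(2 * s) := by positivity
    have h1 := hv.norm_sub_le (emStep b s z) (z.1 + s • b z.1)
    have h2 : emStep b s z - (z.1 + s • b z.1) = √(2 * s) • z.2 := by unfold emStep; abel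
    rw [h2, norm_smul, Real.norm_of_nonneg hp.le] at h1
    have h3 : ⟪v (emStep b s z), -((√(2 * s))⁻¹ • z.2)⟫ =
        -(√(2 * s))⁻¹ * ⟪v (emStep b s z) - v (z.1 + s • b z.1), z.2⟫ +
        (-(√(2 * s))⁻¹) * ⟪v (z.1 + s • b z.1), z.2⟫ := by
      rw [inner_neg_right, real_inner_smul_right, inner_sub_left]; ring
    rw [h3]
    refine add_le_add ?_ le_rfl
    have h4 := abs_real_inner_le_norm (v (emStep b s z) - v (z.1 + s • b z.1)) z.2
    have h5 := (neg_abs_le _).trans' (neg_le_neg h4)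
    have h6 : (√(2 * s))⁻¹ * (‖v (emStep b s z) - v (z.1 + s • b z.1)‖ * ‖z.2‖) ≤
        (√(2 * s))⁻¹ * ((L * (√(2 * s) * ‖z.2‖)) * ‖z.2‖) := by gcongr
    have h7 : (√(2 * s))⁻¹ * ((L * (√(2 * s) * ‖z.2‖)) * ‖z.2‖) = L * ‖z.2‖ ^ 2 := by
      field_simp
    have h8 := mul_le_mul_of_nonneg_left h5 (inv_pos.2 hp).le
    linarith
  refine (integral_mono (integrable_inner_of_memLp hvZ hN)
    ((hi2.const_mul _).fun_add (hiY.const_mul _)) key).trans_eq ?_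
  rw [integral_add (hi2.const_mul _) (hiY.const_mul _), integral_const_mul, integral_const_mul,
    integral_inner_fst_snd (f := fun x => v (x + s • b x)) hiY, integral_norm_sq_snd]
  simp

/-- The mean squared displacement of a step. -/
lemma integral_norm_emStep_sub_sq [IsProbabilityMeasure q] (hq : Integrable (fun x => ‖x‖ ^ 2) q)
    (hb : LipschitzWith L b) {s : ℝ} (hs : 0 ≤ s) :
    ∫ z, ‖emStep b s z - z.1‖ ^ 2 ∂(q.prod (stdGaussian (Euc d))) =
      s ^ 2 * ∫ z, ‖b z.1‖ ^ 2 ∂(q.prod (stdGaussian (Euc d))) + 2 * s * d := by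
  have hB : MemLp (fun z : Euc d × Euc d => b z.1) 2 (q.prod (stdGaussian (Euc d))) :=
    memLp_comp_fst hq hb.continuous.measurable (norm_drift_growth hb)
  have hi := integrable_inner_of_memLp hB memLp_snd
  have hi2 := integrable_norm_sq_snd (d := d) (q := q)
  have hB2 := integrable_normSq_of_memLp hB
  have e : ∀ z : Euc d × Euc d, ‖emStep b s z - z.1‖ ^ 2 =
      s ^ 2 * ‖b z.1‖ ^ 2 + 2 * s * √(2 * s) * ⟪b z.1, z.2⟫ + 2 * s * ‖z.2‖ ^ 2 := fun z => by
    have : emStep b s z - z.1 = s • b z.1 + √(2 * s) • z.2 := by unfold emStep; abel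
    rw [this, norm_add_sq_real, norm_smul, norm_smul, mul_pow, mul_pow, Real.norm_of_nonneg hs,
      Real.norm_of_nonneg (Real.sqrt_nonneg _), Real.sq_sqrt (by positivity), real_inner_smul_left,
      real_inner_smul_right]
    ring
  simp_rw [e]
  rw [integral_add ((hB2.const_mul _).fun_add (hi.const_mul _)) (hi2.const_mul _),
    integral_add (hB2.const_mul _) (hi.const_mul _), integral_const_mul, integral_const_mul,
    integral_const_mul, integral_inner_fst_snd hi, integral_norm_sq_snd]
  simp

end EMDescent
end

/-! ### The descent inequality at positive times. -/

noncomputable section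

namespace EMDescent

open scoped RealInnerProductSpace

variable {m d : ℕ} {ρ : Euc m → Euc d → ℝ} {Lθ Lx L : ℝ≥0}
  {b : Euc d → Euc d} {q : Measure (Euc d)}

/-- The free energy along the interpolation, with parameter path `s ↦ θ + s g`. -/
def freeEnergyPath (ρ : Euc m → Euc d → ℝ) (q : Measure (Euc d)) (b : Euc d → Euc d)
    (θ g : Euc m) (s : ℝ) : ℝ :=
  Real.log (heatConst d s) + ∫ z, (Real.log (mass q b s (emStep b s z)) -
    logLik ρ (θ + s • g) (emStep b s z)) ∂(q.prod (stdGaussian (Euc d)))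

/-- The extended Fisher information at the endpoint of a step. -/
def fisherPath (ρ : Euc m → Euc d → ℝ) (q : Measure (Euc d)) (b : Euc d → Euc d)
    (θ : Euc m) (s : ℝ) : ℝ :=
  ‖∫ z, gradTheta ρ θ (emStep b s z) ∂(q.prod (stdGaussian (Euc d)))‖ ^ 2 +
    ∫ z, ‖gradX ρ θ (emStep b s z) - score q b s (emStep b s z)‖ ^ 2
      ∂(q.prod (stdGaussian (Euc d)))

lemma hasDerivAt_log_heatConst {t : ℝ} (ht : 0 < t) :
    HasDerivAt (fun s => Real.log (heatConst d s)) (-(d / (2 * t))) t := by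
  have h1 : HasDerivAt (fun s => -((d : ℝ) / 2) * Real.log (4 * Real.pi * s))
      (-((d : ℝ) / 2) * ((4 * Real.pi * 1) / (4 * Real.pi * t))) t :=
    (((hasDerivAt_id' t).const_mul (4 * Real.pi)).log (by positivity)).const_mul _
  refine (h1.congr_of_eventuallyEq ?_).congr_deriv (by field_simp)
  filter_upwards [lt_mem_nhds ht] with s hs
  have hs' : 0 < s := hs
  rw [heatConst, Real.log_inv, Real.log_rpow (by positivity), neg_mul]

lemma LipschitzGradient.exists_path_bound (hg : LipschitzGradient ρ Lθ Lx) (θ g : Euc m) {T : ℝ}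
    (hT : 0 ≤ T) : ∃ C, 0 ≤ C ∧ ∀ s ∈ Icc 0 T, ∀ y,
      |⟪gradTheta ρ (θ + s • g) y, g⟫| ≤ C * (1 + ‖y‖) ∧
      ‖gradX ρ (θ + s • g) y‖ ≤ C * (1 + ‖y‖) ∧ ‖gradTheta ρ (θ + s • g) y‖ ≤ C * (1 + ‖y‖) := by
  obtain ⟨L, hθ, hx⟩ : ∃ L, Lθ ≤ L ∧ Lx ≤ L := ⟨max Lθ Lx, le_max_left _ _, le_max_right _ _⟩
  set C1 := ‖gradTheta ρ θ 0‖ + L * (T * ‖g‖ + 1) with hC1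
  set C2 := ‖gradX ρ θ 0‖ + L * (T * ‖g‖ + 1) with hC2
  have hC1p : 0 ≤ C1 := by positivity
  have hC2p : 0 ≤ C2 := by positivity
  have key : ∀ s ∈ Icc 0 T, ‖θ + s • g - θ‖ ≤ T * ‖g‖ := fun s hs => by
    rw [add_sub_cancel_left, norm_smul, Real.norm_of_nonneg hs.1]
    gcongr; exact hs.2
  have b1 : ∀ s ∈ Icc 0 T, ∀ y, ‖gradTheta ρ (θ + s • g) y‖ ≤ C1 * (1 + ‖y‖) := fun s hs y => by
    refine (hg.norm_gradTheta_le hθ hx _ θ y).trans ?_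
    have h1 := key s hs
    have h2 : C1 * (1 + ‖y‖) = ‖gradTheta ρ θ 0‖ + L * (T * ‖g‖ + ‖y‖) +
      (‖gradTheta ρ θ 0‖ * ‖y‖ + L * (T * ‖g‖ * ‖y‖ + 1)) := by rw [hC1]; ring
    have h3 : 0 ≤ ‖gradTheta ρ θ 0‖ * ‖y‖ + L * (T * ‖g‖ * ‖y‖ + 1) := by positivity
    have h4 := mul_le_mul_of_nonneg_left (add_le_add_left h1 ‖y‖) L.coe_nonneg
    linarith
  have b2 : ∀ s ∈ Icc 0 T, ∀ y, ‖gradX ρ (θ + s • g) y‖ ≤ C2 * (1 + ‖y‖) := fun s hs y => by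
    refine (hg.norm_gradX_le hθ hx _ θ y).trans ?_
    have h1 := key s hs
    have h2 : C2 * (1 + ‖y‖) = ‖gradX ρ θ 0‖ + L * (T * ‖g‖ + ‖y‖) +
      (‖gradX ρ θ 0‖ * ‖y‖ + L * (T * ‖g‖ * ‖y‖ + 1)) := by rw [hC2]; ring
    have h3 : 0 ≤ ‖gradX ρ θ 0‖ * ‖y‖ + L * (T * ‖g‖ * ‖y‖ + 1) := by positivity
    have h4 := mul_le_mul_of_nonneg_left (add_le_add_left h1 ‖y‖) L.coe_nonneg
    linarith
  refine ⟨C1 * ‖g‖ + C2 + C1, by positivity, fun s hs y => ⟨?_, ?_, ?_⟩⟩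
  · refine (abs_real_inner_le_norm _ _).trans ?_
    calc _ ≤ C1 * (1 + ‖y‖) * ‖g‖ := by gcongr; exact b1 s hs y
      _ = (C1 * ‖g‖) * (1 + ‖y‖) := by ring
      _ ≤ _ := by gcongr; linarith
  · refine (b2 s hs y).trans ?_
    gcongr
    linarith [mul_nonneg hC1p (norm_nonneg g)]
  · refine (b1 s hs y).trans ?_
    gcongr
    linarith [mul_nonneg hC1p (norm_nonneg g)]

theorem hasDerivAt_freeEnergyPath [IsProbabilityMeasure q] (hq : Integrable (fun x => ‖x‖ ^ 2) q)
    (hb : LipschitzWith L b) (hg : LipschitzGradient ρ Lθ Lx) (hθ : Lθ ≤ L) (hx : Lx ≤ L)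
    (θ g : Euc m) {t : ℝ} (ht : 0 < t) (htL : t * L ≤ 1 / 4) :
    HasDerivAt (freeEnergyPath ρ q b θ g)
      (-(d / (2 * t)) + ∫ z, ((rate q b t (emStep b t z) -
          ⟪gradTheta ρ (θ + t • g) (emStep b t z), g⟫) +
        ⟪score q b t (emStep b t z) - gradX ρ (θ + t • g) (emStep b t z),
          b z.1 + (√(2 * t))⁻¹ • z.2⟫) ∂(q.prod (stdGaussian (Euc d)))) t := by
  have hbm := hb.continuous.measurable
  obtain ⟨C1, hC1, h1⟩ := exists_growth_bound hq hb ht htL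
  obtain ⟨C2, hC2, h2⟩ := hg.exists_path_bound θ g (T := 2 * t) (by linarith)
  obtain ⟨C3, hC3, h3⟩ := hg.exists_logLik_bound (θ + t • g)
  have htm : t ∈ Ioo (t / 2) (2 * t) := ⟨by linarith, by linarith⟩
  have hpos : ∀ s ∈ Ioo (t / 2) (2 * t), 0 < s := fun s hs => by linarith [hs.1]
  have hIcc : ∀ s ∈ Ioo (t / 2) (2 * t), s ∈ Icc 0 (2 * t) := fun s hs => ⟨(hpos s hs).le, hs.2.le⟩
  have hlin : ∀ y : Euc d, 1 + ‖y‖ ≤ 2 * (1 + ‖y‖ ^ 2) := fun y => by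
    nlinarith [sq_nonneg (‖y‖ - 1)]
  -- The normalising constant is split off, leaving the logarithm of the mass minus the
  -- log-likelihood, a function of at most quadratic growth.
  refine (hasDerivAt_log_heatConst ht).add (hasDerivAt_integral_emStep hq hb ht
    (Φ := fun s y => Real.log (mass q b s y) - logLik ρ (θ + s • g) y)
    (α := fun s y => rate q b s y - ⟪gradTheta ρ (θ + s • g) y, g⟫)
    (β := fun s y => score q b s y - gradX ρ (θ + s • g) y)
    (C := C1 + 2 * C2) (C' := C1 + C3) ?_ ?_ ?_ ?_ ?_ ?_ ?_)
  · intro s hs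
    exact (measurable_mass hbm s).log.sub (hg.continuous_logLik _).measurable
  · have := (hg.lipschitzWith_gradTheta hθ hx (θ + t • g)).continuous
    exact (measurable_rate hbm t).sub (by fun_prop)
  · exact (measurable_score hbm t).sub (hg.lipschitzWith_gradX hθ hx (θ + t • g)).continuous.measurable
  · intro y
    have e1 := (h1 t htm y).1
    have e2 := neg_log_mass_nonneg (q := q) hbm ht.le y
    have e3 := h3 y
    have e4 := abs_sub (Real.log (mass q b t y)) (logLik ρ (θ + t • g) y)
    rw [← abs_neg (Real.log _), abs_of_nonneg e2] at e4
    linarith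
  · intro s hs y
    have := (hasFDerivAt_log_mass hq hb (hpos s hs) y).sub (hg.hasFDerivAt_path θ g s y)
    refine this.congr_fderiv (ContinuousLinearMap.ext fun p => ?_)
    simp only [sub_apply, jointForm_apply, inner_sub_left]
    ring
  · intro s hs y
    have e1 := (h1 s hs y).2.2
    have e2 := (h2 s (hIcc s hs) y).1
    have e3 := mul_le_mul_of_nonneg_left (hlin y) hC2
    have e4 := abs_sub (rate q b s y) ⟪gradTheta ρ (θ + s • g) y, g⟫
    linarith
  · intro s hs y
    have e1 := (h1 s hs y).2.1
    have e2 := (h2 s (hIcc s hs) y).2.1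
    have e4 := norm_sub_le (score q b s y) (gradX ρ (θ + s • g) y)
    have e5 : 0 ≤ C2 * (1 + ‖y‖) := by positivity
    linarith

/-- Dictionary: `w = tL`, `D = Ld`, `A2 = ‖A‖²`, `G2 = ‖g‖²`, `Ag = ⟪A, g⟫`, `B = E‖b‖²`, and `a2`,
`c2`, `e2` are the mean squares of `v - S`, `b - S`, `v - b`. Spending `c2 ≥ w (B - 2D - e2)` and
using `w ≤ 1/4`, the coefficients of `G2` and `w B` come out negative, and that of `w D` is `45/16 +
1 = 61/16 ≤ 6`. -/
lemma descent_arith {w D A2 G2 Ag a2 c2 e2 B : ℝ} (hw : 0 ≤ w) (hw4 : w ≤ 1 / 4) (hD : 0 ≤ D)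
    (hB : 0 ≤ B) (hc : 0 ≤ c2) (he : 0 ≤ e2) (_hG : 0 ≤ G2) (hce : B - 2 * D - e2 ≤ c2)
    (he2 : e2 ≤ 5 / 16 * G2 + 5 / 4 * (w ^ 2 * B + 2 * (w * D)))
    (hA : A2 - 2 * Ag + G2 ≤ 5 / 16 * G2 + 5 / 4 * (w ^ 2 * B + 2 * (w * D))) :
    -Ag - (a2 + c2 - e2) / 2 ≤ -(1 / 2) * (A2 + a2) + 6 * (w * D) := by
  have h7 : w * (B - 2 * D - e2) ≤ c2 :=
    (mul_le_mul_of_nonneg_left hce hw).trans (mul_le_of_le_one_left hc (by linarith))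
  have h8 : w * (B - 2 * D - e2) = w * B - 2 * (w * D) - w * e2 := by ring
  rw [h8] at h7
  have h9 : w * e2 ≤ 1 / 4 * e2 := mul_le_mul_of_nonneg_right hw4 he
  have h10 : w ^ 2 * B ≤ 1 / 4 * (w * B) := by
    rw [pow_two, mul_assoc]
    exact mul_le_mul_of_nonneg_right hw4 (by positivity)
  have h11 : 0 ≤ w * B := by positivity
  have h12 : 0 ≤ w * D := by positivity
  linarith

set_option maxHeartbeats 600000 in
/-- The descent inequality for the real-valued free energy along the interpolation. -/
theorem exists_hasDerivAt_freeEnergyPath_le [IsProbabilityMeasure q]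
    (hq : Integrable (fun x => ‖x‖ ^ 2) q) (hg : LipschitzGradient ρ Lθ Lx) (hθ : Lθ ≤ L)
    (hx : Lx ≤ L) (θ θf g : Euc m) (hgd : g = ∫ x, gradTheta ρ θ x ∂q) {t : ℝ} (ht : 0 < t)
    (htL : t * L ≤ 1 / 4) (hθf : L * ‖θ + t • g - θf‖ ≤ 1 / 4 * ‖g‖) :
    ∃ D, HasDerivAt (freeEnergyPath ρ q (gradX ρ θf) θ g) D t ∧
      D ≤ -(1 / 2) * fisherPath ρ q (gradX ρ θf) (θ + t • g) t + 6 * L ^ 2 * d * t := by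
  have hb := hg.lipschitzWith_gradX hθ hx θf
  set b := gradX ρ θf with hbdef
  refine ⟨_, hasDerivAt_freeEnergyPath hq hb hg hθ hx θ g ht htL, ?_⟩
  have hbm := hb.continuous.measurable
  set ν := q.prod (stdGaussian (Euc d)) with hν
  set θt := θ + t • g with hθt
  have hvl := hg.lipschitzWith_gradX hθ hx θt
  have hvm := hvl.continuous.measurable
  have hTl := hg.lipschitzWith_gradTheta hθ hx θt
  have hT0 := hg.lipschitzWith_gradTheta hθ hx θ
  obtain ⟨C1, hC1, h1⟩ := exists_growth_bound hq hb ht htL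
  obtain ⟨C2, hC2, h2⟩ := hg.exists_path_bound θ g (T := 2 * t) (by linarith)
  have htm : t ∈ Ioo (t / 2) (2 * t) := ⟨by linarith, by linarith⟩
  have htI : t ∈ Icc 0 (2 * t) := ⟨by linarith, by linarith⟩
  have hS : MemLp (fun z => score q b t (emStep b t z)) 2 ν :=
    memLp_comp_emStep hq hb ht.le (measurable_score hbm t) fun y => (h1 t htm y).2.1
  have hv : MemLp (fun z => gradX ρ θt (emStep b t z)) 2 ν :=
    memLp_comp_emStep hq hb ht.le hvm fun y => (h2 t htI y).2.1
  have hT : MemLp (fun z => gradTheta ρ θt (emStep b t z)) 2 ν :=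
    memLp_comp_emStep hq hb ht.le hTl.continuous.measurable fun y => (h2 t htI y).2.2
  have hT0' : MemLp (fun z : Euc d × Euc d => gradTheta ρ θ z.1) 2 ν :=
    memLp_comp_fst hq hT0.continuous.measurable fun y => by
      simpa using (h2 0 ⟨le_rfl, by linarith⟩ y).2.2
  have hB : MemLp (fun z : Euc d × Euc d => b z.1) 2 ν :=
    memLp_comp_fst hq hbm (norm_drift_growth hb)
  have hN : MemLp (fun z : Euc d × Euc d => (√(2 * t))⁻¹ • z.2) 2 ν :=
    (memLp_snd (d := d) (q := q)).const_smul (√(2 * t))⁻¹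
  have hSv : MemLp (fun z => score q b t (emStep b t z) - gradX ρ θt (emStep b t z)) 2 ν := hS.sub hv
  have hTi := hT.integrable (by norm_num)
  have hT0i := hT0'.integrable (by norm_num)
  have hrate : Integrable (fun z => rate q b t (emStep b t z)) ν :=
    integrable_comp_emStep hq hb ht.le (measurable_rate hbm t) fun y => (h1 t htm y).2.2
  -- rewriting the derivative
  have hTg : ∫ z, ⟪gradTheta ρ θt (emStep b t z), g⟫ ∂ν =
      ⟪∫ z, gradTheta ρ θt (emStep b t z) ∂ν, g⟫ := by
    simp_rw [real_inner_comm g]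
    exact integral_inner hTi g
  -- The mean of the rate cancels `-d/(2t)`, and integration by parts converts the noise in the
  -- velocity into `-score`: effectively `Z` moves with velocity `b(X) - S(Z)`.
  have hD : -(d / (2 * t)) + ∫ z, ((rate q b t (emStep b t z) -
          ⟪gradTheta ρ θt (emStep b t z), g⟫) +
        ⟪score q b t (emStep b t z) - gradX ρ θt (emStep b t z),
          b z.1 + (√(2 * t))⁻¹ • z.2⟫) ∂ν =
      -⟪∫ z, gradTheta ρ θt (emStep b t z) ∂ν, g⟫ -
        ∫ z, ⟪gradX ρ θt (emStep b t z) - score q b t (emStep b t z),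
          b z.1 - score q b t (emStep b t z)⟫ ∂ν := by
    have i1 : Integrable (fun z => ⟪gradTheta ρ θt (emStep b t z), g⟫) ν := hTi.inner_const g
    rw [integral_add (by exact hrate.sub i1) (by exact integrable_inner_of_memLp hSv (hB.add hN)),
      integral_sub hrate i1, hTg, integral_rate hq hb ht]
    have e1 := integral_inner_score (q := q) hb ht
      (K := fun y => score q b t y - gradX ρ θt y) ((measurable_score hbm t).sub hvm) hSv
    have e2 : ∫ z, ⟪score q b t (emStep b t z) - gradX ρ θt (emStep b t z),
        b z.1 + (√(2 * t))⁻¹ • z.2⟫ ∂ν =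
        ∫ z, ⟪score q b t (emStep b t z) - gradX ρ θt (emStep b t z), b z.1⟫ ∂ν -
        ∫ z, ⟪score q b t (emStep b t z) - gradX ρ θt (emStep b t z),
          score q b t (emStep b t z)⟫ ∂ν := by
      rw [e1, ← integral_sub (integrable_inner_of_memLp hSv hB)
        (by exact integrable_inner_of_memLp hSv hN.neg)]
      congr 1; ext z
      rw [← inner_sub_right, sub_neg_eq_add]
    rw [e2, ← integral_sub (integrable_inner_of_memLp hSv hB) (integrable_inner_of_memLp hSv hS)]
    have e3 : ∀ z : Euc d × Euc d, ⟪score q b t (emStep b t z) - gradX ρ θt (emStep b t z), b z.1⟫ -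
        ⟪score q b t (emStep b t z) - gradX ρ θt (emStep b t z), score q b t (emStep b t z)⟫ =
        -⟪gradX ρ θt (emStep b t z) - score q b t (emStep b t z),
          b z.1 - score q b t (emStep b t z)⟫ := fun z => by
      rw [← inner_sub_right, ← inner_neg_left, neg_sub]
    simp_rw [e3]
    rw [integral_neg]
    ring
  rw [hD, fisherPath]
  -- abbreviations for the quadratic quantities
  set A := ∫ z, gradTheta ρ θt (emStep b t z) ∂ν with hA
  have hvS : MemLp (fun z => gradX ρ θt (emStep b t z) - score q b t (emStep b t z)) 2 ν := hv.sub hS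
  have hBS : MemLp (fun z => b z.1 - score q b t (emStep b t z)) 2 ν := hB.sub hS
  have hvB : MemLp (fun z => gradX ρ θt (emStep b t z) - b z.1) 2 ν := hv.sub hB
  set a2 := ∫ z, ‖gradX ρ θt (emStep b t z) - score q b t (emStep b t z)‖ ^ 2 ∂ν with ha2
  set c2 := ∫ z, ‖b z.1 - score q b t (emStep b t z)‖ ^ 2 ∂ν with hc2
  set e2 := ∫ z, ‖gradX ρ θt (emStep b t z) - b z.1‖ ^ 2 ∂ν with he2
  set Bq := ∫ z : Euc d × Euc d, ‖b z.1‖ ^ 2 ∂ν with hBq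
  set R := ∫ z, ‖emStep b t z - z.1‖ ^ 2 ∂ν with hR
  -- Polarisation around `(v - S) - (b - S) = v - b`: the Fisher term `a2` appears, `c2` is a gain,
  -- and `e2` is the discretisation error.
  have polar : ∫ z, ⟪gradX ρ θt (emStep b t z) - score q b t (emStep b t z),
          b z.1 - score q b t (emStep b t z)⟫ ∂ν = (a2 + c2 - e2) / 2 := by
    rw [ha2, hc2, he2, ← integral_add (integrable_normSq_of_memLp hvS)
      (integrable_normSq_of_memLp hBS), ← integral_sub ((integrable_normSq_of_memLp hvS).fun_add
      (integrable_normSq_of_memLp hBS)) (integrable_normSq_of_memLp hvB), ← integral_div]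
    congr 1; ext z
    have := norm_sub_sq_real (gradX ρ θt (emStep b t z) - score q b t (emStep b t z))
      (b z.1 - score q b t (emStep b t z))
    rw [sub_sub_sub_cancel_right] at this
    linarith
  have hc2nn : 0 ≤ c2 := integral_nonneg fun z => sq_nonneg _
  have hBqnn : 0 ≤ Bq := integral_nonneg fun z => sq_nonneg _
  -- Pointwise, `‖b - S‖² ≥ ‖b‖² - 2⟪v, S⟫ - ‖v - b‖²` follows from `0 ≤ ‖v - b + S‖²`. The product
  -- with `v` rather than `b(X)` is wanted, because `v` is a Lipschitz function of the endpoint.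
  have hc2ge : Bq - 2 * (L * d) - e2 ≤ c2 := by
    have hle := integral_inner_score_le hq hb ht hvl
    have hivS := integrable_inner_of_memLp hv hS
    have := integral_mono (((integrable_normSq_of_memLp hB).sub (hivS.const_mul 2)).sub
      (integrable_normSq_of_memLp hvB)) (integrable_normSq_of_memLp hBS) (fun z => by
        have h3 := norm_sub_sq_real (b z.1) (score q b t (emStep b t z))
        have h4 := norm_add_sq_real (gradX ρ θt (emStep b t z) - b z.1) (score q b t (emStep b t z))
        rw [inner_sub_left] at h4
        have h5 := sq_nonneg ‖gradX ρ θt (emStep b t z) - b z.1 + score q b t (emStep b t z)‖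
        show ‖b z.1‖ ^ 2 - 2 * ⟪gradX ρ θt (emStep b t z), score q b t (emStep b t z)⟫ -
          ‖gradX ρ θt (emStep b t z) - b z.1‖ ^ 2 ≤ ‖b z.1 - score q b t (emStep b t z)‖ ^ 2
        linarith)
    simp only [Pi.sub_apply] at this
    rw [integral_sub (by exact (integrable_normSq_of_memLp hB).sub (hivS.const_mul 2))
      (integrable_normSq_of_memLp hvB), integral_sub (integrable_normSq_of_memLp hB)
      (hivS.const_mul 2), integral_const_mul] at this
    linarith
  have hRi : Integrable (fun z => ‖emStep b t z - z.1‖ ^ 2) ν := by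
    refine integrable_normSq_of_memLp (MemLp.sub (f := emStep b t) (g := fun z => z.1) ?_ ?_)
    · exact memLp_comp_emStep hq hb ht.le (f := fun y => y) measurable_id (C := 1)
        fun y => by linarith [norm_nonneg y]
    · exact memLp_comp_fst hq (f := fun y => y) measurable_id (C := 1)
        fun y => by linarith [norm_nonneg y]
  have hReq : R = t ^ 2 * Bq + 2 * t * d := integral_norm_emStep_sub_sq hq hb ht.le
  -- Young's inequality with weights `5` and `5/4`: with `p ≤ ‖g‖/4` the parameter error costs `5/16
  -- ‖g‖²`, while the factor on the displacement stays close to one.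
  have young : ∀ {e p r : ℝ}, 0 ≤ e → e ≤ p + r → e ^ 2 ≤ 5 * p ^ 2 + 5 / 4 * r ^ 2 :=
    fun {e p r} he h => by
      have := pow_le_pow_left₀ he h 2
      nlinarith [sq_nonneg (2 * p - r / 2)]
  have hbound : ∀ c : ℝ, 0 ≤ c → c ≤ 1 / 4 * ‖g‖ → ∀ f : Euc d × Euc d → ℝ,
      (∀ z, 0 ≤ f z) → (∀ z, f z ≤ c + L * ‖emStep b t z - z.1‖) →
      Integrable (fun z => f z ^ 2) ν →
      ∫ z, f z ^ 2 ∂ν ≤ 5 / 16 * ‖g‖ ^ 2 + 5 / 4 * (L ^ 2 * R) := by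
    intro c hc0 hc f hf0 hf hfi
    have := integral_mono hfi ((integrable_const (5 * c ^ 2)).fun_add
      (hRi.const_mul (5 / 4 * (L : ℝ) ^ 2))) (fun z => by
        have := young (hf0 z) (hf z)
        show f z ^ 2 ≤ 5 * c ^ 2 + 5 / 4 * (L : ℝ) ^ 2 * ‖emStep b t z - z.1‖ ^ 2
        rw [mul_pow] at this
        linarith)
    rw [integral_add (integrable_const _) (hRi.const_mul _),
      integral_const_mul (5 / 4 * (L : ℝ) ^ 2), ← hR] at this
    simp only [integral_const, probReal_univ, one_smul] at this
    have h6 := pow_le_pow_left₀ hc0 hc 2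
    nlinarith
  have he2le : e2 ≤ 5 / 16 * ‖g‖ ^ 2 + 5 / 4 * (L ^ 2 * R) := by
    refine hbound (L * ‖θt - θf‖) (by positivity) hθf _ (fun z => norm_nonneg _) (fun z => ?_)
      (integrable_normSq_of_memLp hvB)
    rw [← mul_add]
    exact hg.norm_gradX_sub_le hθ hx _ _ _ _
  -- The vector `g` is the mean of `∇_θ ℓ(θ; X)` under the same coupling of `X` and `Z`, so the
  -- difference is again an expectation controlled by the parameter shift and the displacement.
  have hAg : ‖A - g‖ ^ 2 ≤ 5 / 16 * ‖g‖ ^ 2 + 5 / 4 * (L ^ 2 * R) := by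
    have e1 : A - g = ∫ z, (gradTheta ρ θt (emStep b t z) - gradTheta ρ θ z.1) ∂ν := by
      rw [integral_sub hTi hT0i, hgd, hν, integral_fun_fst (fun x => gradTheta ρ θ x), probReal_univ, one_smul]
    rw [e1]
    refine (norm_integral_sq_le (hTi.sub hT0i) (integrable_normSq_of_memLp (hT.sub hT0'))).trans ?_
    refine hbound (L * ‖θt - θ‖) (by positivity) ?_ _ (fun z => norm_nonneg _) (fun z => ?_)
      (integrable_normSq_of_memLp (hT.sub hT0'))
    · rw [hθt, add_sub_cancel_left, norm_smul, Real.norm_of_nonneg ht.le, ← mul_assoc, mul_comm (L : ℝ)]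
      gcongr
    · rw [← mul_add]
      exact hg.norm_gradTheta_sub_le hθ hx _ _ _ _
  have hpA := norm_sub_sq_real A g
  rw [polar]
  have hLR : (L : ℝ) ^ 2 * R = (t * L) ^ 2 * Bq + 2 * (t * L * (L * d)) := by rw [hReq]; ring
  have hLd : 6 * (L : ℝ) ^ 2 * d * t = 6 * (t * L * (L * d)) := by ring
  rw [hLR] at he2le hAg
  rw [hLd]
  exact descent_arith (by positivity) htL (by positivity) hBqnn hc2nn
    (integral_nonneg fun z => sq_nonneg _) (sq_nonneg _) hc2ge he2le (hpA ▸ hAg)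

end EMDescent
end

/-! ### From the explicit path quantities to `freeEnergy` and `extFisher` of the law of a step. -/

noncomputable section

namespace EMDescent

open scoped RealInnerProductSpace

variable {m d : ℕ} {ρ : Euc m → Euc d → ℝ} {Lθ Lx L : ℝ≥0}
  {b : Euc d → Euc d} {q : Measure (Euc d)} {f : Euc d → ℝ}

/-! ### Free energy of a measure with a density -/

lemma LipschitzGradient.continuous_density (hg : LipschitzGradient ρ Lθ Lx)
    (hpos : ∀ θ x, 0 < ρ θ x) (θ : Euc m) : Continuous (ρ θ) := by
  have : ρ θ = fun x => Real.exp (logLik ρ θ x) := by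
    ext x; rw [logLik, Real.exp_log (hpos θ x)]
  rw [this]
  exact Real.continuous_exp.comp (hg.continuous_logLik θ)

lemma ae_pos_of_density (hf : Measurable f)
    (hq : q = volume.withDensity (fun x => ENNReal.ofReal (f x))) : ∀ᵐ x ∂q, 0 < f x := by
  rw [hq, ae_withDensity_iff (by fun_prop)]
  refine .of_forall fun x hx => ?_
  simpa using hx

lemma eq_withDensity_modelMeasure (hg : LipschitzGradient ρ Lθ Lx) (hpos : ∀ θ x, 0 < ρ θ x)
    (θ : Euc m) (hf : Measurable f)
    (hq : q = volume.withDensity (fun x => ENNReal.ofReal (f x))) :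
    q = (modelMeasure ρ θ).withDensity (fun x => ENNReal.ofReal (f x / ρ θ x)) := by
  have hm := (hg.continuous_density hpos θ).measurable
  rw [modelMeasure, ← withDensity_mul _ (by fun_prop) (by fun_prop), hq]
  congr 1; ext x
  rw [Pi.mul_apply, ← ENNReal.ofReal_mul (hpos θ x).le, mul_div_cancel₀ _ (hpos θ x).ne']

lemma absolutelyContinuous_modelMeasure (hg : LipschitzGradient ρ Lθ Lx)
    (hpos : ∀ θ x, 0 < ρ θ x) (θ : Euc m) (hf : Measurable f)
    (hq : q = volume.withDensity (fun x => ENNReal.ofReal (f x))) : q ≪ modelMeasure ρ θ := by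
  rw [eq_withDensity_modelMeasure hg hpos θ hf hq]
  exact withDensity_absolutelyContinuous _ _

lemma llr_ae_eq (hg : LipschitzGradient ρ Lθ Lx) (hpos : ∀ θ x, 0 < ρ θ x) (θ : Euc m)
    (hf : Measurable f) (hq : q = volume.withDensity (fun x => ENNReal.ofReal (f x))) :
    llr q (modelMeasure ρ θ) =ᵐ[q] fun x => Real.log (f x) - logLik ρ θ x := by
  have hm := (hg.continuous_density hpos θ).measurable
  have hs : SigmaFinite (modelMeasure ρ θ) := SigmaFinite.withDensity_ofReal _
  have h1 : q.rnDeriv (modelMeasure ρ θ) =ᵐ[modelMeasure ρ θ]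
      fun x => ENNReal.ofReal (f x / ρ θ x) := by
    have := Measure.rnDeriv_withDensity (modelMeasure ρ θ)
      (f := fun x => ENNReal.ofReal (f x / ρ θ x)) (by fun_prop)
    rwa [← eq_withDensity_modelMeasure hg hpos θ hf hq] at this
  filter_upwards [(absolutelyContinuous_modelMeasure hg hpos θ hf hq).ae_le h1,
    ae_pos_of_density hf hq] with x hx hfx
  rw [llr, hx, ENNReal.toReal_ofReal (div_pos hfx (hpos θ x)).le,
    Real.log_div hfx.ne' (hpos θ x).ne', logLik]

lemma integrable_logLik [IsProbabilityMeasure q] (hg : LipschitzGradient ρ Lθ Lx)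
    (hq : Integrable (fun x => ‖x‖ ^ 2) q) (θ : Euc m) : Integrable (logLik ρ θ) q := by
  obtain ⟨C, hC, h⟩ := hg.exists_logLik_bound θ
  refine (((integrable_const 1).add hq).const_mul C).mono'
    (hg.continuous_logLik θ).aestronglyMeasurable (.of_forall fun x => h x)

lemma freeEnergy_eq_coe [IsProbabilityMeasure q] (hg : LipschitzGradient ρ Lθ Lx)
    (hpos : ∀ θ x, 0 < ρ θ x) (θ : Euc m) (hq2 : Integrable (fun x => ‖x‖ ^ 2) q)
    (hf : Measurable f) (hq : q = volume.withDensity (fun x => ENNReal.ofReal (f x)))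
    (hi : Integrable (fun x => Real.log (f x)) q) :
    freeEnergy ρ θ q = ((∫ x, (Real.log (f x) - logLik ρ θ x) ∂q : ℝ) : EReal) := by
  have h := llr_ae_eq hg hpos θ hf hq
  rw [freeEnergy, if_pos ⟨absolutelyContinuous_modelMeasure hg hpos θ hf hq,
    (integrable_congr h).2 (hi.sub (integrable_logLik hg hq2 θ))⟩, integral_congr_ae h]

/-- The log-likelihood is `q`-integrable, so `log f` and the log-likelihood ratio are integrable
together. This is the case of infinite initial free energy. -/
lemma freeEnergy_eq_top [IsProbabilityMeasure q] (hg : LipschitzGradient ρ Lθ Lx)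
    (hpos : ∀ θ x, 0 < ρ θ x) (θ : Euc m) (hq2 : Integrable (fun x => ‖x‖ ^ 2) q)
    (hf : Measurable f) (hq : q = volume.withDensity (fun x => ENNReal.ofReal (f x)))
    (hi : ¬ Integrable (fun x => Real.log (f x)) q) : freeEnergy ρ θ q = ⊤ := by
  rw [freeEnergy, if_neg]
  rintro ⟨-, h⟩
  refine hi ?_
  have := ((integrable_congr (llr_ae_eq hg hpos θ hf hq)).1 h).add (integrable_logLik hg hq2 θ)
  exact this.congr (.of_forall fun x => by simp)

/-! ### The law of a step -/

lemma IsP2.integrable_norm_sq (h : IsP2 q) : Integrable (fun x => ‖x‖ ^ 2) q := by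
  refine ⟨by fun_prop, ?_⟩
  rw [hasFiniteIntegral_iff_enorm]
  convert h.second_moment using 3 with x
  rw [enorm_pow, enorm_norm]

lemma measurable_stepDensity [SFinite q] (hb : Measurable b) (s : ℝ) :
    Measurable (stepDensity q b s) :=
  (measurable_mass hb s).const_mul _

lemma isProbabilityMeasure_map_emStep [IsProbabilityMeasure q] (hb : Measurable b) (s : ℝ) :
    IsProbabilityMeasure ((q.prod (stdGaussian (Euc d))).map (emStep b s)) :=
  Measure.isProbabilityMeasure_map (measurable_emStep hb s).aemeasurable

lemma integrable_norm_sq_map_emStep [IsProbabilityMeasure q]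
    (hq : Integrable (fun x => ‖x‖ ^ 2) q) (hb : LipschitzWith L b) {s : ℝ} (hs : 0 ≤ s) :
    Integrable (fun x => ‖x‖ ^ 2) ((q.prod (stdGaussian (Euc d))).map (emStep b s)) := by
  rw [integrable_map_measure (by fun_prop)
    (measurable_emStep hb.continuous.measurable s).aemeasurable]
  refine integrable_comp_emStep hq hb hs (f := fun y : Euc d => ‖y‖ ^ 2) (by fun_prop) (C := 1)
    fun y => ?_
  rw [Real.norm_of_nonneg (sq_nonneg _)]; linarith

lemma isP2_map_emStep [IsProbabilityMeasure q] (hq : Integrable (fun x => ‖x‖ ^ 2) q)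
    (hb : LipschitzWith L b) {s : ℝ} (hs : 0 < s) :
    IsP2 ((q.prod (stdGaussian (Euc d))).map (emStep b s)) where
  isProbabilityMeasure := isProbabilityMeasure_map_emStep hb.continuous.measurable s
  absolutelyContinuous := by
    rw [map_emStep hb.continuous.measurable hs]
    exact withDensity_absolutelyContinuous _ _
  second_moment := by
    have := (integrable_norm_sq_map_emStep hq hb hs.le).2
    rw [hasFiniteIntegral_iff_enorm] at this
    convert this using 3 with x
    rw [enorm_pow, enorm_norm]

lemma hasFDerivAt_log_stepDensity [IsProbabilityMeasure q] (hq : Integrable (fun x => ‖x‖ ^ 2) q)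
    (hb : LipschitzWith L b) {s : ℝ} (hs : 0 < s) (y : Euc d) :
    HasFDerivAt (fun y => Real.log (stepDensity q b s y)) (innerSL ℝ (score q b s y)) y := by
  have h1 := (hasFDerivAt_log_mass hq hb hs y).comp y (hasFDerivAt_prodMk_right (𝕜 := ℝ) s y)
  have h2 := h1.const_add (Real.log (heatConst d s))
  have e : (fun y => Real.log (stepDensity q b s y)) = fun y => Real.log (heatConst d s) +
      ((fun p : ℝ × Euc d => Real.log (mass q b p.1 p.2)) ∘ fun y => (s, y)) y := by
    ext y
    rw [stepDensity, Real.log_mul (heatConst_pos hs).ne'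
      (mass_pos hb.continuous.measurable hs.le y).ne']
    rfl
  rw [e]
  refine h2.congr_fderiv (ContinuousLinearMap.ext fun v => ?_)
  simp [jointForm_apply, innerSL_apply_apply ℝ]

lemma hasFDerivAt_stepDensity [IsProbabilityMeasure q] (hq : Integrable (fun x => ‖x‖ ^ 2) q)
    (hb : LipschitzWith L b) {s : ℝ} (hs : 0 < s) (y : Euc d) :
    HasFDerivAt (stepDensity q b s) (stepDensity q b s y • innerSL ℝ (score q b s y)) y := by
  have hp := stepDensity_pos (q := q) hb.continuous.measurable hs
  have := (hasFDerivAt_log_stepDensity hq hb hs y).exp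
  simpa only [Real.exp_log (hp _)] using this

lemma isDiffDensity_stepDensity [IsProbabilityMeasure q] (hq : Integrable (fun x => ‖x‖ ^ 2) q)
    (hb : LipschitzWith L b) {s : ℝ} (hs : 0 < s) :
    IsDiffDensity ((q.prod (stdGaussian (Euc d))).map (emStep b s)) (stepDensity q b s) where
  measurable := measurable_stepDensity hb.continuous.measurable s
  nonneg := fun y => (stepDensity_pos hb.continuous.measurable hs y).le
  eq_withDensity := map_emStep hb.continuous.measurable hs
  ae_differentiable := .of_forall fun y => (hasFDerivAt_stepDensity hq hb hs y).differentiableAt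

lemma integrable_log_mass_emStep [IsProbabilityMeasure q] (hq : Integrable (fun x => ‖x‖ ^ 2) q)
    (hb : LipschitzWith L b) {s : ℝ} (hs : 0 < s) (hsL : s * L ≤ 1 / 4) :
    Integrable (fun z => Real.log (mass q b s (emStep b s z)))
      (q.prod (stdGaussian (Euc d))) := by
  obtain ⟨C, hC, h⟩ := exists_growth_bound hq hb hs hsL
  refine integrable_comp_emStep hq hb hs.le (measurable_mass hb.continuous.measurable s).log
    (C := C) fun y => ?_
  have h1 := (h s ⟨by linarith, by linarith⟩ y).1
  rwa [Real.norm_eq_abs, ← abs_neg, abs_of_nonneg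
    (neg_log_mass_nonneg hb.continuous.measurable hs.le y)]

lemma log_stepDensity [IsProbabilityMeasure q] (hb : Measurable b) {s : ℝ} (hs : 0 < s)
    (y : Euc d) :
    Real.log (stepDensity q b s y) = Real.log (heatConst d s) + Real.log (mass q b s y) := by
  rw [stepDensity, Real.log_mul (heatConst_pos hs).ne' (mass_pos hb hs.le y).ne']

theorem freeEnergy_map_emStep [IsProbabilityMeasure q] (hq : Integrable (fun x => ‖x‖ ^ 2) q)
    (hg : LipschitzGradient ρ Lθ Lx) (hpos : ∀ θ x, 0 < ρ θ x) (hb : LipschitzWith L b)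
    (θ g : Euc m) {s : ℝ} (hs : 0 < s) (hsL : s * L ≤ 1 / 4) :
    freeEnergy ρ (θ + s • g) ((q.prod (stdGaussian (Euc d))).map (emStep b s)) =
      (freeEnergyPath ρ q b θ g s : EReal) := by
  have hbm := hb.continuous.measurable
  have := isProbabilityMeasure_map_emStep (q := q) hbm s
  have hZ := (measurable_emStep hbm s).aemeasurable (μ := q.prod (stdGaussian (Euc d)))
  have hlm := integrable_log_mass_emStep hq hb hs hsL
  have hlog : Measurable fun y => Real.log (stepDensity q b s y) :=
    (measurable_stepDensity hbm s).log
  have hi : Integrable (fun y => Real.log (stepDensity q b s y))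
      ((q.prod (stdGaussian (Euc d))).map (emStep b s)) := by
    rw [integrable_map_measure hlog.aestronglyMeasurable hZ]
    simp only [Function.comp_def, log_stepDensity hbm hs]
    exact (integrable_const _).add hlm
  have hq2 := integrable_norm_sq_map_emStep hq hb hs.le
  rw [freeEnergy_eq_coe hg hpos _ hq2 (measurable_stepDensity hbm s) (map_emStep hbm hs) hi]
  congr 1
  have hlik : Measurable (logLik ρ (θ + s • g)) := (hg.continuous_logLik _).measurable
  rw [integral_map hZ (by exact (hlog.sub hlik).aestronglyMeasurable), freeEnergyPath]
  simp only [log_stepDensity hbm hs, add_sub_assoc]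
  have h2 := (integrable_map_measure hlik.aestronglyMeasurable hZ).1
    (integrable_logLik hg hq2 (θ + s • g))
  rw [integral_add (integrable_const _) (by exact hlm.sub h2)]
  simp

/-! ### The extended Fisher information -/

/-- The coincidence set has full measure, hence is dense, and a derivative is determined by the
values on a dense set. -/
lemma gradient_eq_of_ae_eq {f₁ f₂ : Euc d → ℝ} (h : f₁ =ᵐ[volume] f₂) {x : Euc d}
    (h1 : DifferentiableAt ℝ f₁ x) (h2 : DifferentiableAt ℝ f₂ x) :
    f₁ x = f₂ x ∧ gradient f₁ x = gradient f₂ x := by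
  have hdense : Dense {y | f₁ y = f₂ y} := Measure.dense_of_ae h
  have hx : f₁ x = f₂ x := by
    by_contra hne
    have hev : ∀ᶠ y in 𝓝 x, f₁ y ≠ f₂ y :=
      (h1.continuousAt.ne_iff_eventually_ne h2.continuousAt).1 hne
    obtain ⟨y, hy, hy2⟩ := (hdense.inter_nhds_nonempty hev)
    exact hy2 hy
  refine ⟨hx, ?_⟩
  have hu : UniqueDiffWithinAt ℝ {y | f₁ y = f₂ y} x := by
    rw [← uniqueDiffWithinAt_closure, hdense.closure_eq]
    exact uniqueDiffWithinAt_univ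
  have h3 : HasFDerivWithinAt f₁ (fderiv ℝ f₂ x) {y | f₁ y = f₂ y} x :=
    h2.hasFDerivAt.hasFDerivWithinAt.congr (fun y hy => hy) hx
  rw [gradient, gradient, hu.eq h1.hasFDerivAt.hasFDerivWithinAt h3]

/-- Arbitrary a.e. differentiable densities are allowed in the final statement, whereas the
computations concern `stepDensity`; this permits the exchange. -/
lemma extFisher_congr (hg : LipschitzGradient ρ Lθ Lx) (hpos : ∀ θ x, 0 < ρ θ x) (θ : Euc m)
    {f₁ f₂ : Euc d → ℝ} (h1 : IsDiffDensity q f₁) (h2 : IsDiffDensity q f₂) :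
    extFisher ρ θ q f₁ = extFisher ρ θ q f₂ := by
  unfold extFisher
  congr 1
  refine lintegral_congr_ae ?_
  have hs : SigmaFinite (volume.withDensity fun x => ENNReal.ofReal (f₁ x)) :=
    SigmaFinite.withDensity_ofReal _
  have hff : f₁ =ᵐ[volume] f₂ := by
    have h3 : (fun x => ENNReal.ofReal (f₁ x)) =ᵐ[volume] fun x => ENNReal.ofReal (f₂ x) := by
      rw [← withDensity_eq_iff_of_sigmaFinite (h1.measurable.ennreal_ofReal).aemeasurable
        (h2.measurable.ennreal_ofReal).aemeasurable, ← h1.eq_withDensity, ← h2.eq_withDensity]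
    filter_upwards [h3] with x hx
    rwa [ENNReal.ofReal_eq_ofReal_iff (h1.nonneg x) (h2.nonneg x)] at hx
  have hac : q ≪ volume := by rw [h1.eq_withDensity]; exact withDensity_absolutelyContinuous _ _
  filter_upwards [ae_pos_of_density h1.measurable h1.eq_withDensity,
    hac.ae_le h1.ae_differentiable, hac.ae_le h2.ae_differentiable] with x hx hd1 hd2
  have hx2 : 0 < f₂ x := (gradient_eq_of_ae_eq hff hd1 hd2).1 ▸ hx
  have hr : DifferentiableAt ℝ (ρ θ) x := by
    have : ρ θ = fun x => Real.exp (logLik ρ θ x) := by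
      ext x; rw [logLik, Real.exp_log (hpos θ x)]
    rw [this]
    exact (hg.hasFDerivAt_right θ x).differentiableAt.exp
  have hr0 := (hpos θ x).ne'
  rw [(gradient_eq_of_ae_eq (f₁ := fun y => Real.log (f₁ y / ρ θ y))
    (f₂ := fun y => Real.log (f₂ y / ρ θ y)) ?_ ?_ ?_).2]
  · filter_upwards [hff] with y hy
    rw [hy]
  · exact (DifferentiableAt.log (f := fun y => f₁ y / ρ θ y) (by
      simp only [div_eq_mul_inv]; exact hd1.mul (hr.inv hr0)) (div_pos hx (hpos θ x)).ne')
  · exact (DifferentiableAt.log (f := fun y => f₂ y / ρ θ y) (by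
      simp only [div_eq_mul_inv]; exact hd2.mul (hr.inv hr0)) (div_pos hx2 (hpos θ x)).ne')

lemma gradient_log_div (hg : LipschitzGradient ρ Lθ Lx) (hpos : ∀ θ x, 0 < ρ θ x) (θ : Euc m)
    {x n : Euc d} (hfx : 0 < f x) (hd : HasFDerivAt f (innerSL ℝ n) x) :
    gradient (fun y => Real.log (f y / ρ θ y)) x = (f x)⁻¹ • n - gradX ρ θ x := by
  have h1 := (hd.log hfx.ne').sub (hg.hasFDerivAt_right θ x)
  have e : (fun y => Real.log (f y / ρ θ y)) =ᶠ[𝓝 x] fun y => Real.log (f y) - logLik ρ θ y := by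
    filter_upwards [hd.continuousAt.eventually (lt_mem_nhds hfx)] with y hy
    have hy' : 0 < f y := hy
    rw [Real.log_div hy'.ne' (hpos θ y).ne', logLik]
  have h2 : HasFDerivAt (fun y => Real.log (f y / ρ θ y))
      (innerSL ℝ ((f x)⁻¹ • n - gradX ρ θ x)) x := by
    refine (h1.congr_of_eventuallyEq e).congr_fderiv ?_
    rw [map_sub, map_smul]
  rw [gradient, h2.fderiv]
  refine ext_inner_right ℝ fun v => ?_
  rw [InnerProductSpace.toDual_symm_apply, innerSL_apply_apply ℝ]

lemma gradient_log_stepDensity_div [IsProbabilityMeasure q]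
    (hq : Integrable (fun x => ‖x‖ ^ 2) q) (hg : LipschitzGradient ρ Lθ Lx)
    (hpos : ∀ θ x, 0 < ρ θ x) (hb : LipschitzWith L b) (θ : Euc m) {s : ℝ} (hs : 0 < s) (y : Euc d) :
    gradient (fun y => Real.log (stepDensity q b s y / ρ θ y)) y =
      score q b s y - gradX ρ θ y := by
  have hp := stepDensity_pos (q := q) hb.continuous.measurable hs y
  rw [gradient_log_div hg hpos θ hp (n := stepDensity q b s y • score q b s y)
    ((hasFDerivAt_stepDensity hq hb hs y).congr_fderiv (by rw [map_smul])),
    smul_smul, inv_mul_cancel₀ hp.ne', one_smul]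

theorem extFisher_map_emStep [IsProbabilityMeasure q] (hq : Integrable (fun x => ‖x‖ ^ 2) q)
    (hg : LipschitzGradient ρ Lθ Lx) (hpos : ∀ θ x, 0 < ρ θ x) (hb : LipschitzWith L b)
    (hθ : Lθ ≤ L) (hx : Lx ≤ L)
    (θ : Euc m) {s : ℝ} (hs : 0 < s) (hsL : s * L ≤ 1 / 4)
    (hf : IsDiffDensity ((q.prod (stdGaussian (Euc d))).map (emStep b s)) f) :
    extFisher ρ θ ((q.prod (stdGaussian (Euc d))).map (emStep b s)) f =
      ENNReal.ofReal (fisherPath ρ q b θ s) := by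
  have hbm := hb.continuous.measurable
  have hZm := measurable_emStep hbm s
  have hZ := hZm.aemeasurable (μ := q.prod (stdGaussian (Euc d)))
  rw [extFisher_congr hg hpos θ hf (isDiffDensity_stepDensity hq hb hs), extFisher, fisherPath,
    ENNReal.ofReal_add (sq_nonneg _) (integral_nonneg fun z => sq_nonneg _)]
  have hvl := hg.lipschitzWith_gradX hθ hx θ
  congr 1
  · rw [integral_map hZ (hg.lipschitzWith_gradTheta hθ hx θ).continuous.aestronglyMeasurable,
      ← ofReal_norm, ENNReal.ofReal_pow (norm_nonneg _)]
  · have hsm := measurable_score (q := q) hbm s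
    have hvm := hvl.continuous.measurable
    simp_rw [gradient_log_stepDensity_div hq hg hpos hb θ hs]
    rw [lintegral_map (by fun_prop) hZm]
    obtain ⟨C1, hC1, h1⟩ := exists_growth_bound hq hb hs hsL
    have hi : Integrable (fun z => ‖gradX ρ θ (emStep b s z) - score q b s (emStep b s z)‖ ^ 2)
        (q.prod (stdGaussian (Euc d))) :=
      integrable_normSq_of_memLp ((memLp_comp_emStep hq hb hs.le hvm (norm_drift_growth hvl)).sub
        (memLp_comp_emStep hq hb hs.le hsm fun y => (h1 s ⟨by linarith, by linarith⟩ y).2.1))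
    rw [ofReal_integral_eq_lintegral_ofReal hi (.of_forall fun z => sq_nonneg _)]
    congr 1; ext z
    rw [← ofReal_norm, ENNReal.ofReal_pow (norm_nonneg _), norm_sub_rev]

end EMDescent
end

noncomputable section

namespace EMDescent

open scoped RealInnerProductSpace

variable {m d : ℕ} {ρ : Euc m → Euc d → ℝ} {Ω : Type*} [MeasurableSpace Ω] {P : Measure Ω}
  {W : ℝ≥0 → Ω → Euc d} {ϑ : ℝ → Euc m} {Z : ℝ → Ω → Euc d} {h : ℝ} {k : ℕ} {θk θf : Euc m}
  {qk : Measure (Euc d)}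

/-! ### The law of the interpolation -/

/-- The coordinates of the rescaled increment are independent standard real Gaussians, and the
product of their laws is `stdGaussian`. -/
lemma IsBrownian.hasLaw_increment (hW : IsBrownian W P) (r : ℝ≥0) {s : ℝ} (hs : 0 < s) :
    HasLaw (fun ω => (√s)⁻¹ • (W (r + s.toNNReal) ω - W r ω)) (stdGaussian (Euc d)) P := by
  have hcoord : ∀ i, HasLaw (fun ω => (√s)⁻¹ * (W (r + s.toNNReal) ω i - W r ω i))
      (gaussianReal 0 1) P := fun i => by
    have h1 := (hW.coord i).toIsPreBrownianReal.hasLaw_sub (r + s.toNNReal) r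
    have h2 := gaussianReal_const_mul h1 (√s)⁻¹
    have hv : (NNReal.mk ((√s)⁻¹ ^ 2) (sq_nonneg _) *
        nndist (r + s.toNNReal : ℝ≥0).1 r.1 : ℝ≥0) = 1 := by
      ext
      have e : |((r : ℝ) + s) - r| = s := by rw [add_sub_cancel_left, abs_of_pos hs]
      simp only [NNReal.coe_mul, NNReal.coe_mk, coe_nndist, NNReal.coe_one, NNReal.val_eq_coe,
        NNReal.coe_add, Real.coe_toNNReal _ hs.le, Real.dist_eq, e]
      rw [inv_pow, Real.sq_sqrt hs.le, inv_mul_cancel₀ hs.ne']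
    rw [hv, mul_zero] at h2
    exact h2
  have hind : iIndepFun (fun i ω => (√s)⁻¹ * (W (r + s.toNNReal) ω i - W r ω i)) P :=
    hW.indep.comp (fun _ w => (√s)⁻¹ * (w (r + s.toNNReal) - w r)) fun i => by fun_prop
  have hpi := hind.hasLaw_pi hcoord
  have h3 : HasLaw (WithLp.toLp 2 : (Fin d → ℝ) → Euc d) (stdGaussian (Euc d))
      (Measure.pi fun _ => gaussianReal 0 1) := ⟨by fun_prop, map_pi_eq_stdGaussian⟩
  refine (h3.comp hpi).congr (.of_forall fun ω => ?_)
  ext i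
  simp

/-- The frozen drift is constant in time, so the integral equation is one Euler–Maruyama step of
length `t - kh` driven by a single increment, which is independent of the initial point. Only
one-time marginals enter the free energy. -/
theorem IsInterpolation.map_eq [IsProbabilityMeasure P]
    (hint : IsInterpolation ρ h k θk qk θf P W ϑ Z) (hh : 0 < h) (hb : Measurable (gradX ρ θf))
    {t : ℝ} (ht : t ∈ Ioc (k * h) ((k + 1) * h)) :
    P.map (Z t) = (qk.prod (stdGaussian (Euc d))).map (emStep (gradX ρ θf) (t - k * h)) := by
  have hkh : 0 ≤ k * h := by positivity
  set s := t - k * h with hs_def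
  have hs : 0 < s := by rw [hs_def]; linarith [ht.1]
  set r := (k * h).toNNReal with hr
  have hrs : t.toNNReal = r + s.toNNReal := by
    rw [hr, ← Real.toNNReal_add hkh hs.le, hs_def]; congr 1; ring
  have hN := hint.brownian.hasLaw_increment r hs
  have hind : IndepFun (Z (k * h)) (fun ω => (√s)⁻¹ • (W (r + s.toNNReal) ω - W r ω)) P :=
    hint.indep.comp (φ := id) (ψ := fun w : ℝ≥0 → Euc d => (√s)⁻¹ • w s.toNNReal) measurable_id (by fun_prop)
  have hZ0 := hint.init_law
  have hpair := (indepFun_iff_map_prod_eq_prod_map_map hZ0.aemeasurable hN.aemeasurable).1 hind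
  rw [hZ0.map_eq, hN.map_eq] at hpair
  rw [← hpair, AEMeasurable.map_map_of_aemeasurable (measurable_emStep hb s).aemeasurable
    (hZ0.aemeasurable.prodMk hN.aemeasurable)]
  refine Measure.map_congr ?_
  filter_upwards [hint.sde] with ω hω
  rw [hω t ⟨ht.1.le, ht.2⟩, intervalIntegral.integral_const, hrs]
  simp only [Function.comp_apply, emStep]
  congr 1
  rw [smul_smul]
  congr 1
  rw [Real.sqrt_mul (by norm_num), mul_assoc, mul_inv_cancel₀ (Real.sqrt_pos.2 hs).ne', mul_one]

/-- The right-hand side of the parameter equation is constant, so `ϑ` minus the affine candidate has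
zero derivative. -/
theorem IsInterpolation.theta_eq (hint : IsInterpolation ρ h k θk qk θf P W ϑ Z)
    {t : ℝ} (ht : t ∈ Icc (k * h) ((k + 1) * h)) :
    ϑ t = θk + (t - k * h) • ∫ x, gradTheta ρ θk x ∂qk := by
  have hode := hint.theta_ode
  rw [hint.theta_init, hint.init_law.map_eq] at hode
  set g := ∫ x, gradTheta ρ θk x ∂qk
  have hd : ∀ x ∈ Icc (k * h) ((k + 1) * h),
      HasDerivWithinAt (fun t => ϑ t - (t - k * h) • g) 0 (Icc (k * h) ((k + 1) * h)) x := by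
    intro x hx
    have h1 := ((hasDerivAt_id' x).sub_const (k * h)).smul_const g
    have := (hode x hx).sub h1.hasDerivWithinAt
    rwa [one_smul, sub_self] at this
  have h2 := constant_of_has_deriv_right_zero (fun x hx => (hd x hx).continuousWithinAt)
    (fun x hx => (hd x ⟨hx.1, hx.2.le⟩).mono_of_mem_nhdsWithin
      (mem_of_superset (Icc_mem_nhdsGE hx.2) (Icc_subset_Icc_left hx.1))) t ht
  simp only [sub_self, zero_smul, sub_zero, hint.theta_init] at h2
  rw [← h2]; abel

end EMDescent
end

noncomputable section

namespace EMDescent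

open scoped RealInnerProductSpace

variable {d : ℕ} {L : ℝ≥0} {b : Euc d → Euc d} {q : Measure (Euc d)} {f : Euc d → ℝ}

/-! ### Convergence of the density and of its gradient as the step length tends to zero -/

/-- The prefactors blow up only like powers of `1/s`, which `exp(-c/s)` beats. The last factor
matches the bound on the kernel and its gradient away from `y`. -/
lemma tendsto_heatConst_mul_exp {c : ℝ} (hc : 0 < c) :
    Tendsto (fun s => heatConst d s * Real.exp (-c / s) * (1 + (1 + 8 * s) / (2 * s)))
      (𝓝[>] 0) (𝓝 0) := by
  have h1 : ∀ r : ℝ, Tendsto (fun s : ℝ => s⁻¹ ^ r * Real.exp (-c * s⁻¹)) (𝓝[>] 0) (𝓝 0) :=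
    fun r => (tendsto_rpow_mul_exp_neg_mul_atTop_nhds_zero r c hc).comp tendsto_inv_nhdsGT_zero
  have h2 := (((h1 (d / 2)).const_mul 5).add ((h1 (d / 2 + 1)).const_mul (1 / 2))).const_mul
    (((4 * Real.pi) ^ ((d : ℝ) / 2))⁻¹)
  simp only [mul_zero, add_zero] at h2
  refine h2.congr' ?_
  filter_upwards [self_mem_nhdsWithin] with s hs
  have hs' : 0 < s := hs
  rw [heatConst, Real.mul_rpow (by positivity) hs'.le, mul_inv, Real.rpow_add (by positivity),
    Real.inv_rpow hs'.le, Real.rpow_one, neg_div, div_eq_mul_inv c s, neg_mul]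
  field_simp
  ring

/-- The change of weight between the kernels with and without drift. -/
def driftWeight (b : Euc d → Euc d) (s : ℝ) (y x : Euc d) : ℝ :=
  Real.exp (⟪y - x, b x⟫ / 2 - s * ‖b x‖ ^ 2 / 4)

/-- Expanding `‖y - x - s b(x)‖²` separates a pure heat kernel, so that the integral over `x`
becomes a Gaussian average around `y`. -/
lemma transKer_eq_driftWeight {s : ℝ} (hs : 0 < s) (x y : Euc d) :
    transKer b s x y = Real.exp (-‖x - y‖ ^ 2 / (4 * s)) * driftWeight b s y x := by
  rw [transKer, driftWeight, ← Real.exp_add, resid, norm_sub_sq_real, norm_smul,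
    real_inner_smul_right, norm_sub_rev, Real.norm_of_nonneg hs.le]
  congr 1
  field_simp
  ring

lemma integral_stdGaussian_affine {F : Type*} [NormedAddCommGroup F] [NormedSpace ℝ F]
    [MeasurableSpace F] [BorelSpace F] [SecondCountableTopology F]
    {s : ℝ} (hs : 0 < s) (y : Euc d) {G : Euc d → F} (hG : Measurable G) :
    ∫ ξ, G (y + √(2 * s) • ξ) ∂stdGaussian (Euc d) =
      ∫ x, (heatConst d s * Real.exp (-‖x - y‖ ^ 2 / (4 * s))) • G x := by
  have h := integral_map (μ := stdGaussian (Euc d)) (φ := fun ξ => y + √(2 * s) • ξ)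
    (by fun_prop) hG.aestronglyMeasurable
  rw [← h, stdGaussian_map_affine hs, integral_withDensity_eq_integral_toReal_smul (by fun_prop)
    (by simp)]
  congr 1; ext x
  rw [ENNReal.toReal_ofReal (mul_nonneg (heatConst_pos hs).le (Real.exp_pos _).le)]

lemma setIntegral_transKer_eq {F : Type*} [NormedAddCommGroup F] [NormedSpace ℝ F]
    [MeasurableSpace F] [BorelSpace F] [SecondCountableTopology F] (hb : Measurable b)
    (hf : Measurable f) (hf0 : ∀ x, 0 ≤ f x)
    (hq : q = volume.withDensity (fun x => ENNReal.ofReal (f x)))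
    {s : ℝ} (hs : 0 < s) (y : Euc d) {N : Set (Euc d)} (hN : MeasurableSet N) {V : Euc d → F}
    (hV : Measurable V) :
    heatConst d s • ∫ x in N, transKer b s x y • V x ∂q =
      ∫ ξ, N.indicator (fun x => (f x * driftWeight b s y x) • V x) (y + √(2 * s) • ξ)
        ∂stdGaussian (Euc d) := by
  have hw : Measurable (driftWeight b s y) := by unfold driftWeight; fun_prop
  rw [integral_stdGaussian_affine hs y (G := N.indicator (fun x => (f x * driftWeight b s y x) • V x))
      (by exact ((hf.mul hw).smul hV).indicator hN),
    ← integral_indicator hN, hq, integral_withDensity_eq_integral_toReal_smul (by fun_prop)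
    (by simp), ← integral_smul]
  congr 1; ext x
  rw [ENNReal.toReal_ofReal (hf0 x)]
  by_cases hx : x ∈ N
  · simp only [indicator_of_mem hx, smul_smul, transKer_eq_driftWeight hs x y]
    congr 1
    ring
  · simp [indicator_of_notMem hx]

lemma norm_resid_ge (hb : LipschitzWith L b) {s : ℝ} (hs : 0 ≤ s) (hsL : s * L ≤ 1 / 2)
    (x y : Euc d) : ‖x - y‖ / 2 - s * ‖b y‖ ≤ ‖resid b s x y‖ := by
  have h1 : ‖x - y‖ ≤ ‖resid b s x y‖ + s * ‖b x‖ := by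
    have e : y - x = resid b s x y + s • b x := by unfold resid; abel
    rw [norm_sub_rev, e]
    refine (norm_add_le _ _).trans ?_
    rw [norm_smul, Real.norm_of_nonneg hs]
  have h2 : ‖b x‖ ≤ ‖b y‖ + L * ‖x - y‖ := by
    have := hb.norm_sub_le x y
    have := norm_sub_norm_le (b x) (b y)
    linarith
  nlinarith [mul_le_mul_of_nonneg_left h2 hs, mul_le_mul_of_nonneg_right hsL (norm_nonneg (x - y))]

/-- The Gaussian is split into two equal factors `exp(-R²/(8s))`: one supplies the exponential
smallness, the other absorbs the factor `R`. -/
lemma transKer_far_le {s c : ℝ} (hs : 0 < s) {x y : Euc d} (hc : 8 * c ≤ ‖resid b s x y‖ ^ 2) :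
    transKer b s x y * (1 + 1 / (2 * s) * ‖resid b s x y‖) ≤
      Real.exp (-c / s) * (1 + (1 + 8 * s) / (2 * s)) := by
  set R := ‖resid b s x y‖
  have e1 : transKer b s x y = Real.exp (-R ^ 2 / (8 * s)) * Real.exp (-R ^ 2 / (8 * s)) := by
    rw [← Real.exp_add, transKer]; congr 1; field_simp; ring
  have h1 : Real.exp (-R ^ 2 / (8 * s)) ≤ Real.exp (-c / s) := by
    rw [Real.exp_le_exp, div_le_div_iff₀ (by positivity) hs]
    nlinarith
  have h2 : Real.exp (-R ^ 2 / (8 * s)) ≤ 1 := by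
    rw [Real.exp_le_one_iff, neg_div, neg_nonpos]; positivity
  have h3 : Real.exp (-R ^ 2 / (8 * s)) * R ^ 2 ≤ 8 * s := by
    have h := Real.add_one_le_exp (R ^ 2 / (8 * s))
    have h2 : R ^ 2 = (8 * s) * (R ^ 2 / (8 * s)) := by field_simp
    rw [neg_div, Real.exp_neg, inv_mul_le_iff₀ (Real.exp_pos _)]
    calc _ = (8 * s) * (R ^ 2 / (8 * s)) := h2
      _ ≤ (8 * s) * Real.exp (R ^ 2 / (8 * s)) := by gcongr; linarith
      _ = _ := mul_comm _ _
  have h0 := Real.exp_pos (-R ^ 2 / (8 * s))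
  have h4 : Real.exp (-R ^ 2 / (8 * s)) * R ≤ 1 + 8 * s := by
    nlinarith [mul_nonneg h0.le (sq_nonneg (R - 1)), mul_nonneg h0.le (norm_nonneg (resid b s x y))]
  rw [e1, mul_assoc]
  gcongr
  calc Real.exp (-R ^ 2 / (8 * s)) * (1 + 1 / (2 * s) * R) =
      Real.exp (-R ^ 2 / (8 * s)) + 1 / (2 * s) * (Real.exp (-R ^ 2 / (8 * s)) * R) := by ring
    _ ≤ 1 + 1 / (2 * s) * (1 + 8 * s) := by gcongr
    _ = _ := by ring

/-- The contribution of the points far from `y` vanishes in the limit. -/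
lemma tendsto_far [IsProbabilityMeasure q] {F : Type*} [NormedAddCommGroup F] [NormedSpace ℝ F]
    (hb : LipschitzWith L b) (y : Euc d) {δ : ℝ} (hδ : 0 < δ) {V : ℝ → Euc d → F}
    (hV : ∀ s x, 0 < s → ‖V s x‖ ≤ 1 + 1 / (2 * s) * ‖resid b s x y‖) :
    Tendsto (fun s => heatConst d s • ∫ x in (Metric.ball y δ)ᶜ, transKer b s x y • V s x ∂q)
      (𝓝[>] 0) (𝓝 0) := by
  have hlim := tendsto_heatConst_mul_exp (d := d) (c := δ ^ 2 / 128) (by positivity)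
  refine squeeze_zero_norm' ?_ hlim
  have e1 : ∀ᶠ s : ℝ in 𝓝[>] 0, s * L < 1 / 2 := by
    have : Tendsto (fun s : ℝ => s * L) (𝓝[>] 0) (𝓝 (0 * L)) :=
      (tendsto_id.mul_const _).mono_left nhdsWithin_le_nhds
    rw [zero_mul] at this
    exact this.eventually (gt_mem_nhds (by norm_num))
  have e2 : ∀ᶠ s : ℝ in 𝓝[>] 0, s * ‖b y‖ < δ / 4 := by
    have : Tendsto (fun s : ℝ => s * ‖b y‖) (𝓝[>] 0) (𝓝 (0 * ‖b y‖)) :=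
      (tendsto_id.mul_const _).mono_left nhdsWithin_le_nhds
    rw [zero_mul] at this
    exact this.eventually (gt_mem_nhds (by positivity))
  filter_upwards [e1, e2, self_mem_nhdsWithin] with s h1 h2 hs
  have hs' : 0 < s := hs
  have hk := heatConst_pos (d := d) hs'
  rw [norm_smul, Real.norm_of_nonneg hk.le, mul_assoc]
  gcongr
  have hpt : ∀ x ∈ (Metric.ball y δ)ᶜ, ‖transKer b s x y • V s x‖ ≤
      Real.exp (-(δ ^ 2 / 128) / s) * (1 + (1 + 8 * s) / (2 * s)) := by
    intro x hx
    have hx' : δ ≤ ‖x - y‖ := by simpa [dist_eq_norm] using hx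
    -- For small `s` the drift moves a point outside the ball too little to reach `y`; `R ≥ δ/4`
    -- gives `R² ≥ 8 · δ²/128`, which explains the choice of `c`.
    have hR : δ / 4 ≤ ‖resid b s x y‖ := by
      have := norm_resid_ge hb hs'.le h1.le x y
      linarith
    have hR2 := pow_le_pow_left₀ (by positivity) hR 2
    rw [norm_smul, Real.norm_of_nonneg (transKer_pos s x y).le]
    refine (mul_le_mul_of_nonneg_left (hV s x hs') (transKer_pos s x y).le).trans
      (transKer_far_le hs' ?_)
    nlinarith
  refine (norm_setIntegral_le_of_norm_le_const (measure_lt_top _ _) hpt).trans ?_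
  exact mul_le_of_le_one_right (by positivity) measureReal_le_one

lemma integral_symm_stdGaussian {N : Set (Euc d)} (hN : MeasurableSet N) (hsymm : ∀ x, -x ∈ N ↔ x ∈ N) :
    ∫ ξ, N.indicator (fun ξ => ξ) ξ ∂stdGaussian (Euc d) = 0 := by
  have h := integral_map (μ := stdGaussian (Euc d)) (φ := fun ξ : Euc d => -ξ)
    measurable_neg.aemeasurable (f := N.indicator (fun ξ => ξ))
    (measurable_id.indicator hN).aestronglyMeasurable
  have e : (stdGaussian (Euc d)).map (fun ξ => -ξ) = stdGaussian (Euc d) :=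
    stdGaussian_map (LinearIsometryEquiv.neg ℝ (E := Euc d))
  rw [e] at h
  have e2 : ∀ ξ : Euc d, N.indicator (fun ξ => ξ) (-ξ) = -N.indicator (fun ξ => ξ) ξ := fun ξ => by
    by_cases hx : ξ ∈ N
    · rw [indicator_of_mem hx, indicator_of_mem ((hsymm ξ).2 hx)]
    · rw [indicator_of_notMem hx, indicator_of_notMem (mt (hsymm ξ).1 hx), neg_zero]
  simp_rw [e2] at h
  rw [integral_neg] at h
  have h2 : (2 : ℝ) • ∫ ξ, N.indicator (fun ξ => ξ) ξ ∂stdGaussian (Euc d) = 0 := by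
    rw [two_smul]; nth_rewrite 1 [h]; simp
  exact (smul_eq_zero.1 h2).resolve_left two_ne_zero

lemma abs_exp_sub_one_le_mul (a : ℝ) : |Real.exp a - 1| ≤ |a| * Real.exp |a| := by
  rw [abs_le]
  have h1 := Real.add_one_le_exp a
  have h2 := Real.add_one_le_exp (-a)
  have h3 := Real.one_le_exp (abs_nonneg a)
  have h4 := abs_nonneg a
  constructor
  · nlinarith [neg_abs_le a]
  · have h5 : Real.exp a - 1 ≤ a * Real.exp a := by
      have : Real.exp (-a) * Real.exp a = 1 := by rw [← Real.exp_add]; simp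
      nlinarith [Real.exp_pos a]
    refine h5.trans ?_
    have h6 := le_abs_self a
    calc a * Real.exp a ≤ |a| * Real.exp a := by gcongr
      _ ≤ _ := by gcongr

/-- Bounds near a point of differentiability. -/
lemma exists_near_bound (hb : LipschitzWith L b) {y n : Euc d} (hf0 : 0 ≤ f y)
    (hd : HasFDerivAt f (innerSL ℝ n) y) :
    ∃ δ > 0, ∃ C, 0 ≤ C ∧ ∀ σ ∈ Ioc (0 : ℝ) 1, ∀ ξ : Euc d, y + σ • ξ ∈ Metric.ball y δ →
      |f (y + σ • ξ) * driftWeight b (σ ^ 2 / 2) y (y + σ • ξ) - f y| ≤ C * (σ * (1 + ‖ξ‖)) ∧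
      |f (y + σ • ξ) * driftWeight b (σ ^ 2 / 2) y (y + σ • ξ)| ≤ C ∧ ‖b (y + σ • ξ)‖ ≤ C := by
  have h1 : ∀ᶠ x in 𝓝 y, |f x - f y| ≤ (‖n‖ + 1) * ‖x - y‖ := by
    have := hd.isLittleO.def (c := 1) one_pos
    filter_upwards [this] with x hx
    have h2 : ‖innerSL ℝ n (x - y)‖ ≤ ‖n‖ * ‖x - y‖ := by
      rw [innerSL_apply_apply ℝ]; exact norm_inner_le_norm _ _
    have h3 := norm_add_le (f x - f y - innerSL ℝ n (x - y)) (innerSL ℝ n (x - y))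
    rw [sub_add_cancel, Real.norm_eq_abs] at h3
    linarith
  obtain ⟨δ₀, hδ₀, hball⟩ := Metric.eventually_nhds_iff_ball.1 h1
  set B := ‖b y‖ + L with hB
  have hB0 : 0 ≤ B := by positivity
  set E := B / 2 + B ^ 2 / 8 with hE
  have hE0 : 0 ≤ E := by positivity
  set K := ‖n‖ + 1 with hK
  have hK0 : 0 ≤ K := by positivity
  -- Radius at most `1` bounds the drift by `B` and the exponent of the weight by `E` on the ball.
  -- The constant dominates separately the increment bound, the value bound and `B`.
  refine ⟨min δ₀ 1, by positivity, (K + f y) * Real.exp E + f y * (E * Real.exp E) + B,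
    by positivity, ?_⟩
  intro σ hσ ξ hx
  set x := y + σ • ξ with hxdef
  have hxy : ‖x - y‖ = σ * ‖ξ‖ := by
    rw [hxdef, add_sub_cancel_left, norm_smul, Real.norm_of_nonneg hσ.1.le]
  have hr1 : ‖x - y‖ ≤ 1 := by
    have : ‖x - y‖ < min δ₀ 1 := by simpa [dist_eq_norm] using hx
    exact (this.trans_le (min_le_right _ _)).le
  have hfx := hball x (Metric.ball_subset_ball (min_le_left _ _) hx)
  have hbx : ‖b x‖ ≤ B := by
    have e1 := hb.norm_sub_le x y
    have e2 := norm_sub_norm_le (b x) (b y)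
    have e3 := mul_le_mul_of_nonneg_left hr1 L.coe_nonneg
    linarith
  set a := ⟪y - x, b x⟫ / 2 - σ ^ 2 / 2 * ‖b x‖ ^ 2 / 4 with ha
  have hw : driftWeight b (σ ^ 2 / 2) y x = Real.exp a := rfl
  have ha1 : |a| ≤ E * (σ * (1 + ‖ξ‖)) := by
    have e1 : |⟪y - x, b x⟫| ≤ σ * ‖ξ‖ * B := by
      refine (abs_real_inner_le_norm _ _).trans ?_
      rw [norm_sub_rev, hxy]
      have := hσ.1
      gcongr
    have e2 : ‖b x‖ ^ 2 ≤ B ^ 2 := by gcongr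
    have e3 : σ ^ 2 ≤ σ := by nlinarith [hσ.1, hσ.2]
    have e4 : |a| ≤ |⟪y - x, b x⟫| / 2 + σ ^ 2 / 2 * ‖b x‖ ^ 2 / 4 := by
      refine (abs_sub _ _).trans ?_
      rw [abs_div, abs_of_nonneg (show (0 : ℝ) ≤ σ ^ 2 / 2 * ‖b x‖ ^ 2 / 4 by positivity)]
      norm_num
    have e5 : σ ^ 2 * ‖b x‖ ^ 2 ≤ σ * B ^ 2 := by gcongr; exact hσ.1.le
    have e6 : E * (σ * (1 + ‖ξ‖)) = σ * ‖ξ‖ * B / 2 + σ * B ^ 2 / 8 +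
      (B / 2 * σ + B ^ 2 / 8 * (σ * ‖ξ‖)) := by rw [hE]; ring
    have e7 : 0 ≤ B / 2 * σ + B ^ 2 / 8 * (σ * ‖ξ‖) := by have := hσ.1; positivity
    linarith
  have ha2 : |a| ≤ E := by
    have e1 : |⟪y - x, b x⟫| ≤ 1 * B := by
      refine (abs_real_inner_le_norm _ _).trans ?_
      rw [norm_sub_rev]
      gcongr
    have e2 : ‖b x‖ ^ 2 ≤ B ^ 2 := by gcongr
    have e3 : σ ^ 2 ≤ 1 := by nlinarith [hσ.1, hσ.2]
    have e4 : |a| ≤ |⟪y - x, b x⟫| / 2 + σ ^ 2 / 2 * ‖b x‖ ^ 2 / 4 := by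
      refine (abs_sub _ _).trans ?_
      rw [abs_div, abs_of_nonneg (show (0 : ℝ) ≤ σ ^ 2 / 2 * ‖b x‖ ^ 2 / 4 by positivity)]
      norm_num
    have e5 : σ ^ 2 * ‖b x‖ ^ 2 ≤ 1 * B ^ 2 := by gcongr
    linarith
  have hexp : Real.exp a ≤ Real.exp E := Real.exp_le_exp.2 ((le_abs_self a).trans ha2)
  have hσξ : 0 ≤ σ * (1 + ‖ξ‖) := by have := hσ.1; positivity
  have hexp1 : |Real.exp a - 1| ≤ E * (σ * (1 + ‖ξ‖)) * Real.exp E :=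
    (abs_exp_sub_one_le_mul a).trans
      (mul_le_mul ha1 (Real.exp_le_exp.2 ha2) (Real.exp_pos _).le (mul_nonneg hE0 hσξ))
  rw [hw]
  refine ⟨?_, ?_, by
    have : 0 ≤ (K + f y) * Real.exp E + f y * (E * Real.exp E) := by positivity
    linarith⟩
  · have e1 : f x * Real.exp a - f y = (f x - f y) * Real.exp a + f y * (Real.exp a - 1) := by ring
    rw [e1]
    refine (abs_add_le _ _).trans ?_
    rw [abs_mul, abs_mul, abs_of_nonneg (Real.exp_pos a).le, abs_of_nonneg hf0]
    have e2 : |f x - f y| ≤ K * (σ * (1 + ‖ξ‖)) := by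
      refine hfx.trans ?_
      rw [hxy]
      gcongr
      · exact hσ.1.le
      · linarith
    calc _ ≤ K * (σ * (1 + ‖ξ‖)) * Real.exp E + f y * (E * (σ * (1 + ‖ξ‖)) * Real.exp E) := by gcongr
      _ = (K * Real.exp E + f y * (E * Real.exp E)) * (σ * (1 + ‖ξ‖)) := by ring
      _ ≤ _ := by
        refine mul_le_mul_of_nonneg_right ?_ hσξ
        have : 0 ≤ f y * Real.exp E := by positivity
        linarith
  · rw [abs_mul, abs_of_nonneg (Real.exp_pos a).le]
    have e2 : |f x| ≤ K + f y := by
      have e3 := abs_sub_abs_le_abs_sub (f x) (f y)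
      rw [abs_of_nonneg hf0] at e3
      have e4 := mul_le_mul_of_nonneg_left hr1 hK0
      linarith
    calc _ ≤ (K + f y) * Real.exp E := by gcongr
      _ ≤ _ := by
        have : 0 ≤ f y * (E * Real.exp E) := by positivity
        linarith

/-- The directional derivative of the weighted density. -/
lemma hasDerivAt_weighted (hb : Continuous b) {y n : Euc d} (hd : HasFDerivAt f (innerSL ℝ n) y)
    (ξ : Euc d) :
    HasDerivAt (fun σ : ℝ => f (y + σ • ξ) * driftWeight b (σ ^ 2 / 2) y (y + σ • ξ))
      (⟪n - (f y / 2) • b y, ξ⟫) 0 := by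
  have hline : HasDerivAt (fun σ : ℝ => y + σ • ξ) ξ 0 := by
    simpa using ((hasDerivAt_id (0 : ℝ)).smul_const ξ).const_add y
  have hd0 : HasFDerivAt f (innerSL ℝ n) (y + (0 : ℝ) • ξ) := by simpa using hd
  have h1 : HasDerivAt (fun σ : ℝ => f (y + σ • ξ)) ⟪n, ξ⟫ 0 := by
    have := hd0.comp_hasDerivAt (0 : ℝ) hline
    rwa [innerSL_apply_apply ℝ] at this
  set c : ℝ → ℝ := fun σ => -⟪ξ, b (y + σ • ξ)⟫ / 2 - σ * ‖b (y + σ • ξ)‖ ^ 2 / 8 with hc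
  have hcc : Continuous c := by rw [hc]; fun_prop
  -- The drift `b` is merely continuous here, so `c` need not be differentiable; the factor `σ`
  -- alone makes the exponent differentiable at `0`.
  have h2 : HasDerivAt (fun σ : ℝ => σ * c σ) (c 0) 0 := by
    rw [hasDerivAt_iff_tendsto_slope_zero]
    refine ((hcc.tendsto 0).mono_left nhdsWithin_le_nhds).congr' ?_
    filter_upwards [self_mem_nhdsWithin] with σ hσ
    have : σ ≠ 0 := hσ
    simp [this]
  have e : ∀ σ : ℝ, driftWeight b (σ ^ 2 / 2) y (y + σ • ξ) = Real.exp (σ * c σ) := fun σ => by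
    have e3 : y - (y + σ • ξ) = -(σ • ξ) := by abel
    rw [driftWeight, e3, inner_neg_left, real_inner_smul_left, hc]
    congr 1
    ring
  simp_rw [e]
  have h3 := h1.mul h2.exp
  refine h3.congr_deriv ?_
  simp only [zero_mul, Real.exp_zero, mul_one, one_mul, zero_smul, add_zero, hc, zero_div, sub_zero]
  rw [inner_sub_left, real_inner_smul_left, real_inner_comm ξ (b y)]
  ring

lemma integrable_one_add_norm_mul : Integrable (fun ξ : Euc d => (1 + ‖ξ‖) * ‖ξ‖)
    (stdGaussian (Euc d)) := by
  refine (integrable_id_stdGaussian.norm.add integrable_norm_sq_stdGaussian).congr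
    (.of_forall fun ξ => ?_)
  simp only [Pi.add_apply]; ring

lemma eventually_mem_ball (y : Euc d) {δ : ℝ} (hδ : 0 < δ) (ξ : Euc d) :
    ∀ᶠ σ : ℝ in 𝓝[>] 0, y + σ • ξ ∈ Metric.ball y δ := by
  have : Tendsto (fun σ : ℝ => y + σ • ξ) (𝓝[>] 0) (𝓝 (y + (0 : ℝ) • ξ)) :=
    (Continuous.tendsto (by fun_prop) 0).mono_left nhdsWithin_le_nhds
  rw [zero_smul, add_zero] at this
  exact this.eventually (Metric.ball_mem_nhds y hδ)

lemma eventually_Ioc : ∀ᶠ σ : ℝ in 𝓝[>] 0, σ ∈ Ioc (0 : ℝ) 1 := Ioc_mem_nhdsGT one_pos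

/-- Convergence of the local part of the density, and of the local part of its gradient. -/
lemma tendsto_near (hb : LipschitzWith L b) (hf : Measurable f) {y n : Euc d} (hf0 : 0 ≤ f y)
    (hd : HasFDerivAt f (innerSL ℝ n) y) :
    ∃ δ > 0,
      Tendsto (fun σ : ℝ => ∫ ξ, (Metric.ball y δ).indicator
        (fun x => (f x * driftWeight b (σ ^ 2 / 2) y x) • (1 : ℝ)) (y + σ • ξ)
          ∂stdGaussian (Euc d)) (𝓝[>] 0) (𝓝 (f y)) ∧
      Tendsto (fun σ : ℝ => ∫ ξ, (Metric.ball y δ).indicator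
        (fun x => (f x * driftWeight b (σ ^ 2 / 2) y x) •
          (-(1 / (2 * (σ ^ 2 / 2))) • resid b (σ ^ 2 / 2) x y)) (y + σ • ξ)
          ∂stdGaussian (Euc d)) (𝓝[>] 0) (𝓝 n) := by
  obtain ⟨δ, hδ, C, hC, hbd⟩ := exists_near_bound hb hf0 hd
  have hbm := hb.continuous.measurable
  have hw : ∀ s, Measurable (driftWeight b s y) := fun s => by unfold driftWeight; fun_prop
  have hN : MeasurableSet (Metric.ball y δ) := measurableSet_ball
  have hline : ∀ σ : ℝ, Measurable fun ξ : Euc d => y + σ • ξ := fun σ => by fun_prop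
  have hG : ∀ ξ : Euc d, Tendsto (fun σ : ℝ => f (y + σ • ξ) *
      driftWeight b (σ ^ 2 / 2) y (y + σ • ξ)) (𝓝[>] 0) (𝓝 (f y)) := fun ξ => by
    have := (hasDerivAt_weighted hb.continuous hd ξ).continuousAt.tendsto.mono_left
      (nhdsWithin_le_nhds (s := Ioi 0))
    simpa [driftWeight] using this
  refine ⟨δ, hδ, ?_, ?_⟩
  · have hlim : f y = ∫ _ : Euc d, f y ∂stdGaussian (Euc d) := by simp
    rw [hlim]
    refine tendsto_integral_filter_of_dominated_convergence (fun _ => C) ?_ ?_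
      (integrable_const _) ?_
    · refine .of_forall fun σ => Measurable.aestronglyMeasurable ?_
      exact (((hf.mul (hw _)).smul_const (1 : ℝ)).indicator hN).comp (hline σ)
    · filter_upwards [eventually_Ioc] with σ hσ
      refine .of_forall fun ξ => ?_
      by_cases hx : y + σ • ξ ∈ Metric.ball y δ
      · rw [indicator_of_mem hx, smul_eq_mul, mul_one]
        exact (hbd σ hσ ξ hx).2.1
      · rw [indicator_of_notMem hx, norm_zero]; exact hC
    · refine .of_forall fun ξ => (hG ξ).congr' ?_
      filter_upwards [eventually_mem_ball y hδ ξ] with σ hσ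
      rw [indicator_of_mem hσ, smul_eq_mul, mul_one]
  · -- split the weight `-resid / (2 s) = ξ / σ + b / 2`
    have hsplit : ∀ᶠ σ : ℝ in 𝓝[>] 0, ∫ ξ, (Metric.ball y δ).indicator
        (fun x => (f x * driftWeight b (σ ^ 2 / 2) y x) •
          (-(1 / (2 * (σ ^ 2 / 2))) • resid b (σ ^ 2 / 2) x y)) (y + σ • ξ) ∂stdGaussian (Euc d) =
        ∫ ξ, ((Metric.ball y δ).indicator (fun x => f x * driftWeight b (σ ^ 2 / 2) y x - f y)
          (y + σ • ξ) * σ⁻¹) • ξ ∂stdGaussian (Euc d) +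
        ∫ ξ, (Metric.ball y δ).indicator (fun x => (f x * driftWeight b (σ ^ 2 / 2) y x) •
          ((1 / 2 : ℝ) • b x)) (y + σ • ξ) ∂stdGaussian (Euc d) := by
      filter_upwards [eventually_Ioc] with σ hσ
      have hσ0 := hσ.1
      have i1 : Integrable (fun ξ => ((Metric.ball y δ).indicator (fun x => f x *
          driftWeight b (σ ^ 2 / 2) y x - f y) (y + σ • ξ) * σ⁻¹) • ξ) (stdGaussian (Euc d)) := by
        refine (integrable_one_add_norm_mul.const_mul C).mono' ?_ (.of_forall fun ξ => ?_)
        · have := (((hf.mul (hw (σ ^ 2 / 2))).sub_const (f y)).indicator hN).comp (hline σ)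
          exact ((this.mul_const _).smul measurable_id).aestronglyMeasurable
        · by_cases hx : y + σ • ξ ∈ Metric.ball y δ
          · rw [indicator_of_mem hx, norm_smul, norm_mul, norm_inv, Real.norm_of_nonneg hσ0.le,
              ← mul_assoc]
            refine mul_le_mul_of_nonneg_right ?_ (norm_nonneg ξ)
            rw [← div_eq_mul_inv, div_le_iff₀ hσ0, Real.norm_eq_abs]
            linarith [(hbd σ hσ ξ hx).1]
          · rw [indicator_of_notMem hx, zero_mul, zero_smul, norm_zero]; positivity
      have i2 : Integrable (fun ξ => (Metric.ball y δ).indicator (fun x => (f x *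
          driftWeight b (σ ^ 2 / 2) y x) • ((1 / 2 : ℝ) • b x)) (y + σ • ξ))
          (stdGaussian (Euc d)) := by
        refine (integrable_const (C * (1 / 2 * C))).mono' ?_ (.of_forall fun ξ => ?_)
        · exact ((((hf.mul (hw (σ ^ 2 / 2))).smul (hbm.const_smul (1 / 2 : ℝ))).indicator hN).comp
            (hline σ)).aestronglyMeasurable
        · by_cases hx : y + σ • ξ ∈ Metric.ball y δ
          · rw [indicator_of_mem hx, norm_smul, norm_smul, Real.norm_eq_abs,
              Real.norm_of_nonneg (by norm_num)]
            have := hbd σ hσ ξ hx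
            gcongr
            · exact this.2.1
            · exact this.2.2
          · rw [indicator_of_notMem hx, norm_zero]; positivity
      have i3 : Integrable (fun ξ : Euc d => (f y * σ⁻¹) •
          {ξ : Euc d | y + σ • ξ ∈ Metric.ball y δ}.indicator (fun ξ => ξ) ξ)
          (stdGaussian (Euc d)) :=
        (integrable_id_stdGaussian.indicator (hline σ hN)).smul (f y * σ⁻¹)
      -- The ball is symmetric about `y`, so this term is the integral of an odd function.
      -- Subtracting it replaces the singular factor `1/σ` by a difference quotient of the weighted
      -- density.
      have h0 : ∫ ξ, (f y * σ⁻¹) • {ξ : Euc d | y + σ • ξ ∈ Metric.ball y δ}.indicator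
          (fun ξ => ξ) ξ ∂stdGaussian (Euc d) = 0 := by
        rw [integral_smul, integral_symm_stdGaussian (N := {ξ | y + σ • ξ ∈ Metric.ball y δ})
          (by exact hline σ hN) (fun ξ => ?_), smul_zero]
        simp [dist_eq_norm]
      rw [← add_zero (∫ ξ, ((Metric.ball y δ).indicator (fun x => f x *
          driftWeight b (σ ^ 2 / 2) y x - f y) (y + σ • ξ) * σ⁻¹) • ξ ∂stdGaussian (Euc d)), ← h0,
        ← integral_add i1 i3, ← integral_add (by exact i1.add i3) i2]
      congr 1; ext1 ξ
      by_cases hx : y + σ • ξ ∈ Metric.ball y δ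
      · have hx' : ξ ∈ {ξ : Euc d | y + σ • ξ ∈ Metric.ball y δ} := hx
        rw [indicator_of_mem hx, indicator_of_mem hx, indicator_of_mem hx, indicator_of_mem hx',
          ← add_smul]
        have e1 : -(1 / (2 * (σ ^ 2 / 2))) • resid b (σ ^ 2 / 2) (y + σ • ξ) y =
            σ⁻¹ • ξ + (1 / 2 : ℝ) • b (y + σ • ξ) := by
          have e2 : resid b (σ ^ 2 / 2) (y + σ • ξ) y =
              -(σ • ξ) - (σ ^ 2 / 2) • b (y + σ • ξ) := by unfold resid; abel
          rw [e2, smul_sub, smul_neg, smul_smul, smul_smul, neg_mul, neg_smul, neg_neg, neg_mul,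
            neg_smul, sub_neg_eq_add]
          congr 2 <;> field_simp
        rw [e1, smul_add, smul_smul]
        congr 2
        ring
      · have hx' : ξ ∉ {ξ : Euc d | y + σ • ξ ∈ Metric.ball y δ} := hx
        rw [indicator_of_notMem hx, indicator_of_notMem hx, indicator_of_notMem hx,
          indicator_of_notMem hx']
        simp
    refine Tendsto.congr' (hsplit.mono fun σ h => h.symm) ?_
    -- Differentiating the drift weight contributes `-f(y) b(y)/2`, which the `b/2` part of the
    -- residual cancels; only the gradient `n` remains.
    have hn : n = ∫ ξ, ⟪n - (f y / 2) • b y, ξ⟫ • ξ ∂stdGaussian (Euc d) +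
        ∫ _ : Euc d, f y • ((1 / 2 : ℝ) • b y) ∂stdGaussian (Euc d) := by
      rw [integral_inner_smul_stdGaussian, integral_const, probReal_univ, one_smul, smul_smul]
      module
    rw [show 𝓝 n = 𝓝 _ from congrArg 𝓝 hn]
    refine Tendsto.add ?_ ?_
    · refine tendsto_integral_filter_of_dominated_convergence
        (fun ξ => C * ((1 + ‖ξ‖) * ‖ξ‖)) ?_ ?_ (integrable_one_add_norm_mul.const_mul C) ?_
      · refine .of_forall fun σ => Measurable.aestronglyMeasurable ?_
        have := (((hf.mul (hw (σ ^ 2 / 2))).sub_const (f y)).indicator hN).comp (hline σ)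
        exact (this.mul_const _).smul measurable_id
      · filter_upwards [eventually_Ioc] with σ hσ
        have hσ0 := hσ.1
        refine .of_forall fun ξ => ?_
        by_cases hx : y + σ • ξ ∈ Metric.ball y δ
        · rw [indicator_of_mem hx, norm_smul, norm_mul, norm_inv, Real.norm_of_nonneg hσ0.le,
            ← mul_assoc]
          refine mul_le_mul_of_nonneg_right ?_ (norm_nonneg ξ)
          rw [← div_eq_mul_inv, div_le_iff₀ hσ0, Real.norm_eq_abs]
          linarith [(hbd σ hσ ξ hx).1]
        · rw [indicator_of_notMem hx, zero_mul, zero_smul, norm_zero]; positivity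
      · refine .of_forall fun ξ => Tendsto.smul_const ?_ ξ
        have h1 := hasDerivAt_iff_tendsto_slope_zero.1 (hasDerivAt_weighted hb.continuous hd ξ)
        have h2 := h1.mono_left (nhdsWithin_mono (0 : ℝ) (fun x (hx : 0 < x) => hx.ne'))
        refine h2.congr' ?_
        filter_upwards [eventually_mem_ball y hδ ξ] with σ hσ
        rw [indicator_of_mem hσ]
        simp [driftWeight, mul_comm]
    · refine tendsto_integral_filter_of_dominated_convergence
        (fun ξ => C * (1 / 2 * C)) ?_ ?_ (integrable_const _) ?_
      · refine .of_forall fun σ => Measurable.aestronglyMeasurable ?_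
        exact (((hf.mul (hw (σ ^ 2 / 2))).smul (hbm.const_smul (1 / 2 : ℝ))).indicator hN).comp
          (hline σ)
      · filter_upwards [eventually_Ioc] with σ hσ
        refine .of_forall fun ξ => ?_
        by_cases hx : y + σ • ξ ∈ Metric.ball y δ
        · rw [indicator_of_mem hx, norm_smul, norm_smul, Real.norm_eq_abs,
            Real.norm_of_nonneg (by norm_num)]
          have := hbd σ hσ ξ hx
          gcongr
          · exact this.2.1
          · exact this.2.2
        · rw [indicator_of_notMem hx, norm_zero]; positivity
      · refine .of_forall fun ξ => ?_
        have hbc : Tendsto (fun σ : ℝ => b (y + σ • ξ)) (𝓝[>] 0) (𝓝 (b y)) := by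
          have hc : Continuous fun σ : ℝ => b (y + σ • ξ) := by
            have := hb.continuous
            fun_prop
          simpa using (hc.tendsto 0).mono_left (nhdsWithin_le_nhds (s := Ioi 0))
        refine ((hG ξ).smul (hbc.const_smul (1 / 2 : ℝ))).congr' ?_
        filter_upwards [eventually_mem_ball y hδ ξ] with σ hσ
        rw [indicator_of_mem hσ]

lemma tendsto_sqrt_two_mul : Tendsto (fun s : ℝ => √(2 * s)) (𝓝[>] 0) (𝓝[>] 0) := by
  refine tendsto_nhdsWithin_iff.2 ⟨?_, ?_⟩
  · have : Tendsto (fun s : ℝ => √(2 * s)) (𝓝 0) (𝓝 √(2 * 0)) :=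
      Continuous.tendsto (by fun_prop) 0
    rw [mul_zero, Real.sqrt_zero] at this
    exact this.mono_left nhdsWithin_le_nhds
  · filter_upwards [self_mem_nhdsWithin] with s hs
    have : 0 < s := hs
    exact Real.sqrt_pos.2 (by positivity)

/-- At a point of differentiability of the initial density, the density of a step and its gradient
converge as the step length tends to zero. -/
theorem tendsto_stepDensity [IsProbabilityMeasure q] (hb : LipschitzWith L b)
    (hf : Measurable f) (hf0 : ∀ x, 0 ≤ f x)
    (hq : q = volume.withDensity (fun x => ENNReal.ofReal (f x))) {y n : Euc d}
    (hd : HasFDerivAt f (innerSL ℝ n) y) :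
    Tendsto (fun s => stepDensity q b s y) (𝓝[>] 0) (𝓝 (f y)) ∧
    Tendsto (fun s => stepDensity q b s y • score q b s y) (𝓝[>] 0) (𝓝 n) := by
  obtain ⟨δ, hδ, h1, h2⟩ := tendsto_near hb hf (hf0 y) hd
  have hbm := hb.continuous.measurable
  have hN : MeasurableSet (Metric.ball y δ) := measurableSet_ball
  have hsq : ∀ s : ℝ, 0 < s → √(2 * s) ^ 2 / 2 = s := fun s hs => by
    rw [Real.sq_sqrt (by positivity)]; ring
  constructor
  · have hfar := tendsto_far (q := q) (F := ℝ) hb y hδ (V := fun _ _ => 1) (fun s x hs => by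
      rw [norm_one]
      have : 0 ≤ 1 / (2 * s) * ‖resid b s x y‖ := by positivity
      linarith)
    have hnear := h1.comp tendsto_sqrt_two_mul
    have := hnear.add hfar
    rw [add_zero] at this
    refine this.congr' ?_
    filter_upwards [self_mem_nhdsWithin] with s hs
    have hs' : 0 < s := hs
    simp only [Function.comp_apply]
    have hi : Integrable (fun x => transKer b s x y • (1 : ℝ)) q := by
      simpa using integrable_transKer (q := q) hbm hs'.le y
    rw [hsq s hs', ← setIntegral_transKer_eq hbm hf hf0 hq hs' y hN measurable_const, ← smul_add,
      integral_add_compl hN hi, stepDensity, mass]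
    simp
  · have hfar := tendsto_far (q := q) hb y hδ (V := fun s x => -(1 / (2 * s)) • resid b s x y)
      (fun s x hs => by
        rw [norm_smul, norm_neg, Real.norm_of_nonneg (by positivity)]
        linarith)
    have hnear := h2.comp tendsto_sqrt_two_mul
    have := hnear.add hfar
    rw [add_zero] at this
    refine this.congr' ?_
    filter_upwards [self_mem_nhdsWithin] with s hs
    have hs' : 0 < s := hs
    simp only [Function.comp_apply]
    have hi : Integrable (fun x => transKer b s x y • (-(1 / (2 * s)) • resid b s x y)) q := by
      simp_rw [smul_comm _ (-(1 / (2 * s)))]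
      exact (integrable_transKer_smul_resid (q := q) hbm hs' y).smul (-(1 / (2 * s)))
    rw [hsq s hs', ← setIntegral_transKer_eq hbm hf hf0 hq hs' y hN
      ((measurable_resid_left hbm s y).fun_const_smul _), ← smul_add, integral_add_compl hN hi,
      stepDensity, score, integral_backLaw, smul_smul, mul_assoc,
      mul_inv_cancel₀ (mass_pos hbm hs'.le y).ne', mul_one]

end EMDescent
end

noncomputable section

namespace EMDescent

open scoped RealInnerProductSpace

variable {m d : ℕ} {ρ : Euc m → Euc d → ℝ} {Lθ Lx L : ℝ≥0} {b : Euc d → Euc d}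
  {q : Measure (Euc d)} {f : Euc d → ℝ}

/-! ### The entropy of a step -/

/-- Banach's fixed point theorem for `x ↦ y - s b(x)`. The zero of the residual serves as centre of
a Gaussian bound for the kernel in its initial point. -/
lemma exists_resid_eq_zero (hb : LipschitzWith L b) {s : ℝ} (hs : 0 ≤ s) (hsL : s * L < 1)
    (y : Euc d) : ∃ x, resid b s x y = 0 := by
  have hc : ContractingWith (s.toNNReal * L) (fun x => y - s • b x) := by
    refine ⟨?_, LipschitzWith.of_dist_le_mul fun x x' => ?_⟩
    · rw [← NNReal.coe_lt_coe]
      simpa [Real.coe_toNNReal s hs] using hsL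
    · rw [dist_eq_norm, dist_eq_norm, sub_sub_sub_cancel_left, ← smul_sub, norm_smul,
        Real.norm_of_nonneg hs, NNReal.coe_mul, Real.coe_toNNReal s hs, mul_assoc,
        norm_sub_rev x x']
      gcongr
      exact hb.norm_sub_le _ _
  refine ⟨hc.fixedPoint, ?_⟩
  have h : y - s • b hc.fixedPoint = hc.fixedPoint := hc.fixedPoint_isFixedPt
  rw [resid, sub_right_comm, h, sub_self]

lemma heatConst_mul_inv {s a : ℝ} (hs : 0 < s) (ha : 0 < a) :
    heatConst d s * (heatConst d (s / a ^ 2))⁻¹ = a⁻¹ ^ d := by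
  have h : (4 * Real.pi * (s / a ^ 2)) ^ ((d : ℝ) / 2) =
      (4 * Real.pi * s) ^ ((d : ℝ) / 2) * a⁻¹ ^ d := by
    rw [show 4 * Real.pi * (s / a ^ 2) = 4 * Real.pi * s * a⁻¹ ^ 2 by field_simp,
      Real.mul_rpow (by positivity) (by positivity), ← Real.rpow_natCast (a⁻¹) 2,
      ← Real.rpow_mul (by positivity), ← Real.rpow_natCast]
    congr 2
    push_cast
    ring
  rw [heatConst, heatConst, inv_inv, h, ← mul_assoc, inv_mul_cancel₀ (by positivity), one_mul]

/-- The integral of the transition kernel in the initial point. -/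
lemma lintegral_transKer_left_le (hb : LipschitzWith L b) {s : ℝ} (hs : 0 < s) (hsL : s * L < 1)
    (y : Euc d) :
    ∫⁻ x, ENNReal.ofReal (heatConst d s * transKer b s x y) ≤
      ENNReal.ofReal ((1 - s * L)⁻¹ ^ d) := by
  obtain ⟨x₀, hx₀⟩ := exists_resid_eq_zero hb hs.le hsL y
  have ha : 0 < 1 - s * L := by linarith
  have hs' : 0 < s / (1 - s * L) ^ 2 := by positivity
  have hpt : ∀ x, transKer b s x y ≤
      Real.exp (-‖x - x₀‖ ^ 2 / (4 * (s / (1 - s * L) ^ 2))) := fun x => by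
    have h1 : x₀ - x = resid b s x y - s • (b x₀ - b x) := by
      rw [← sub_zero (resid b s x y), ← hx₀, resid, resid, smul_sub]; abel
    -- The map `x ↦ x + s b(x)` expands distances by at least `1 - sL`. So the kernel in `x` lies
    -- below a Gaussian of variance enlarged by `(1 - sL)⁻²`, whence the factor `(1 - sL)^(-d)`.
    have h2 : (1 - s * L) * ‖x - x₀‖ ≤ ‖resid b s x y‖ := by
      have h3 := norm_sub_le (resid b s x y) (s • (b x₀ - b x))
      rw [← h1, norm_smul, Real.norm_of_nonneg hs.le, norm_sub_rev x₀ x, norm_sub_rev (b x₀)] at h3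
      have := mul_le_mul_of_nonneg_left (hb.norm_sub_le x x₀) hs.le
      linarith
    have h4 := pow_le_pow_left₀ (by positivity) h2 2
    rw [transKer, Real.exp_le_exp, show -‖x - x₀‖ ^ 2 / (4 * (s / (1 - s * L) ^ 2)) =
      -((1 - s * L) * ‖x - x₀‖) ^ 2 / (4 * s) by field_simp]
    gcongr
  calc _ ≤ ∫⁻ x, ENNReal.ofReal (heatConst d s *
        Real.exp (-‖x - x₀‖ ^ 2 / (4 * (s / (1 - s * L) ^ 2)))) := by
        refine lintegral_mono fun x => ENNReal.ofReal_le_ofReal ?_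
        exact mul_le_mul_of_nonneg_left (hpt x) (heatConst_pos hs).le
    _ = _ := by
      rw [← ofReal_integral_eq_lintegral_ofReal ((integrable_exp_sub_sq_div hs' x₀).const_mul _)
        (.of_forall fun x => mul_nonneg (heatConst_pos hs).le (Real.exp_pos _).le),
        integral_const_mul, integral_exp_sub_sq_div hs', heatConst_mul_inv hs ha]

/-- In `E[p_s(Z) / f(X)]` the density of `X` cancels `1 / f(X)`, leaving the integral of the kernel
over its initial point, averaged under `p_s`. Where `f = 0` the convention `0 * ⊤ = 0` turns the
cancellation into `≤ 1`. -/
lemma lintegral_density_ratio_le [IsProbabilityMeasure q] (hb : LipschitzWith L b)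
    (hf : Measurable f) (hq : q = volume.withDensity (fun x => ENNReal.ofReal (f x)))
    {s : ℝ} (hs : 0 < s) (hsL : s * L < 1) :
    ∫⁻ z, ENNReal.ofReal (stepDensity q b s (emStep b s z)) * (ENNReal.ofReal (f z.1))⁻¹
      ∂(q.prod (stdGaussian (Euc d))) ≤ ENNReal.ofReal ((1 - s * L)⁻¹ ^ d) := by
  have hbm := hb.continuous.measurable
  have hp := measurable_stepDensity (q := q) hbm s
  have hk := measurable_transKer hbm s
  have hkl := measurable_transKer_left hbm s
  have hprob := isProbabilityMeasure_map_emStep (q := q) hbm s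
  rw [lintegral_emStep hbm hs (G := fun z => ENNReal.ofReal (stepDensity q b s z.2) *
    (ENNReal.ofReal (f z.1))⁻¹) (by fun_prop), lintegral_prod_symm' _ (by fun_prop)]
  calc _ ≤ ∫⁻ y, ENNReal.ofReal (stepDensity q b s y) * ENNReal.ofReal ((1 - s * L)⁻¹ ^ d) := by
        refine lintegral_mono fun y => ?_
        have e : ∀ x, ENNReal.ofReal (heatConst d s * transKer b s x y) *
            (ENNReal.ofReal (stepDensity q b s y) * (ENNReal.ofReal (f x))⁻¹) =
            ENNReal.ofReal (stepDensity q b s y) *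
              (ENNReal.ofReal (heatConst d s * transKer b s x y) * (ENNReal.ofReal (f x))⁻¹) :=
          fun x => by ring
        simp only [e]
        rw [lintegral_const_mul _ (by have := hkl y; fun_prop)]
        gcongr
        refine le_trans ?_ (lintegral_transKer_left_le hb hs hsL y)
        rw [hq, lintegral_withDensity_eq_lintegral_mul _ (by fun_prop)
          (by have := hkl y; fun_prop)]
        refine lintegral_mono fun x => ?_
        rw [Pi.mul_apply, mul_left_comm]
        exact mul_le_of_le_one_right' (ENNReal.mul_inv_le_one _)
    _ = _ := by
      rw [lintegral_mul_const _ (by fun_prop)]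
      have h1 : ∫⁻ y, ENNReal.ofReal (stepDensity q b s y) = 1 := by
        rw [← setLIntegral_univ, ← withDensity_apply _ .univ, ← map_emStep hbm hs]
        exact measure_univ
      rw [h1, one_mul]

lemma integrable_log_stepDensity_emStep [IsProbabilityMeasure q]
    (hq2 : Integrable (fun x => ‖x‖ ^ 2) q) (hb : LipschitzWith L b) {s : ℝ} (hs : 0 < s)
    (hsL : s * L ≤ 1 / 4) :
    Integrable (fun z => Real.log (stepDensity q b s (emStep b s z)))
      (q.prod (stdGaussian (Euc d))) := by
  simp only [log_stepDensity hb.continuous.measurable hs]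
  exact (integrable_const _).add (integrable_log_mass_emStep hq2 hb hs hsL)

/-- The negative entropy increases by at most `d log (1 - sL)⁻¹` in a step. -/
theorem integral_log_stepDensity_le [IsProbabilityMeasure q]
    (hq2 : Integrable (fun x => ‖x‖ ^ 2) q) (hb : LipschitzWith L b)
    (hf : Measurable f) (hq : q = volume.withDensity (fun x => ENNReal.ofReal (f x)))
    (hi : Integrable (fun x => Real.log (f x)) q) {s : ℝ} (hs : 0 < s) (hsL : s * L ≤ 1 / 4) :
    ∫ z, Real.log (stepDensity q b s (emStep b s z)) ∂(q.prod (stdGaussian (Euc d))) ≤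
      ∫ x, Real.log (f x) ∂q + d * Real.log (1 - s * L)⁻¹ := by
  have hbm := hb.continuous.measurable
  have hp := measurable_stepDensity (q := q) hbm s
  have hZ := measurable_emStep hbm s
  have ha : 0 < 1 - s * L := by linarith
  set ν := q.prod (stdGaussian (Euc d)) with hν
  set K := (1 - s * L)⁻¹ ^ d with hK
  have hK0 : 0 < K := by positivity
  have hfpos : ∀ᵐ z ∂ν, 0 < f z.1 :=
    Measure.quasiMeasurePreserving_fst.ae (ae_pos_of_density hf hq)
  have hi1 := integrable_log_stepDensity_emStep hq2 hb hs hsL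
  have hi2 : Integrable (fun z : Euc d × Euc d => Real.log (f z.1)) ν := hi.comp_fst _
  have hratio : ∫⁻ z, ENNReal.ofReal (stepDensity q b s (emStep b s z) / f z.1) ∂ν ≤
      ENNReal.ofReal K := by
    refine le_trans (le_of_eq (lintegral_congr_ae ?_))
      (lintegral_density_ratio_le hb hf hq hs (by linarith))
    filter_upwards [hfpos] with z hz
    rw [div_eq_mul_inv, ENNReal.ofReal_mul (stepDensity_pos hbm hs _).le,
      ENNReal.ofReal_inv_of_pos hz]
  have hrnn : 0 ≤ᵐ[ν] fun z => stepDensity q b s (emStep b s z) / f z.1 := by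
    filter_upwards [hfpos] with z hz
    exact (div_pos (stepDensity_pos hbm hs _) hz).le
  have hrm : AEStronglyMeasurable (fun z => stepDensity q b s (emStep b s z) / f z.1) ν :=
    Measurable.aestronglyMeasurable (by fun_prop)
  have hri : Integrable (fun z => stepDensity q b s (emStep b s z) / f z.1) ν := by
    refine ⟨hrm, ?_⟩
    rw [hasFiniteIntegral_iff_ofReal hrnn]
    exact hratio.trans_lt ENNReal.ofReal_lt_top
  have hrint : ∫ z, stepDensity q b s (emStep b s z) / f z.1 ∂ν ≤ K := by
    rw [integral_eq_lintegral_of_nonneg_ae hrnn hrm]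
    exact ENNReal.toReal_le_of_le_ofReal hK0.le hratio
  -- Jensen for `log(p_s(Z) / f(X))`, through the tangent line `log r ≤ r - 1` at `r = K⁻¹ p_s(Z) /
  -- f(X)`.
  have hmain : ∫ z, Real.log (stepDensity q b s (emStep b s z)) ∂ν ≤
      ∫ z, (Real.log (f z.1) + (Real.log K + (K⁻¹ *
        (stepDensity q b s (emStep b s z) / f z.1) - 1))) ∂ν := by
    refine integral_mono_ae hi1 (hi2.add ((integrable_const _).add
      ((hri.const_mul _).sub (integrable_const _)))) ?_
    filter_upwards [hfpos] with z hz
    have hpz := stepDensity_pos (q := q) hbm hs (emStep b s z)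
    have h := Real.log_le_sub_one_of_pos (x := K⁻¹ *
      (stepDensity q b s (emStep b s z) / f z.1)) (by positivity)
    rw [Real.log_mul (by positivity) (by positivity), Real.log_inv,
      Real.log_div hpz.ne' hz.ne'] at h
    linarith
  have hi3 := (hri.const_mul K⁻¹).sub (integrable_const (1 : ℝ))
  rw [integral_add hi2 (by exact (integrable_const _).add hi3),
    integral_add (integrable_const _) (by exact hi3),
    integral_sub (by exact hri.const_mul _) (integrable_const _), integral_const_mul,
    integral_fun_fst (fun x => Real.log (f x))] at hmain
  simp only [integral_const, probReal_univ, one_smul] at hmain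
  have h1 : K⁻¹ * ∫ z, stepDensity q b s (emStep b s z) / f z.1 ∂ν ≤ 1 := by
    rw [inv_mul_le_iff₀ hK0, mul_one]; exact hrint
  have h2 : Real.log K = d * Real.log (1 - s * L)⁻¹ := by rw [hK, Real.log_pow]
  linarith

/-! ### Limits of expectations along the interpolation -/

lemma tendsto_emStep (z : Euc d × Euc d) :
    Tendsto (fun s => emStep b s z) (𝓝[>] 0) (𝓝 z.1) := by
  have hc : Continuous fun s => emStep b s z := by unfold emStep; fun_prop
  have := (hc.tendsto 0).mono_left (nhdsWithin_le_nhds (s := Ioi 0))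
  simpa [emStep] using this

lemma tendsto_integral_emStep [IsProbabilityMeasure q] (hq2 : Integrable (fun x => ‖x‖ ^ 2) q)
    (hb : LipschitzWith L b) {F : Type*} [NormedAddCommGroup F] [NormedSpace ℝ F]
    {G : ℝ → Euc d → F} (hG : Continuous fun p : ℝ × Euc d => G p.1 p.2) {C : ℝ}
    (hC : ∀ s ∈ Icc (0 : ℝ) 1, ∀ y, ‖G s y‖ ≤ C * (1 + ‖y‖ ^ 2)) :
    Tendsto (fun s => ∫ z, G s (emStep b s z) ∂(q.prod (stdGaussian (Euc d)))) (𝓝[>] 0)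
      (𝓝 (∫ x, G 0 x ∂q)) := by
  have hbm := hb.continuous
  obtain ⟨C', hC', h⟩ := exists_emStep_bound (d := d) hb (t := 1) one_pos
  have hC0 : 0 ≤ C := by simpa using (norm_nonneg _).trans (hC 0 ⟨le_rfl, zero_le_one⟩ 0)
  have hfst : ∫ x, G 0 x ∂q = ∫ z : Euc d × Euc d, G 0 z.1 ∂(q.prod (stdGaussian (Euc d))) := by
    rw [integral_fun_fst]; simp
  rw [hfst]
  refine tendsto_integral_filter_of_dominated_convergence
    (fun z => C * (C' * (1 + ‖z.1‖ ^ 2 + ‖z.2‖ ^ 2))) ?_ ?_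
    (((integrable_growth hq2).const_mul C').const_mul C) ?_
  · refine .of_forall fun s => Continuous.aestronglyMeasurable ?_
    exact hG.comp (continuous_const.prodMk (by fun_prop))
  · filter_upwards [eventually_Ioc] with s hs
    refine .of_forall fun z => (hC s ⟨hs.1.le, hs.2⟩ _).trans ?_
    gcongr
    exact h s ⟨hs.1.le, by linarith [hs.2]⟩ z
  · refine .of_forall fun z => ?_
    exact (hG.tendsto (0, z.1)).comp
      ((tendsto_id.mono_left nhdsWithin_le_nhds).prodMk_nhds (tendsto_emStep z))

lemma LipschitzGradient.exists_logLik_path_bound (hg : LipschitzGradient ρ Lθ Lx) (θ g : Euc m) :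
    ∃ C, ∀ s ∈ Icc (0 : ℝ) 1, ∀ y, ‖logLik ρ (θ + s • g) y‖ ≤ C * (1 + ‖y‖ ^ 2) := by
  obtain ⟨C₁, hC₁, h₁⟩ := hg.exists_logLik_bound θ
  obtain ⟨C₂, hC₂, h₂⟩ := hg.exists_path_bound θ g zero_le_one
  refine ⟨C₁ + 2 * C₂, fun s hs y => ?_⟩
  have hd : ∀ r ∈ Icc (0 : ℝ) 1, HasDerivWithinAt (fun r => logLik ρ (θ + r • g) y)
      ⟪gradTheta ρ (θ + r • g) y, g⟫ (Icc 0 1) r := fun r _ => by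
    have h := (hg.hasFDerivAt_path θ g r y).comp_hasDerivAt r
      ((hasDerivAt_id' r).prodMk (hasDerivAt_const r y))
    refine (h.congr_deriv ?_).hasDerivWithinAt
    simp [jointForm_apply]
  have h3 := (convex_Icc (0 : ℝ) 1).norm_image_sub_le_of_norm_hasDerivWithin_le hd
    (fun r hr => (h₂ r hr y).1) (left_mem_Icc.2 zero_le_one) hs
  rw [zero_smul, add_zero, sub_zero, Real.norm_of_nonneg hs.1] at h3
  have h4 := norm_sub_norm_le (logLik ρ (θ + s • g) y) (logLik ρ θ y)
  have h5 := h₁ y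
  rw [← Real.norm_eq_abs] at h5
  have h6 : C₂ * (1 + ‖y‖) * s ≤ C₂ * (1 + ‖y‖) :=
    mul_le_of_le_one_right (by positivity) hs.2
  have h7 : C₂ * (1 + ‖y‖) ≤ C₂ * (2 * (1 + ‖y‖ ^ 2)) := by
    gcongr; nlinarith [sq_nonneg (‖y‖ - 1)]
  linarith

lemma LipschitzGradient.tendsto_integral_logLik [IsProbabilityMeasure q]
    (hg : LipschitzGradient ρ Lθ Lx) (hq2 : Integrable (fun x => ‖x‖ ^ 2) q)
    (hb : LipschitzWith L b) (θ g : Euc m) :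
    Tendsto (fun s => ∫ z, logLik ρ (θ + s • g) (emStep b s z) ∂(q.prod (stdGaussian (Euc d))))
      (𝓝[>] 0) (𝓝 (∫ x, logLik ρ θ x ∂q)) := by
  obtain ⟨C, hC⟩ := hg.exists_logLik_path_bound θ g
  have := tendsto_integral_emStep hq2 hb (G := fun s y => logLik ρ (θ + s • g) y)
    (hg.differentiable.continuous.comp (f := fun p : ℝ × Euc d => (θ + p.1 • g, p.2))
      (by fun_prop)) hC
  simpa using this

lemma LipschitzGradient.continuous_gradTheta (hg : LipschitzGradient ρ Lθ Lx) :
    Continuous fun p : Euc m × Euc d => gradTheta ρ p.1 p.2 := by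
  refine (LipschitzWith.of_dist_le_mul (K := 2 * max Lθ Lx) fun p p' => ?_).continuous
  rw [dist_eq_norm, NNReal.coe_mul, NNReal.coe_two, mul_comm 2, mul_assoc, two_mul]
  refine (hg.norm_gradTheta_sub_le (le_max_left Lθ Lx) (le_max_right _ _) _ _ _ _).trans ?_
  gcongr
  · rw [← dist_eq_norm, Prod.dist_eq]; exact le_max_left _ _
  · rw [← dist_eq_norm, Prod.dist_eq]; exact le_max_right _ _

lemma LipschitzGradient.continuous_gradX (hg : LipschitzGradient ρ Lθ Lx) :
    Continuous fun p : Euc m × Euc d => gradX ρ p.1 p.2 := by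
  refine (LipschitzWith.of_dist_le_mul (K := 2 * max Lθ Lx) fun p p' => ?_).continuous
  rw [dist_eq_norm, NNReal.coe_mul, NNReal.coe_two, mul_comm 2, mul_assoc, two_mul]
  refine (hg.norm_gradX_sub_le (le_max_left Lθ Lx) (le_max_right _ _) _ _ _ _).trans ?_
  gcongr
  · rw [← dist_eq_norm, Prod.dist_eq]; exact le_max_left _ _
  · rw [← dist_eq_norm, Prod.dist_eq]; exact le_max_right _ _

lemma LipschitzGradient.tendsto_integral_gradTheta [IsProbabilityMeasure q]
    (hg : LipschitzGradient ρ Lθ Lx) (hq2 : Integrable (fun x => ‖x‖ ^ 2) q)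
    (hb : LipschitzWith L b) (θ g : Euc m) :
    Tendsto (fun s => ∫ z, gradTheta ρ (θ + s • g) (emStep b s z)
      ∂(q.prod (stdGaussian (Euc d)))) (𝓝[>] 0) (𝓝 (∫ x, gradTheta ρ θ x ∂q)) := by
  obtain ⟨C, hC, h⟩ := hg.exists_path_bound θ g zero_le_one
  have := tendsto_integral_emStep hq2 hb (G := fun s y => gradTheta ρ (θ + s • g) y) (C := 2 * C)
    (hg.continuous_gradTheta.comp (f := fun p : ℝ × Euc d => (θ + p.1 • g, p.2)) (by fun_prop))
    fun s hs y => (h s hs y).2.2.trans (by nlinarith [mul_nonneg hC (sq_nonneg (‖y‖ - 1))])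
  simpa using this

/-- The free energy is upper semicontinuous at the initial time. -/
lemma exists_tendsto_freeEnergyPath_le [IsProbabilityMeasure q]
    (hg : LipschitzGradient ρ Lθ Lx) (hq2 : Integrable (fun x => ‖x‖ ^ 2) q)
    (hb : LipschitzWith L b) (hf : Measurable f)
    (hq : q = volume.withDensity (fun x => ENNReal.ofReal (f x)))
    (hi : Integrable (fun x => Real.log (f x)) q) (θ g : Euc m) :
    ∃ G : ℝ → ℝ, Tendsto G (𝓝[>] 0) (𝓝 (∫ x, (Real.log (f x) - logLik ρ θ x) ∂q)) ∧
      ∀ s : ℝ, 0 < s → s * L ≤ 1 / 4 → freeEnergyPath ρ q b θ g s ≤ G s := by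
  -- The majorant combines the entropy bound, whose excess `d log (1 - sL)⁻¹` tends to zero, with
  -- the log-likelihood term, which converges by domination. An upper bound alone suffices later.
  refine ⟨fun s => (∫ x, Real.log (f x) ∂q + d * Real.log (1 - s * L)⁻¹) -
    ∫ z, logLik ρ (θ + s • g) (emStep b s z) ∂(q.prod (stdGaussian (Euc d))), ?_,
    fun s hs hsL => ?_⟩
  · rw [integral_sub hi (integrable_logLik hg hq2 θ)]
    refine Tendsto.sub ?_ (hg.tendsto_integral_logLik hq2 hb θ g)
    have h1 : Tendsto (fun s : ℝ => Real.log (1 - s * L)⁻¹) (𝓝 0)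
        (𝓝 (Real.log (1 - 0 * (L : ℝ))⁻¹)) := by
      refine Tendsto.log (Tendsto.inv₀ (Continuous.tendsto (by fun_prop) 0) (by simp)) (by simp)
    simp only [zero_mul, sub_zero, inv_one, Real.log_one] at h1
    simpa using ((h1.mono_left nhdsWithin_le_nhds).const_mul (d : ℝ)).const_add
      (∫ x, Real.log (f x) ∂q)
  · have hbm := hb.continuous.measurable
    have h1 := integral_log_stepDensity_le hq2 hb hf hq hi hs hsL
    have hlm := integrable_log_mass_emStep hq2 hb hs hsL
    obtain ⟨C, hC, hCb⟩ := hg.exists_logLik_bound (θ + s • g)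
    have hl := integrable_comp_emStep hq2 hb hs.le (hg.continuous_logLik (θ + s • g)).measurable hCb
    simp only [log_stepDensity hbm hs] at h1
    rw [integral_add (integrable_const _) hlm, integral_const, probReal_univ, one_smul] at h1
    rw [freeEnergyPath, integral_sub hlm hl]
    linarith

end EMDescent
end

noncomputable section

namespace EMDescent

open scoped RealInnerProductSpace

variable {m d : ℕ} {ρ : Euc m → Euc d → ℝ} {Lθ Lx L : ℝ≥0} {b : Euc d → Euc d}
  {q : Measure (Euc d)} {f : Euc d → ℝ}

/-! ### Descent at the initial time -/

lemma eventually_mul_le (L : ℝ≥0) {c : ℝ} (hc : 0 < c) : ∀ᶠ s : ℝ in 𝓝[>] 0, s * L ≤ c := by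
  have : Tendsto (fun s : ℝ => s * L) (𝓝[>] 0) (𝓝 (0 * L)) :=
    (tendsto_id.mul_const _).mono_left nhdsWithin_le_nhds
  rw [zero_mul] at this
  exact (this.eventually (gt_mem_nhds hc)).mono fun s hs => hs.le

lemma fisherPath_nonneg (θ : Euc m) (s : ℝ) : 0 ≤ fisherPath ρ q b θ s :=
  add_nonneg (sq_nonneg _) (integral_nonneg fun _ => sq_nonneg _)

/-- The information is written as one integral against Lebesgue measure, which does not depend on
`s`, in preparation for Fatou's lemma. -/
lemma ofReal_fisherPath [IsProbabilityMeasure q] (hq : Integrable (fun x => ‖x‖ ^ 2) q)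
    (hg : LipschitzGradient ρ Lθ Lx) (hpos : ∀ θ x, 0 < ρ θ x) (hb : LipschitzWith L b)
    (hθ : Lθ ≤ L) (hx : Lx ≤ L) (θ : Euc m) {s : ℝ} (hs : 0 < s) (hsL : s * L ≤ 1 / 4) :
    ENNReal.ofReal (fisherPath ρ q b θ s) = ∫⁻ y, ENNReal.ofReal (stepDensity q b s y) *
      (‖∫ z, gradTheta ρ θ (emStep b s z) ∂(q.prod (stdGaussian (Euc d)))‖ₑ ^ 2 +
        ‖score q b s y - gradX ρ θ y‖ₑ ^ 2) := by
  have hbm := hb.continuous.measurable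
  have hprob := isProbabilityMeasure_map_emStep (q := q) hbm s
  have hsm := measurable_score (q := q) hbm s
  have hvm := (hg.lipschitzWith_gradX hθ hx θ).continuous.measurable
  have hpm := measurable_stepDensity (q := q) hbm s
  rw [← extFisher_map_emStep hq hg hpos hb hθ hx θ hs hsL (isDiffDensity_stepDensity hq hb hs),
    extFisher, integral_map (measurable_emStep hbm s).aemeasurable
      (hg.lipschitzWith_gradTheta hθ hx θ).continuous.aestronglyMeasurable]
  simp_rw [gradient_log_stepDensity_div hq hg hpos hb θ hs]
  set A := ‖∫ z, gradTheta ρ θ (emStep b s z) ∂(q.prod (stdGaussian (Euc d)))‖ₑ ^ 2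
  have h1 : ∫⁻ y, (A + ‖score q b s y - gradX ρ θ y‖ₑ ^ 2)
      ∂((q.prod (stdGaussian (Euc d))).map (emStep b s)) =
      A + ∫⁻ y, ‖score q b s y - gradX ρ θ y‖ₑ ^ 2
        ∂((q.prod (stdGaussian (Euc d))).map (emStep b s)) := by
    rw [lintegral_add_left measurable_const]; simp
  rw [← h1, map_emStep hbm hs, lintegral_withDensity_eq_lintegral_mul _ (by fun_prop)
    (by fun_prop)]
  rfl

/-- The extended Fisher information is lower semicontinuous at the initial time. -/
theorem extFisher_le_liminf [IsProbabilityMeasure q] (hq2 : Integrable (fun x => ‖x‖ ^ 2) q)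
    (hg : LipschitzGradient ρ Lθ Lx) (hpos : ∀ θ x, 0 < ρ θ x) (hb : LipschitzWith L b)
    (hθ : Lθ ≤ L) (hx : Lx ≤ L) (θ g : Euc m) (hf : IsDiffDensity q f) :
    extFisher ρ θ q f ≤
      liminf (fun s => ENNReal.ofReal (fisherPath ρ q b (θ + s • g) s)) (𝓝[>] 0) := by
  have hbm := hb.continuous.measurable
  set A : ℝ → ℝ≥0∞ := fun s =>
    ‖∫ z, gradTheta ρ (θ + s • g) (emStep b s z) ∂(q.prod (stdGaussian (Euc d)))‖ₑ ^ 2 with hA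
  have hAlim : Tendsto A (𝓝[>] 0) (𝓝 (‖∫ x, gradTheta ρ θ x ∂q‖ₑ ^ 2)) :=
    ENNReal.Tendsto.pow (hg.tendsto_integral_gradTheta hq2 hb θ g).enorm
  set u : ℝ → Euc d → ℝ≥0∞ := fun s y => ENNReal.ofReal (stepDensity q b s y) *
    (A s + ‖score q b s y - gradX ρ (θ + s • g) y‖ₑ ^ 2) with hu
  have hum : ∀ s, Measurable (u s) := fun s => by
    have hsm := measurable_score (q := q) hbm s
    have hvm := (hg.lipschitzWith_gradX hθ hx (θ + s • g)).continuous.measurable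
    have hpm := measurable_stepDensity (q := q) hbm s
    fun_prop
  have hpath : ∀ᶠ s in 𝓝[>] 0, ∫⁻ y, u s y =
      ENNReal.ofReal (fisherPath ρ q b (θ + s • g) s) := by
    filter_upwards [eventually_mul_le L (c := 1 / 4) (by norm_num), self_mem_nhdsWithin] with s h1 hs
    exact (ofReal_fisherPath hq2 hg hpos hb hθ hx (θ + s • g) hs h1).symm
  rw [← liminf_congr hpath]
  refine le_trans ?_ (lintegral_liminf_le hum)
  have hLHS : extFisher ρ θ q f = ∫⁻ y, ENNReal.ofReal (f y) * (‖∫ x, gradTheta ρ θ x ∂q‖ₑ ^ 2 +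
      ‖gradient (fun y => Real.log (f y / ρ θ y)) y‖ₑ ^ 2) := by
    set A₀ := ‖∫ x, gradTheta ρ θ x ∂q‖ₑ ^ 2 with hA₀
    have h1 : extFisher ρ θ q f = ∫⁻ y, (A₀ +
        ‖gradient (fun y => Real.log (f y / ρ θ y)) y‖ₑ ^ 2) ∂q := by
      rw [lintegral_add_left measurable_const, extFisher]; simp [hA₀]
    rw [h1]
    conv_lhs => rw [hf.eq_withDensity]
    rw [lintegral_withDensity_eq_lintegral_mul_non_measurable _ hf.measurable.ennreal_ofReal
      (.of_forall fun _ => ENNReal.ofReal_lt_top)]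
    rfl
  rw [hLHS]
  refine lintegral_mono_ae ?_
  filter_upwards [hf.ae_differentiable] with y hdy
  rcases (hf.nonneg y).eq_or_lt with h0 | hfy
  -- Points where `f` vanishes contribute nothing on the left. At the remaining ones the logarithm
  -- is differentiable and the integrand converges.
  · rw [← h0, ENNReal.ofReal_zero, zero_mul]; exact zero_le
  have hd : HasFDerivAt f (innerSL ℝ (gradient f y)) y := by
    refine hdy.hasFDerivAt.congr_fderiv (ContinuousLinearMap.ext fun v => ?_)
    rw [innerSL_apply_apply ℝ, gradient, InnerProductSpace.toDual_symm_apply]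
  rw [gradient_log_div hg hpos θ hfy hd]
  obtain ⟨h1, h2⟩ := tendsto_stepDensity hb hf.measurable hf.nonneg hf.eq_withDensity hd
  have h3 : Tendsto (fun s => score q b s y) (𝓝[>] 0) (𝓝 ((f y)⁻¹ • gradient f y)) := by
    refine ((h1.inv₀ hfy.ne').smul h2).congr' ?_
    filter_upwards [self_mem_nhdsWithin] with s hs
    rw [smul_smul, inv_mul_cancel₀ (stepDensity_pos hbm hs y).ne', one_smul]
  have h4 : Tendsto (fun s : ℝ => gradX ρ (θ + s • g) y) (𝓝[>] 0) (𝓝 (gradX ρ θ y)) := by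
    have hc : Continuous fun s : ℝ => gradX ρ (θ + s • g) y :=
      hg.continuous_gradX.comp (f := fun s : ℝ => (θ + s • g, y)) (by fun_prop)
    simpa using (hc.tendsto 0).mono_left (nhdsWithin_le_nhds (s := Ioi 0))
  have h5 := ENNReal.Tendsto.mul (ENNReal.tendsto_ofReal h1) (.inr (by simp))
    (hAlim.add (ENNReal.Tendsto.pow (n := 2) (h3.sub h4).enorm)) (.inr (by simp))
  exact h5.liminf_eq.ge

/-- Lower semicontinuity in the form needed for the mean value argument: any real `M` above `-I/2`
at time zero stays above it shortly afterwards, including the case `I = ⊤`. For `M ≥ 0` the sign of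
the information suffices. -/
lemma eventually_le_fisherPath [IsProbabilityMeasure q] (hq2 : Integrable (fun x => ‖x‖ ^ 2) q)
    (hg : LipschitzGradient ρ Lθ Lx) (hpos : ∀ θ x, 0 < ρ θ x) (hb : LipschitzWith L b)
    (hθ : Lθ ≤ L) (hx : Lx ≤ L) (θ g : Euc m) (hf : IsDiffDensity q f) {M : ℝ}
    (hM : ((-(1 / 2) : ℝ) : EReal) * ((extFisher ρ θ q f : ℝ≥0∞) : EReal) < (M : EReal)) :
    ∀ᶠ s in 𝓝[>] 0, -(1 / 2) * fisherPath ρ q b (θ + s • g) s ≤ M := by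
  rcases le_or_gt 0 M with h0 | h0
  · exact .of_forall fun s => by linarith [fisherPath_nonneg (ρ := ρ) (q := q) (b := b) (θ + s • g) s]
  have hlt : ENNReal.ofReal (-2 * M) < extFisher ρ θ q f := by
    rcases eq_or_ne (extFisher ρ θ q f) ⊤ with h | h
    · rw [h]; exact ENNReal.ofReal_lt_top
    · lift extFisher ρ θ q f to ℝ≥0 using h with c
      rw [EReal.coe_nnreal_eq_coe_real, ← EReal.coe_mul, EReal.coe_lt_coe_iff] at hM
      rw [ENNReal.ofReal_lt_coe_iff (by linarith)]
      linarith
  have hev := eventually_lt_of_lt_liminf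
    (hlt.trans_le (extFisher_le_liminf (b := b) hq2 hg hpos hb hθ hx θ g hf))
  filter_upwards [hev] with s hs
  have := (ENNReal.ofReal_lt_ofReal_iff_of_nonneg (by linarith)).1 hs
  linarith

/-- The descent inequality for the upper right derivative at the initial time. -/
theorem eventually_freeEnergyPath_sub_le [IsProbabilityMeasure q]
    (hq2 : Integrable (fun x => ‖x‖ ^ 2) q)
    (hg : LipschitzGradient ρ Lθ Lx) (hpos : ∀ θ x, 0 < ρ θ x)
    (hθ : Lθ ≤ L) (hx : Lx ≤ L) (θ θf g : Euc m) (hgd : g = ∫ x, gradTheta ρ θ x ∂q)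
    (hθf : ∀ᶠ t : ℝ in 𝓝[>] 0, L * ‖θ + t • g - θf‖ ≤ 1 / 4 * ‖g‖)
    (hf : IsDiffDensity q f) (hi : Integrable (fun x => Real.log (f x)) q) {M : ℝ}
    (hM : ((-(1 / 2) : ℝ) : EReal) * ((extFisher ρ θ q f : ℝ≥0∞) : EReal) < (M : EReal)) :
    ∀ᶠ t in 𝓝[>] 0, freeEnergyPath ρ q (gradX ρ θf) θ g t -
      ∫ x, (Real.log (f x) - logLik ρ θ x) ∂q ≤ M * t := by
  have hb := hg.lipschitzWith_gradX hθ hx θf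
  set F := freeEnergyPath ρ q (gradX ρ θf) θ g with hF
  -- The gap `M - M'` leaves room for the error `6 L² d s`, which tends to zero.
  obtain ⟨M', hM1, hM2⟩ := EReal.lt_iff_exists_real_btwn.1 hM
  rw [EReal.coe_lt_coe_iff] at hM2
  have hsmall : ∀ᶠ s : ℝ in 𝓝[>] 0, 6 * L ^ 2 * d * s ≤ M - M' := by
    filter_upwards [eventually_mul_le (6 * L ^ 2 * d) (sub_pos.2 hM2)] with s hs
    push_cast at hs
    linarith
  have hder : ∀ᶠ s in 𝓝[>] 0, ∃ D, HasDerivAt F D s ∧ D ≤ M := by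
    filter_upwards [hsmall, hθf, eventually_mul_le L (c := 1 / 4) (by norm_num),
      eventually_le_fisherPath hq2 hg hpos hb hθ hx θ g hf hM1, self_mem_nhdsWithin]
      with s h1 h2 h3 h4 hs
    obtain ⟨D, hD, hle⟩ := exists_hasDerivAt_freeEnergyPath_le hq2 hg hθ hx θ θf g hgd hs h3 h2
    exact ⟨D, hD, by linarith⟩
  obtain ⟨ε, hε, hsub⟩ := mem_nhdsGT_iff_exists_Ioo_subset.1 hder
  obtain ⟨G, hG, hFG⟩ := exists_tendsto_freeEnergyPath_le hg hq2 hb hf.measurable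
    hf.eq_withDensity hi θ g
  filter_upwards [Ioo_mem_nhdsGT hε] with t ht
  -- The path may fail to be continuous at zero, so the mean value inequality is used on `[r, t]`
  -- only. As `r → 0`, the term `F r` is replaced by its majorant `G r`.
  have hmv : ∀ r ∈ Ioo 0 t, F t - F r ≤ M * (t - r) := by
    intro r hr
    have hdiff : ∀ x ∈ Ioo 0 ε, DifferentiableAt ℝ F x := fun x hx' => by
      obtain ⟨D, hD, -⟩ := hsub hx'
      exact hD.differentiableAt
    refine (convex_Ioo (0 : ℝ) ε).image_sub_le_mul_sub_of_deriv_le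
      (fun x hx' => (hdiff x hx').continuousAt.continuousWithinAt)
      (fun x hx' => (hdiff x (interior_subset hx')).differentiableWithinAt)
      (fun x hx' => ?_) r ⟨hr.1, hr.2.trans ht.2⟩ t ht hr.2.le
    obtain ⟨D, hD, hle⟩ := hsub (interior_subset hx')
    rwa [hD.deriv]
  have hlim : Tendsto (fun r => G r + M * (t - r)) (𝓝[>] 0)
      (𝓝 (∫ x, (Real.log (f x) - logLik ρ θ x) ∂q + M * (t - 0))) :=
    hG.add ((Continuous.tendsto (by fun_prop) 0).mono_left nhdsWithin_le_nhds)
  have hle := ge_of_tendsto (b := F t) hlim (by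
    filter_upwards [Ioo_mem_nhdsGT ht.1, eventually_mul_le L (c := 1 / 4) (by norm_num)]
      with r hr hrL
    linarith [hmv r hr, hFG r hr.1 hrL])
  rw [sub_zero] at hle
  linarith

end EMDescent
end

noncomputable section

namespace EMDescent

variable {m d : ℕ} {ρ : Euc m → Euc d → ℝ} {Lθ Lx L : ℝ≥0} {Ω : Type*} [MeasurableSpace Ω]
  {P : Measure Ω} {W : ℝ≥0 → Ω → Euc d} {ϑ : ℝ → Euc m} {Z : ℝ → Ω → Euc d} {θk θf : Euc m}
  {qk : Measure (Euc d)} {h : ℝ} {k : ℕ} {f : Euc d → ℝ} {t : ℝ}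

/-! ### Descent along the interpolation -/

/-- The frozen parameter stays close to the current one. -/
lemma IsInterpolation.mul_norm_sub_le (hint : IsInterpolation ρ h k θk qk θf P W ϑ Z)
    (h_pos : 0 < h) (h_le : h * L ≤ 1 / 4)
    (hθf : θf = ϑ (k * h) ∨ θf = ϑ ((k + 1) * h)) {s : ℝ} (hs : s ∈ Icc 0 h) :
    L * ‖θk + s • ∫ x, gradTheta ρ θk x ∂qk - θf‖ ≤ 1 / 4 * ‖∫ x, gradTheta ρ θk x ∂qk‖ := by
  set g := ∫ x, gradTheta ρ θk x ∂qk with hg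
  -- Both choices of the frozen parameter are endpoints of the segment traced by the path, whose
  -- length is `h ‖g‖`.
  have h1 : ‖θk + s • g - θf‖ ≤ h * ‖g‖ := by
    rcases hθf with hθf | hθf
    · rw [hθf, hint.theta_init, add_sub_cancel_left, norm_smul, Real.norm_of_nonneg hs.1]
      exact mul_le_mul_of_nonneg_right hs.2 (norm_nonneg g)
    · rw [hθf, hint.theta_eq (t := (k + 1) * h) ⟨by linarith, le_rfl⟩, ← hg,
        add_sub_add_left_eq_sub, ← sub_smul, norm_smul, Real.norm_eq_abs]
      refine mul_le_mul_of_nonneg_right ?_ (norm_nonneg g)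
      rw [abs_le]
      constructor <;> linarith [hs.1, hs.2]
  calc L * ‖θk + s • g - θf‖ ≤ L * (h * ‖g‖) := by gcongr
    _ = h * L * ‖g‖ := by ring
    _ ≤ _ := by gcongr

lemma sub_mem_Ioc (ht : t ∈ Ioc (k * h) ((k + 1) * h)) : t - k * h ∈ Ioc 0 h :=
  ⟨sub_pos.2 ht.1, by linarith [ht.2]⟩

lemma IsInterpolation.freeEnergy_eq [IsProbabilityMeasure P]
    (hint : IsInterpolation ρ h k θk qk θf P W ϑ Z) (hqk : IsP2 qk)
    (hg : LipschitzGradient ρ Lθ Lx) (hpos : ∀ θ x, 0 < ρ θ x) (hθ : Lθ ≤ L) (hx : Lx ≤ L)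
    (h_pos : 0 < h) (h_le : h * L ≤ 1 / 4) (ht : t ∈ Ioc (k * h) ((k + 1) * h)) :
    freeEnergy ρ (ϑ t) (P.map (Z t)) = (freeEnergyPath ρ qk (gradX ρ θf) θk
      (∫ x, gradTheta ρ θk x ∂qk) (t - k * h) : EReal) := by
  have hprob := hqk.isProbabilityMeasure
  have hb := hg.lipschitzWith_gradX hθ hx θf
  have hs := sub_mem_Ioc ht
  rw [hint.map_eq h_pos hb.continuous.measurable ht, hint.theta_eq (Ioc_subset_Icc_self ht),
    freeEnergy_map_emStep hqk.integrable_norm_sq hg hpos hb θk _ hs.1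
      ((mul_le_mul_of_nonneg_right hs.2 L.coe_nonneg).trans h_le)]

theorem IsInterpolation.exists_hasDerivWithinAt [IsProbabilityMeasure P]
    (hint : IsInterpolation ρ h k θk qk θf P W ϑ Z) (hqk : IsP2 qk)
    (hg : LipschitzGradient ρ Lθ Lx) (hpos : ∀ θ x, 0 < ρ θ x) (hθ : Lθ ≤ L) (hx : Lx ≤ L)
    (h_pos : 0 < h) (h_le : h * L ≤ 1 / 4) (hθf : θf = ϑ (k * h) ∨ θf = ϑ ((k + 1) * h))
    (ht : t ∈ Ioc (k * h) ((k + 1) * h)) :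
    ∃ D : ℝ, HasDerivWithinAt (fun s => (freeEnergy ρ (ϑ s) (P.map (Z s))).toReal) D
        (Icc (k * h) ((k + 1) * h)) t ∧
      ∀ f, IsDiffDensity (P.map (Z t)) f →
        (D : EReal) ≤ ((-(1 / 2) : ℝ) : EReal) *
          ((extFisher ρ (ϑ t) (P.map (Z t)) f : ℝ≥0∞) : EReal) +
            ((6 * L ^ 2 * d * (t - k * h) : ℝ) : EReal) := by
  have hprob := hqk.isProbabilityMeasure
  have hq2 := hqk.integrable_norm_sq
  have hb := hg.lipschitzWith_gradX hθ hx θf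
  have hs := sub_mem_Ioc ht
  have hsL := (mul_le_mul_of_nonneg_right hs.2 L.coe_nonneg).trans h_le
  have hmap := hint.map_eq h_pos hb.continuous.measurable ht
  have hF := fun s (hs : s ∈ Ioc (k * h) ((k + 1) * h)) =>
    hint.freeEnergy_eq hqk hg hpos hθ hx h_pos h_le hs
  obtain ⟨D, hD, hle⟩ := exists_hasDerivAt_freeEnergyPath_le hq2 hg hθ hx θk θf _ rfl hs.1 hsL
    (hint.mul_norm_sub_le h_pos h_le hθf (Ioc_subset_Icc_self hs))
  refine ⟨D, ?_, fun f hf => ?_⟩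
  -- The path function is differentiable from both sides even at step length `h`; it agrees with the
  -- free energy only inside the interval, hence the derivative within `Icc`.
  · refine (hD.comp_sub_const t (k * h)).hasDerivWithinAt.congr_of_eventuallyEq ?_
      (by rw [hF t ht, EReal.toReal_coe])
    filter_upwards [self_mem_nhdsWithin, mem_nhdsWithin_of_mem_nhds (lt_mem_nhds ht.1)]
      with s hs1 hs2
    rw [hF s ⟨hs2, hs1.2⟩, EReal.toReal_coe]
  · rw [hmap] at hf ⊢
    rw [extFisher_map_emStep hq2 hg hpos hb hθ hx (ϑ t) hs.1 hsL hf,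
      hint.theta_eq (Ioc_subset_Icc_self ht), EReal.coe_ennreal_ofReal,
      max_eq_left (fisherPath_nonneg _ _), ← EReal.coe_mul, ← EReal.coe_add,
      EReal.coe_le_coe_iff]
    exact hle

theorem IsInterpolation.limsup_le [IsProbabilityMeasure P]
    (hint : IsInterpolation ρ h k θk qk θf P W ϑ Z) (hqk : IsP2 qk)
    (hg : LipschitzGradient ρ Lθ Lx) (hpos : ∀ θ x, 0 < ρ θ x) (hθ : Lθ ≤ L) (hx : Lx ≤ L)
    (h_pos : 0 < h) (h_le : h * L ≤ 1 / 4) (hθf : θf = ϑ (k * h) ∨ θf = ϑ ((k + 1) * h))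
    (hf : IsDiffDensity qk f) :
    limsup (fun s : ℝ => (freeEnergy ρ (ϑ s) (P.map (Z s)) - freeEnergy ρ θk qk) /
        ((s - k * h : ℝ) : EReal)) (𝓝[>] (k * h : ℝ)) ≤
      ((-(1 / 2) : ℝ) : EReal) * ((extFisher ρ θk qk f : ℝ≥0∞) : EReal) := by
  have hprob := hqk.isProbabilityMeasure
  have hq2 := hqk.integrable_norm_sq
  have hF := fun s (hs : s ∈ Ioc (k * h) ((k + 1) * h)) =>
    hint.freeEnergy_eq hqk hg hpos hθ hx h_pos h_le hs
  -- Arguing by contradiction yields a real `M` strictly between the two extended reals, so that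
  -- eventual bounds by `M` are enough.
  by_contra! hlt
  obtain ⟨M, hM1, hM2⟩ := EReal.lt_iff_exists_real_btwn.1 hlt
  refine hM2.not_ge (limsup_le_of_le (by isBoundedDefault) ?_)
  have hshift : Tendsto (fun s : ℝ => s - k * h) (𝓝[>] (k * h)) (𝓝[>] 0) := by
    refine tendsto_nhdsWithin_iff.2 ⟨?_, ?_⟩
    · have : Tendsto (fun s : ℝ => s - k * h) (𝓝 (k * h)) (𝓝 (k * h - k * h)) :=
        Continuous.tendsto (by fun_prop) _
      rw [sub_self] at this
      exact this.mono_left nhdsWithin_le_nhds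
    · filter_upwards [self_mem_nhdsWithin] with s hs
      exact sub_pos.2 (mem_Ioi.1 hs)
  have hIoc : ∀ᶠ s : ℝ in 𝓝[>] (k * h), s ∈ Ioc (k * h) ((k + 1) * h) :=
    Ioc_mem_nhdsGT (by linarith)
  by_cases hi : Integrable (fun x => Real.log (f x)) qk
  · have hev := hshift.eventually (eventually_freeEnergyPath_sub_le hq2 hg hpos hθ hx θk θf _
      rfl (by
        filter_upwards [Ioc_mem_nhdsGT h_pos] with s hs
        exact hint.mul_norm_sub_le h_pos h_le hθf ⟨hs.1.le, hs.2⟩) hf hi hM1)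
    filter_upwards [hev, hIoc] with s hs hs'
    rw [hF s hs', freeEnergy_eq_coe hg hpos θk hq2 hf.measurable hf.eq_withDensity hi,
      ← EReal.coe_sub, ← EReal.coe_div, EReal.coe_le_coe_iff, div_le_iff₀ (sub_mem_Ioc hs').1]
    exact hs
  -- The initial free energy is `⊤` while all later ones are finite, so each quotient is `⊥`.
  · filter_upwards [hIoc] with s hs
    rw [hF s hs, freeEnergy_eq_top hg hpos θk hq2 hf.measurable hf.eq_withDensity hi,
      EReal.sub_top, EReal.bot_div_of_pos_ne_top
        (EReal.coe_pos.2 (sub_mem_Ioc hs).1) (EReal.coe_ne_top _)]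
    exact bot_le

end EMDescent

end

/-! ### Assembly of the descent lemma. -/

theorem mainTheorem8 {m d : ℕ} (ρ : EMDescent.Euc m → EMDescent.Euc d → ℝ)
    (hρ : EMDescent.RegularModel ρ)
    (Lθ Lx : ℝ≥0) (hgrad : EMDescent.LipschitzGradient ρ Lθ Lx)
    (L : ℝ) (hL : L = max (Lθ : ℝ) (Lx : ℝ))
    (h : ℝ) (h_pos : 0 < h) (h_le : 4 * L * h ≤ 1) (k : ℕ)
    (θk : EMDescent.Euc m) (qk : Measure (EMDescent.Euc d)) (hqk : EMDescent.IsP2 qk)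
    {Ω : Type*} [MeasurableSpace Ω] (P : Measure Ω) [IsProbabilityMeasure P]
    (W : ℝ≥0 → Ω → EMDescent.Euc d)
    (ϑ : ℝ → EMDescent.Euc m) (Z : ℝ → Ω → EMDescent.Euc d)
    (θf : EMDescent.Euc m) (hθf : θf = ϑ (k * h) ∨ θf = ϑ ((k + 1) * h))
    (hint : EMDescent.IsInterpolation ρ h k θk qk θf P W ϑ Z) :
    (∀ t ∈ Ioc (k * h) ((k + 1) * h),
      EMDescent.IsP2 (P.map (Z t)) ∧
      (∃ f, EMDescent.IsDiffDensity (P.map (Z t)) f) ∧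
      EMDescent.freeEnergy ρ (ϑ t) (P.map (Z t)) ≠ ⊤ ∧
      ∃ D : ℝ,
        HasDerivWithinAt (fun s => (EMDescent.freeEnergy ρ (ϑ s) (P.map (Z s))).toReal) D
          (Icc (k * h) ((k + 1) * h)) t ∧
        ∀ f, EMDescent.IsDiffDensity (P.map (Z t)) f →
          (D : EReal) ≤ ((-(1 / 2) : ℝ) : EReal) *
              ((EMDescent.extFisher ρ (ϑ t) (P.map (Z t)) f : ℝ≥0∞) : EReal) +
            ((6 * L ^ 2 * d * (t - k * h) : ℝ) : EReal)) ∧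
    (∀ f, EMDescent.IsDiffDensity qk f →
      limsup (fun s : ℝ =>
          (EMDescent.freeEnergy ρ (ϑ s) (P.map (Z s)) - EMDescent.freeEnergy ρ θk qk) /
            ((s - k * h : ℝ) : EReal)) (𝓝[>] (k * h : ℝ)) ≤
        ((-(1 / 2) : ℝ) : EReal) * ((EMDescent.extFisher ρ θk qk f : ℝ≥0∞) : EReal)) := by
  have hprob := hqk.isProbabilityMeasure
  have hq2 := hqk.integrable_norm_sq
  obtain ⟨L', rfl, hθ, hx⟩ : ∃ L' : ℝ≥0, L = L' ∧ Lθ ≤ L' ∧ Lx ≤ L' :=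
    ⟨max Lθ Lx, by rw [hL, NNReal.coe_max], le_max_left _ _, le_max_right _ _⟩
  have h_le' : h * L' ≤ 1 / 4 := by linarith
  have hb := hgrad.lipschitzWith_gradX hθ hx θf
  refine ⟨fun t ht => ⟨?_, ?_, ?_, hint.exists_hasDerivWithinAt hqk hgrad hρ.pos hθ hx h_pos h_le'
    hθf ht⟩, fun f hf => hint.limsup_le hqk hgrad hρ.pos hθ hx h_pos h_le' hθf hf⟩
  · rw [hint.map_eq h_pos hb.continuous.measurable ht]
    exact EMDescent.isP2_map_emStep hq2 hb (sub_pos.2 ht.1)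
  · rw [hint.map_eq h_pos hb.continuous.measurable ht]
    exact ⟨_, EMDescent.isDiffDensity_stepDensity hq2 hb (sub_pos.2 ht.1)⟩
  · rw [hint.freeEnergy_eq hqk hgrad hρ.pos hθ hx h_pos h_le' ht]
    exact EReal.coe_ne_top _
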